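/- Let $k$ be a field of characteristic zero. **Setting.** Let $\mathsf{FB}$ be the category of finite sets and bijections. A $k(\mathsf{FB}\times\mathsf{FB})$-module is a functor from $\mathsf{FB}\times\mathsf{FB}$ to $k$-vector spaces; these form a symmetric monoidal category under Day convolution $(M\circledcirc N)(X,Y)=\bigoplus M(X_0,Y_0)\otimes N(X_1,Y_1)$, the sum over all ordered decompositions $X=X_0\amalg X_1$, $Y=Y_0\amalg Y_1$, with the symmetry induced by that of $\otimes$ (without signs). Write $S_\circledcirc^d M$ and $\Lambda_\circledcirc^d M$ for the quotients of $M^{\circledcirc d}$ by the relations $\sigma v=v$, respectively $\sigma v=\operatorname{sgn}(\sigma)v$, for $\sigma\in\mathfrak S_d$, and $S_\circledcirc^*M=\bigoplus_{d\ge 0}S_\circledcirc^dM$, $\Lambda_\circledcirc^*M=\bigoplus_{d\ge 0}\Lambda_\circledcirc^dM$. Let $k_{(1,1)}$ be the module with value $k$ on pairs of one-point sets and $0$ on other pairs, so that $(M\circledcirc k_{(1,1)})(X,Y)\cong\bigoplus_{s\in X,\,t\in Y}M(X\setminus\{s\},Y\setminus\{t\})$; the corresponding components of a morphism to $M\circledcirc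 k_{(1,1)}$ are called its components at $(s,t)$. **Dioperads without unit.** A dioperad without unit is a $k(\mathsf{FB}\times\mathsf{FB})$-module $D$ with $D(\emptyset,\emptyset)=0$ and a morphism $\mu_D:D\circledcirc D\to D\circledcirc k_{(1,1)}$ that is * *diagonal*: the component $D(X_0,Y_0)\otimes D(X_1,Y_1)\to D(X\setminus\{s\},Y\setminus\{t\})$ is zero unless $s$ and $t$ lie in different pieces (that is, $(s,t)\in X_0\times Y_1$ or $(s,t)\in X_1\times Y_0$); * *symmetric*: $\mu_D$ is invariant under the symmetry of $D\circledcirc D$, i.e. it factors through $S_\circledcirc^2D$; * *associative*: the composite $S_\circledcirc^3D\to S_\circledcirc^2D\circledcirc k_{(1,1)}\to D\circledcirc k_{(1,1)}\circledcirc k_{(1,1)}\to D\circledcirc\Lambda_\circledcirc^2k_{(1,1)}$ is zero. Here, and below, $\mu_D$ is extended to $S_\circledcirc^nD\to S_\circledcirc^{n-1}D\circledcirc k_{(1,1)}$ for $n\ge 2$ as the composite of the coproduct $S_\circledcirc^nD\to S_\circledcirc^{n-2}D\circledcirc S_\circledcirc^2D$, of $\mu_D:S_\circledcirc^2D\to D\circledcirc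 k_{(1,1)}$ and of the product $S_\circledcirc^{n-2}D\circledcirc D\to S_\circledcirc^{n-1}D$; the extension is zero for $n<2$. For exterior powers, let $\mu_D^-:\Lambda_\circledcirc^2D\to D\circledcirc k_{(1,1)}$ be the morphism that on $D(X_0,Y_0)\otimes D(X_1,Y_1)$ has the component at $(s,t)$ of $\mu_D$ if $s\in X_0$, $t\in Y_1$, minus this component if $s\in X_1$, $t\in Y_0$, and zero otherwise; it is extended in the same way to $\Lambda_\circledcirc^nD\to\Lambda_\circledcirc^{n-1}D\circledcirc k_{(1,1)}$. A morphism of dioperads without unit is a morphism of $k(\mathsf{FB}\times\mathsf{FB})$-modules compatible with the structure morphisms; this defines the category $\mathsf{DiOpd}^{\mathrm{nu}}$. **Walled Brauer categories.** Let $(k\,\mathsf{uwb})_\pm$ be the $k$-linear category whose objects are pairs of finite sets, with $$\operatorname{Hom}\big((X,Y),(U,V)\big)=\bigoplus_{n\ge 0}k\big[\operatorname{Bij}(X\amalg\mathbf n,U)\times\operatorname{Bij}(Y\amalg\mathbf n,V)\big]\otimes_{k\mathfrak S_n}k^{\pm},$$ where $\mathbf n=\{1,\dots,n\}$, where $\mathfrak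 S_n$ acts diagonally on the two copies of $\mathbf n$, and where $k^{+}$ is the trivial and $k^-$ the sign representation; composition is induced by composition of bijections and concatenation of the walled pairs $\mathbf n$. (The summand indexed by $n$ is zero unless $|U|-|X|=|V|-|Y|=n$.) Let $(k\,\mathsf{dwb})_\pm$ be the opposite category, and $k\,\mathsf{dwb}=(k\,\mathsf{dwb})_+$. A $(k\,\mathsf{dwb})_\pm$-module is a $k$-linear functor from $(k\,\mathsf{dwb})_\pm$ to $k$-vector spaces. It has an underlying $k(\mathsf{FB}\times\mathsf{FB})$-module, given by restriction along the functor $\mathsf{FB}\times\mathsf{FB}\to(k\,\mathsf{dwb})_\pm$ that sends a pair of bijections to the opposite of the degree-zero morphism given by the inverse bijections. For $s\in X$, $t\in Y$ let $\beta_{s,t}:(X\setminus\{s\},Y\setminus\{t\})\to(X,Y)$ be the morphism of $(k\,\mathsf{uwb})_\pm$ with $n=1$ given by the two inclusions and $1\mapsto s$, $1\mapsto t$. **Theorem.** 1. There is a functor $\Phi_+:\mathsf{DiOpd}^{\mathrm{nu}}\to k\,\mathsf{dwb}\text{-}\mathsf{mod}$ and an isomorphism, natural in $D$, of the underlying $k(\mathsf{FB}\times\mathsf{FB})$-module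 of $\Phi_+(D)$ with $S_\circledcirc^*D$, under which, for every pair $(X,Y)$ of finite sets and all $s\in X$, $t\in Y$, the opposite of $\beta_{s,t}$ acts as the component $S_\circledcirc^*D(X,Y)\to S_\circledcirc^*D(X\setminus\{s\},Y\setminus\{t\})$ at $(s,t)$ of the extension of $\mu_D$. 2. There is a functor $\Phi_-:\mathsf{DiOpd}^{\mathrm{nu}}\to(k\,\mathsf{dwb})_-\text{-}\mathsf{mod}$ and an isomorphism, natural in $D$, of the underlying $k(\mathsf{FB}\times\mathsf{FB})$-module of $\Phi_-(D)$ with $\Lambda_\circledcirc^*D$, under which, for all $(X,Y)$, $s\in X$, $t\in Y$, the opposite of $\beta_{s,t}$ acts as the component $\Lambda_\circledcirc^*D(X,Y)\to\Lambda_\circledcirc^*D(X\setminus\{s\},Y\setminus\{t\})$ at $(s,t)$ of the extension of $\mu_D^-$. Moreover, in both cases and for each $D$, the module structure is determined by this description: if $A$ is a $k\,\mathsf{dwb}$-module (respectively a $(k\,\mathsf{dwb})_-$-module) with an isomorphism of its underlying $k(\mathsf{FB}\times\mathsf{FB})$-module with $S_\circledcirc^*D$ (respectively $\Lambda_\circledcirc^*D$)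 for which the opposites of all $\beta_{s,t}$ act by the same formula, then there is a unique isomorphism $\Phi_\pm(D)\cong A$ of modules that is compatible with the two isomorphisms. -/

import Mathlib

open CategoryTheory TensorProduct DirectSum

universe v

noncomputable section

/-- Objects of `FB`: finite sets. -/
structure FB : Type 1 where
  carrier : Type
  [finite : Finite carrier]

namespace FB

attribute [instance] FB.finite

instance : CoeSort FB Type := ⟨FB.carrier⟩

/-- The category `FB` of finite sets and bijections. -/
instance : Category FB where
  Hom X Y := X.carrier ≃ Y.carrier
  id X := Equiv.refl X.carrier
  comp f g := f.trans g

/-- The subset of a finite set cut out by a predicate. -/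
abbrev sub (X : FB) (p : X → Prop) : FB := ⟨{x : X // p x}⟩

/-- `X \ {s}`. -/
abbrev del (X : FB) (s : X) : FB := X.sub (fun x => x ≠ s)

end FB

/-- `k(FB × FB)`-modules: functors from `FB × FB` to `k`-vector spaces. -/
abbrev BiMod (k : Type v) [Field k] := (FB × FB) ⥤ ModuleCat.{v} k

/-- A morphism of `FB × FB` from a pair of bijections. -/
abbrev biHom {P Q : FB × FB} (e : P.1.carrier ≃ Q.1.carrier) (f : P.2.carrier ≃ Q.2.carrier) :
    P ⟶ Q := Prod.mkHom (X₁ := P.1) (Y₁ := P.2) (X₂ := Q.1) (Y₂ := Q.2) e f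

/-- `(X \ {s}, Y \ {t})`. -/
abbrev biDel (P : FB × FB) (s : P.1) (t : P.2) : FB × FB := (P.1.del s, P.2.del t)

/-! ### Ordered decompositions -/

/-- Ordered decompositions `X = ∐ᵢ Xᵢ`, `Y = ∐ᵢ Yᵢ` of a pair `(X, Y)` into pieces indexed by `I`,
given by the maps which record the index of the piece that contains an element. -/
abbrev Dec (P : FB × FB) (I : Type) := (P.1 → I) × (P.2 → I)

namespace Dec

variable {I J : Type}

/-- The piece `(Xᵢ, Yᵢ)`. -/
abbrev part {P : FB × FB} (c : Dec P I) (i : I) : FB × FB :=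
  (P.1.sub (fun x => c.1 x = i), P.2.sub (fun y => c.2 y = i))

/-- Transport of a decomposition along a bijection. -/
abbrev push {P Q : FB × FB} (φ : P ⟶ Q) (c : Dec P I) : Dec Q I :=
  (fun x => c.1 ((φ.1 : P.1.carrier ≃ Q.1.carrier).symm x),
   fun y => c.2 ((φ.2 : P.2.carrier ≃ Q.2.carrier).symm y))

/-- The restriction of a bijection to a piece. -/
abbrev pushMap {P Q : FB × FB} (φ : P ⟶ Q) (c : Dec P I) (i : I) :
    c.part i ⟶ (c.push φ).part i :=
  biHom
    ((φ.1 : P.1.carrier ≃ Q.1.carrier).subtypeEquiv (fun x => by simp))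
    ((φ.2 : P.2.carrier ≃ Q.2.carrier).subtypeEquiv (fun x => by simp))

/-- Change of the names of the pieces along a bijection. -/
abbrev relabel {P : FB × FB} (σ : I ≃ J) (c : Dec P I) : Dec P J :=
  (fun x => σ (c.1 x), fun y => σ (c.2 y))

/-- The piece named `j` after relabelling is the piece that was named `σ⁻¹ j`. -/
abbrev relabelMap {P : FB × FB} (σ : I ≃ J) (c : Dec P I) (j : J) :
    c.part (σ.symm j) ⟶ (c.relabel σ).part j :=
  biHom
    (Equiv.subtypeEquivRight (fun x => by simp [Equiv.eq_symm_apply]))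
    (Equiv.subtypeEquivRight (fun x => by simp [Equiv.eq_symm_apply]))

end Dec

open Classical in
/-- The map of direct sums which sends the summand `i` to the summand `p i`. -/
def dsMap {k : Type v} [Field k] {ι κ : Type} {A : ι → Type v} {B : κ → Type v}
    [∀ i, AddCommGroup (A i)] [∀ i, Module k (A i)] [∀ i, AddCommGroup (B i)]
    [∀ i, Module k (B i)] (p : ι → κ) (f : ∀ i, A i →ₗ[k] B (p i)) :
    (⨁ i, A i) →ₗ[k] (⨁ j, B j) :=
  DirectSum.toModule k ι _ (fun i => DirectSum.lof k κ B (p i) ∘ₗ f i)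

section dsMap

variable {k : Type v} [Field k] {ι κ μ : Type} {A : ι → Type v} {B : κ → Type v} {C : μ → Type v}
    [∀ i, AddCommGroup (A i)] [∀ i, Module k (A i)] [∀ i, AddCommGroup (B i)]
    [∀ i, Module k (B i)] [∀ i, AddCommGroup (C i)] [∀ i, Module k (C i)]

open Classical in
lemma dsMap_lof (p : ι → κ) (f : ∀ i, A i →ₗ[k] B (p i)) (i : ι) (a : A i) :
    dsMap p f (DirectSum.lof k ι A i a) = DirectSum.lof k κ B (p i) (f i a) := by
  simp [dsMap]

lemma dsMap_id : dsMap (k := k) (A := A) (B := A) (fun i => i) (fun _ => LinearMap.id)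
    = LinearMap.id := by
  classical
  refine DirectSum.linearMap_ext _ fun i => LinearMap.ext fun a => ?_
  simp [dsMap]

lemma dsMap_comp (p : ι → κ) (f : ∀ i, A i →ₗ[k] B (p i)) (q : κ → μ)
    (g : ∀ i, B i →ₗ[k] C (q i)) :
    dsMap q g ∘ₗ dsMap p f = dsMap (fun i => q (p i)) (fun i => g (p i) ∘ₗ f i) := by
  classical
  refine DirectSum.linearMap_ext _ fun i => LinearMap.ext fun a => ?_
  simp [dsMap]

end dsMap

section Day

variable {k : Type v} [Field k]

lemma BiMod.map_eq (M : BiMod k) {P Q Q' R : FB × FB} {f : P ⟶ Q} {g : Q ⟶ R} {f' : P ⟶ Q'}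
    {g' : Q' ⟶ R} (h : f ≫ g = f' ≫ g') (x : M.obj P) :
    (M.map g).hom ((M.map f).hom x) = (M.map g').hom ((M.map f').hom x) := by
  have h2 : M.map f ≫ M.map g = M.map f' ≫ M.map g' := by rw [← M.map_comp, ← M.map_comp, h]
  exact congrArg (fun l => l.hom x) h2

lemma BiMod.map_map (M : BiMod k) {P Q R : FB × FB} (f : P ⟶ Q) (g : Q ⟶ R) (x : M.obj P) :
    (M.map g).hom ((M.map f).hom x) = (M.map (f ≫ g)).hom x := by
  rw [M.map_comp]; rfl

lemma BiMod.nat {M N : BiMod k} (α : M ⟶ N) {P Q : FB × FB} (f : P ⟶ Q) (x : M.obj P) :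
    (α.app Q).hom ((M.map f).hom x) = (N.map f).hom ((α.app P).hom x) := by
  exact congrArg (fun g => g.hom x) (α.naturality f)

/-- Day convolution
`(M ⊚ N)(X, Y) = ⨁ M(X₀, Y₀) ⊗ N(X₁, Y₁)`, over ordered decompositions into two pieces. -/
def day (M N : BiMod k) : BiMod k where
  obj P := ModuleCat.of k (⨁ c : Dec P (Fin 2), (M.obj (c.part 0)) ⊗[k] (N.obj (c.part 1)))
  map {P Q} φ := ModuleCat.ofHom (dsMap (fun c => c.push φ) (fun c =>
    TensorProduct.map (M.map (c.pushMap φ 0)).hom (N.map (c.pushMap φ 1)).hom))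
  map_id P := by
    refine ModuleCat.hom_ext (Eq.trans ?_ dsMap_id)
    refine congrArg (dsMap _) (funext fun c => ?_)
    change TensorProduct.map (M.map (𝟙 (c.part 0))).hom (N.map (𝟙 (c.part 1))).hom = _
    rw [M.map_id, N.map_id]
    exact TensorProduct.map_id
  map_comp f g := by
    refine ModuleCat.hom_ext (Eq.trans ?_ (dsMap_comp _ _ _ _).symm)
    refine congrArg (dsMap _) (funext fun c => ?_)
    change TensorProduct.map (M.map (c.pushMap f 0 ≫ (c.push f).pushMap g 0)).hom
      (N.map (c.pushMap f 1 ≫ (c.push f).pushMap g 1)).hom = _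
    rw [M.map_comp, N.map_comp]
    exact TensorProduct.map_comp _ _ _ _

/-- Functoriality of Day convolution in both variables. -/
def dayMap {M M' N N' : BiMod k} (f : M ⟶ M') (g : N ⟶ N') : day M N ⟶ day M' N' where
  app P := ModuleCat.ofHom (dsMap (fun c => c) (fun c =>
    TensorProduct.map (f.app (c.part 0)).hom (g.app (c.part 1)).hom))
  naturality P Q φ := by
    refine ModuleCat.hom_ext (Eq.trans (dsMap_comp _ _ _ _) (Eq.trans ?_ (dsMap_comp _ _ _ _).symm))
    refine congrArg (dsMap _) (funext fun c => TensorProduct.ext' fun m n => ?_)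
    exact congrArg₂ (· ⊗ₜ[k] ·) (BiMod.nat f _ m) (BiMod.nat g _ n)

/-- The symmetry `M ⊚ N ≅ N ⊚ M`, given by the symmetry of `⊗` on each summand. -/
def dayBraid (M N : BiMod k) : day M N ⟶ day N M where
  app P := ModuleCat.ofHom (dsMap (fun c => c.relabel (Equiv.swap 0 1)) (fun c =>
    TensorProduct.map (N.map (c.relabelMap (Equiv.swap 0 1) 0)).hom
      (M.map (c.relabelMap (Equiv.swap 0 1) 1)).hom ∘ₗ
      (TensorProduct.comm k (M.obj (c.part 0)) (N.obj (c.part 1))).toLinearMap))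
  naturality P Q φ := by
    refine ModuleCat.hom_ext (Eq.trans (dsMap_comp _ _ _ _) (Eq.trans ?_ (dsMap_comp _ _ _ _).symm))
    refine congrArg (dsMap _) (funext fun c => TensorProduct.ext' fun m n => ?_)
    refine congrArg₂ (· ⊗ₜ[k] ·) ?_ ?_
    · exact BiMod.map_eq N (f := c.pushMap φ 1) (g := (c.push φ).relabelMap (Equiv.swap 0 1) 0)
        (f' := c.relabelMap (Equiv.swap 0 1) 0)
        (g' := (c.relabel (Equiv.swap 0 1)).pushMap φ 0) rfl n
    · exact BiMod.map_eq M (f := c.pushMap φ 0) (g := (c.push φ).relabelMap (Equiv.swap 0 1) 1)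
        (f' := c.relabelMap (Equiv.swap 0 1) 1)
        (g' := (c.relabel (Equiv.swap 0 1)).pushMap φ 1) rfl m

/-- `k_(1,1)`: the value is `k` on pairs of one-point sets and zero on all other pairs. -/
def kk11 (k : Type v) [Field k] : BiMod k where
  obj P := ModuleCat.of k (PLift (Nat.card P.1 = 1 ∧ Nat.card P.2 = 1) → k)
  map {P Q} φ := ModuleCat.ofHom (LinearMap.funLeft k k (fun h => PLift.up
    ⟨(Nat.card_congr (φ.1 : P.1.carrier ≃ Q.1.carrier)).trans h.down.1,
      (Nat.card_congr (φ.2 : P.2.carrier ≃ Q.2.carrier)).trans h.down.2⟩))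
  map_id _ := rfl
  map_comp _ _ := rfl

/-! ### Components of a morphism `M ⊚ M → M ⊚ k_(1,1)` -/

open Classical in
/-- The decomposition of `(X, Y)` into `(X \ {s}, Y \ {t})` and `({s}, {t})`. -/
def pointDec (P : FB × FB) (s : P.1) (t : P.2) : Dec P (Fin 2) :=
  (fun x => if x = s then 1 else 0, fun y => if y = t then 1 else 0)

lemma card_pointDec (P : FB × FB) (s : P.1) (t : P.2) :
    Nat.card ((pointDec P s t).part 1).1 = 1 ∧ Nat.card ((pointDec P s t).part 1).2 = 1 := by
  simp [pointDec]

/-- The first piece of `pointDec`. -/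
def pointDecMap (P : FB × FB) (s : P.1) (t : P.2) : (pointDec P s t).part 0 ⟶ biDel P s t :=
  biHom (Equiv.subtypeEquivRight (fun x => by simp [pointDec]))
    (Equiv.subtypeEquivRight (fun x => by simp [pointDec]))

/-- The component `(M ⊚ k_(1,1))(X, Y) → M(X \ {s}, Y \ {t})` for `s ∈ X`, `t ∈ Y`: the projection
to the summand of the decomposition into `(X \ {s}, Y \ {t})` and `({s}, {t})`. These are the
components of the isomorphism of `(M ⊚ k_(1,1))(X, Y)` with `⨁ M(X \ {s}, Y \ {t})`. -/
def proj11 (M : BiMod k) (P : FB × FB) (s : P.1) (t : P.2) :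
    (day M (kk11 k)).obj P →ₗ[k] M.obj (biDel P s t) :=
  (M.map (pointDecMap P s t)).hom ∘ₗ
    (TensorProduct.rid k (M.obj ((pointDec P s t).part 0))).toLinearMap ∘ₗ
    LinearMap.lTensor _ (LinearMap.proj (PLift.up (card_pointDec P s t)) :
      (PLift _ → k) →ₗ[k] k) ∘ₗ
    DirectSum.component k (Dec P (Fin 2))
      (fun c => (M.obj (c.part 0)) ⊗[k] ((kk11 k).obj (c.part 1))) (pointDec P s t)

open Classical in
/-- The component `M(X₀, Y₀) ⊗ M(X₁, Y₁) → M(X \ {s}, Y \ {t})` of `μ`, for a decomposition `c` of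
`(X, Y)` into `(X₀, Y₀)` and `(X₁, Y₁)`, and `s ∈ X`, `t ∈ Y`. -/
def muComp {M : BiMod k} (μ : day M M ⟶ day M (kk11 k)) (P : FB × FB) (c : Dec P (Fin 2))
    (s : P.1) (t : P.2) :
    M.obj (c.part 0) →ₗ[k] M.obj (c.part 1) →ₗ[k] M.obj (biDel P s t) :=
  TensorProduct.curry (proj11 M P s t ∘ₗ (μ.app P).hom ∘ₗ
    DirectSum.lof k (Dec P (Fin 2)) (fun c => (M.obj (c.part 0)) ⊗[k] (M.obj (c.part 1))) c)

/-- Diagonal morphisms: the component of `s`, `t` is zero if `s` and `t` belong to the same piece. -/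
def IsDiagonal {M : BiMod k} (μ : day M M ⟶ day M (kk11 k)) : Prop :=
  ∀ (P : FB × FB) (c : Dec P (Fin 2)) (s : P.1) (t : P.2), c.1 s = c.2 t → muComp μ P c s t = 0

/-- Symmetric morphisms: those invariant under the symmetry of `M ⊚ M`, that is, those which
factorize through the quotient `S²M` of `M ⊚ M` by the symmetric group. -/
def IsSymmetric {M : BiMod k} (μ : day M M ⟶ day M (kk11 k)) : Prop :=
  dayBraid M M ≫ μ = μ

end Day
section Powers

variable {k : Type v} [Field k]

/-! ### Symmetric and exterior powers -/

/-- The summand `⨂ᵢ M(Xᵢ, Yᵢ)` of a decomposition. -/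
abbrev tensPart (M : BiMod k) {P : FB × FB} {d : ℕ} (c : Dec P (Fin d)) : Type v :=
  ⨂[k] i : Fin d, M.obj (c.part i)

/-- The iterated Day convolution
`M^{⊚d}(X, Y) = ⨁ M(X₁, Y₁) ⊗ ⋯ ⊗ M(X_d, Y_d)`, over ordered decompositions into `d` pieces. -/
def tpow (d : ℕ) (M : BiMod k) : BiMod k where
  obj P := ModuleCat.of k (⨁ c : Dec P (Fin d), tensPart M c)
  map {P Q} φ := ModuleCat.ofHom (dsMap (fun c => c.push φ) (fun c =>
    PiTensorProduct.map (fun i => (M.map (c.pushMap φ i)).hom)))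
  map_id P := by
    refine ModuleCat.hom_ext (Eq.trans ?_ dsMap_id)
    refine congrArg (dsMap _) (funext fun c => ?_)
    change PiTensorProduct.map (fun i => (M.map (𝟙 (c.part i))).hom) = _
    simp only [M.map_id]
    exact PiTensorProduct.map_id
  map_comp f g := by
    refine ModuleCat.hom_ext (Eq.trans ?_ (dsMap_comp _ _ _ _).symm)
    refine congrArg (dsMap _) (funext fun c => ?_)
    change PiTensorProduct.map (fun i =>
      (M.map (c.pushMap f i ≫ (c.push f).pushMap g i)).hom) = _
    simp only [M.map_comp]
    exact PiTensorProduct.map_comp _ _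

/-- Functoriality of `M^{⊚d}` in `M`. -/
def tpowMap (d : ℕ) {M N : BiMod k} (f : M ⟶ N) : tpow d M ⟶ tpow d N where
  app P := ModuleCat.ofHom (dsMap (fun c => c) (fun c =>
    PiTensorProduct.map (fun i => (f.app (c.part i)).hom)))
  naturality P Q φ := by
    refine ModuleCat.hom_ext (Eq.trans (dsMap_comp _ _ _ _) (Eq.trans ?_ (dsMap_comp _ _ _ _).symm))
    refine congrArg (dsMap _) (funext fun c => ?_)
    refine (PiTensorProduct.map_comp _ _).symm.trans (Eq.trans ?_ (PiTensorProduct.map_comp _ _))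
    refine congrArg _ (funext fun i => LinearMap.ext fun x => ?_)
    exact BiMod.nat f _ x

/-- The place permutation action of `σ` on the summands of `M^{⊚d}(X, Y)`: the factor at place `i`
moves to place `σ i`. -/
def permAct (M : BiMod k) {d : ℕ} (σ : Equiv.Perm (Fin d)) (P : FB × FB) :
    (tpow d M).obj P →ₗ[k] (tpow d M).obj P :=
  dsMap (fun c => c.relabel σ) (fun c =>
    PiTensorProduct.map (fun j => (M.map (c.relabelMap σ j)).hom) ∘ₗ
      (PiTensorProduct.reindex k (fun i => M.obj (c.part i)) σ).toLinearMap)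

lemma permAct_aux (M : BiMod k) {d : ℕ} (σ : Equiv.Perm (Fin d)) {P : FB × FB} (c : Dec P (Fin d))
    (a : ∀ i, M.obj (c.part i)) :
    (PiTensorProduct.map (fun j => (M.map (c.relabelMap σ j)).hom) ∘ₗ
      (PiTensorProduct.reindex k (fun i => M.obj (c.part i)) σ).toLinearMap)
      (PiTensorProduct.tprod k a) =
    PiTensorProduct.tprod k (fun j => (M.map (c.relabelMap σ j)).hom (a (σ.symm j))) := by
  simp

lemma tens_ext {d : ℕ} {A : Fin d → Type v} [∀ i, AddCommGroup (A i)] [∀ i, Module k (A i)]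
    {B : Type v} [AddCommGroup B] [Module k B] {f g : (⨂[k] i, A i) →ₗ[k] B}
    (h : ∀ a, f (PiTensorProduct.tprod k a) = g (PiTensorProduct.tprod k a)) : f = g :=
  PiTensorProduct.ext (MultilinearMap.ext h)

lemma comp_eval {A B C : Type v} [AddCommGroup A] [Module k A] [AddCommGroup B] [Module k B]
    [AddCommGroup C] [Module k C] {g : B →ₗ[k] C} {f : A →ₗ[k] B} {a : A} {b : B} {c : C}
    (h : f a = b) (h' : g b = c) : (g ∘ₗ f) a = c := by
  subst h; exact h'

lemma permAct_mul (M : BiMod k) {d : ℕ} (σ τ : Equiv.Perm (Fin d)) (P : FB × FB) :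
    permAct M (σ * τ) P = permAct M σ P ∘ₗ permAct M τ P := by
  refine Eq.trans ?_ (dsMap_comp _ _ _ _).symm
  refine congrArg (dsMap _) (funext fun c => tens_ext fun a => ?_)
  refine (permAct_aux M (σ * τ) c a).trans (Eq.symm ?_)
  refine comp_eval (permAct_aux M τ c a) ((permAct_aux M σ (c.relabel τ) _).trans ?_)
  refine congrArg _ (funext fun j => ?_)
  exact BiMod.map_map M (c.relabelMap τ (σ.symm j)) ((c.relabel τ).relabelMap σ j) _

lemma permAct_nat (M : BiMod k) {d : ℕ} (σ : Equiv.Perm (Fin d)) {P Q : FB × FB} (φ : P ⟶ Q) :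
    permAct M σ Q ∘ₗ ((tpow d M).map φ).hom = ((tpow d M).map φ).hom ∘ₗ permAct M σ P := by
  refine Eq.trans (dsMap_comp _ _ _ _) (Eq.trans ?_ (dsMap_comp _ _ _ _).symm)
  refine congrArg (dsMap _) (funext fun c => tens_ext fun a => ?_)
  refine Eq.trans (comp_eval (PiTensorProduct.map_tprod _ a) (permAct_aux M σ (c.push φ) _))
    (Eq.symm (Eq.trans (comp_eval (permAct_aux M σ c a) (PiTensorProduct.map_tprod _ _)) ?_))
  refine congrArg _ (funext fun j => ?_)
  exact (BiMod.map_eq M (f := c.pushMap φ (σ.symm j)) (g := (c.push φ).relabelMap σ j)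
    (f' := c.relabelMap σ j) (g' := (c.relabel σ).pushMap φ j) rfl _).symm

lemma permAct_tpowMap {M N : BiMod k} {d : ℕ} (σ : Equiv.Perm (Fin d)) (f : M ⟶ N) (P : FB × FB) :
    permAct N σ P ∘ₗ ((tpowMap d f).app P).hom = ((tpowMap d f).app P).hom ∘ₗ permAct M σ P := by
  refine Eq.trans (dsMap_comp _ _ _ _) (Eq.trans ?_ (dsMap_comp _ _ _ _).symm)
  refine congrArg (dsMap _) (funext fun c => tens_ext fun a => ?_)
  refine Eq.trans (comp_eval (PiTensorProduct.map_tprod _ a) (permAct_aux N σ c _))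
    (Eq.symm (Eq.trans (comp_eval (permAct_aux M σ c a) (PiTensorProduct.map_tprod _ _)) ?_))
  exact congrArg _ (funext fun j => BiMod.nat f _ _)

/-- The two signs `+` and `-`. -/
inductive Twist
  | plus
  | minus

/-- The representation `k^±` of the symmetric group: trivial for `+`, the sign for `-`. -/
def Twist.chi {n : ℕ} : Twist → Equiv.Perm (Fin n) → ℤˣ
  | .plus, _ => 1
  | .minus, σ => Equiv.Perm.sign σ

lemma Twist.chi_mul {n : ℕ} (ε : Twist) (σ τ : Equiv.Perm (Fin n)) :
    ε.chi (σ * τ) = ε.chi σ * ε.chi τ := by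
  cases ε <;> simp [Twist.chi]

/-- The relations which define the coinvariants of the diagonal action of the symmetric group on
`M^{⊚d} ⊗ k^±`. -/
def powRel (ε : Twist) (d : ℕ) (M : BiMod k) (P : FB × FB) : Submodule k ((tpow d M).obj P) :=
  Submodule.span k {w | ∃ (σ : Equiv.Perm (Fin d)) (v : (tpow d M).obj P),
    w = (ε.chi σ : ℤ) • permAct M σ P v - v}

lemma powRel_le_map (ε : Twist) (d : ℕ) (M : BiMod k) {P Q : FB × FB} (φ : P ⟶ Q) :
    powRel ε d M P ≤ (powRel ε d M Q).comap ((tpow d M).map φ).hom := by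
  refine Submodule.span_le.2 ?_
  rintro _ ⟨σ, v, rfl⟩
  refine Submodule.subset_span ⟨σ, ((tpow d M).map φ).hom v, ?_⟩
  rw [map_sub, map_zsmul]
  exact congrArg (fun x => (ε.chi σ : ℤ) • x - ((tpow d M).map φ).hom v)
    (LinearMap.congr_fun (permAct_nat M σ φ) v).symm

lemma powRel_le_tpowMap (ε : Twist) (d : ℕ) {M N : BiMod k} (f : M ⟶ N) (P : FB × FB) :
    powRel ε d M P ≤ (powRel ε d N P).comap ((tpowMap d f).app P).hom := by
  refine Submodule.span_le.2 ?_
  rintro _ ⟨σ, v, rfl⟩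
  refine Submodule.subset_span ⟨σ, ((tpowMap d f).app P).hom v, ?_⟩
  rw [map_sub, map_zsmul]
  exact congrArg (fun x => (ε.chi σ : ℤ) • x - ((tpowMap d f).app P).hom v)
    (LinearMap.congr_fun (permAct_tpowMap σ f P) v).symm

/-- The symmetric power `S^d_⊚ M` (for `ε = +`) and the exterior power `Λ^d_⊚ M` (for `ε = -`): the
quotient `(M^{⊚d} ⊗ k^±) / S_d`. -/
def gpow (ε : Twist) (d : ℕ) (M : BiMod k) : BiMod k where
  obj P := ModuleCat.of k ((tpow d M).obj P ⧸ powRel ε d M P)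
  map φ := ModuleCat.ofHom (Submodule.mapQ _ _ ((tpow d M).map φ).hom (powRel_le_map ε d M φ))
  map_id P := by
    refine ModuleCat.hom_ext (Submodule.linearMap_qext _ (LinearMap.ext fun v => ?_))
    exact congrArg (fun l => (powRel ε d M P).mkQ (l.hom v)) ((tpow d M).map_id P)
  map_comp f g := by
    refine ModuleCat.hom_ext (Submodule.linearMap_qext _ (LinearMap.ext fun v => ?_))
    exact congrArg (fun l => (powRel ε d M _).mkQ (l.hom v)) ((tpow d M).map_comp f g)

/-- The projection `M^{⊚d} → S^d M`, respectively `M^{⊚d} → Λ^d M`. -/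
def gpowMk (ε : Twist) (d : ℕ) (M : BiMod k) (P : FB × FB) :
    (tpow d M).obj P →ₗ[k] (gpow ε d M).obj P :=
  (powRel ε d M P).mkQ

/-- Functoriality of the symmetric and exterior powers. -/
def gpowMap (ε : Twist) (d : ℕ) {M N : BiMod k} (f : M ⟶ N) : gpow ε d M ⟶ gpow ε d N where
  app P := ModuleCat.ofHom
    (Submodule.mapQ _ _ ((tpowMap d f).app P).hom (powRel_le_tpowMap ε d f P))
  naturality P Q φ := by
    refine ModuleCat.hom_ext (Submodule.linearMap_qext _ (LinearMap.ext fun v => ?_))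
    exact congrArg (fun l => (powRel ε d N Q).mkQ (l.hom v)) ((tpowMap d f).naturality φ)

lemma gpowMap_id (ε : Twist) (d : ℕ) (M : BiMod k) : gpowMap ε d (𝟙 M) = 𝟙 (gpow ε d M) := by
  refine NatTrans.ext (funext fun P => ModuleCat.hom_ext
    (Submodule.linearMap_qext _ (LinearMap.ext fun v => congrArg Submodule.Quotient.mk ?_)))
  refine LinearMap.congr_fun (g := LinearMap.id) (Eq.trans ?_ dsMap_id) v
  exact congrArg (dsMap _) (funext fun c => PiTensorProduct.map_id)

lemma gpowMap_comp (ε : Twist) (d : ℕ) {M N L : BiMod k} (f : M ⟶ N) (g : N ⟶ L) :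
    gpowMap ε d (f ≫ g) = gpowMap ε d f ≫ gpowMap ε d g := by
  refine NatTrans.ext (funext fun P => ModuleCat.hom_ext
    (Submodule.linearMap_qext _ (LinearMap.ext fun v => congrArg Submodule.Quotient.mk ?_)))
  refine LinearMap.congr_fun (g := ((tpowMap d g).app P).hom ∘ₗ ((tpowMap d f).app P).hom)
    (Eq.trans ?_ (dsMap_comp _ _ _ _).symm) v
  exact congrArg (dsMap _) (funext fun c => PiTensorProduct.map_comp _ _)

/-- `S_⊚^* = ⨁_d S_⊚^d` (for `ε = +`) and `Λ_⊚^* = ⨁_d Λ_⊚^d` (for `ε = -`), as functors from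
`k(FB × FB)`-modules to `k(FB × FB)`-modules. -/
def totalPow (k : Type v) [Field k] (ε : Twist) : BiMod k ⥤ BiMod k where
  obj M :=
    { obj := fun P => ModuleCat.of k (⨁ d : ℕ, (gpow ε d M).obj P)
      map := fun φ => ModuleCat.ofHom (dsMap (fun d => d) (fun d => ((gpow ε d M).map φ).hom))
      map_id := fun P => by
        refine ModuleCat.hom_ext (Eq.trans ?_ dsMap_id)
        exact congrArg (dsMap _)
          (funext fun d => congrArg ModuleCat.Hom.hom ((gpow ε d M).map_id P))
      map_comp := fun f g => by
        refine ModuleCat.hom_ext (Eq.trans ?_ (dsMap_comp _ _ _ _).symm)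
        exact congrArg (dsMap _)
          (funext fun d => congrArg ModuleCat.Hom.hom ((gpow ε d M).map_comp f g)) }
  map {M N} f :=
    { app := fun P => ModuleCat.ofHom
        (dsMap (fun d => d) (fun d => ((gpowMap ε d f).app P).hom))
      naturality := fun P Q φ => by
        refine ModuleCat.hom_ext
          (Eq.trans (dsMap_comp _ _ _ _) (Eq.trans ?_ (dsMap_comp _ _ _ _).symm))
        exact congrArg (dsMap _)
          (funext fun d => congrArg ModuleCat.Hom.hom ((gpowMap ε d f).naturality φ)) }
  map_id M := by
    refine NatTrans.ext (funext fun P => ModuleCat.hom_ext (Eq.trans ?_ dsMap_id))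
    exact congrArg (dsMap _)
      (funext fun d => congrArg (fun α : gpow ε d M ⟶ _ => (α.app P).hom) (gpowMap_id ε d M))
  map_comp f g := by
    refine NatTrans.ext (funext fun P => ModuleCat.hom_ext
      (Eq.trans ?_ (dsMap_comp _ _ _ _).symm))
    exact congrArg (dsMap _)
      (funext fun d => congrArg (fun α : gpow ε d _ ⟶ gpow ε d _ => (α.app P).hom)
        (gpowMap_comp ε d f g))

end Powers
section Contraction

variable {k : Type v} [Field k]

/-! ### The action of a walled pair -/

/-- The sign with which a morphism `M ⊚ M → M ⊚ k_(1,1)` enters for `s` in the piece `i` and `t` in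
the piece `j`: always `1` for `+`; for `-`, the sign that orders the two pieces so that `s` belongs
to the first one and `t` to the second one, and zero if they belong to the same piece. -/
def Twist.orient : Twist → Fin 2 → Fin 2 → ℤ
  | .plus, _, _ => 1
  | .minus, i, j => (j.val : ℤ) - (i.val : ℤ)

/-- The components of the morphism `S² M → M ⊚ k_(1,1)` (for `ε = +`) or `Λ² M → M ⊚ k_(1,1)` (for
`ε = -`) induced by a symmetric and diagonal `μ`. -/
def muTw (ε : Twist) {M : BiMod k} (μ : day M M ⟶ day M (kk11 k)) (P : FB × FB)
    (c : Dec P (Fin 2)) (s : P.1) (t : P.2) :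
    M.obj (c.part 0) →ₗ[k] M.obj (c.part 1) →ₗ[k] M.obj (biDel P s t) :=
  ε.orient (c.1 s) (c.2 t) • muComp μ P c s t

namespace Dec

variable {n : ℕ} {P : FB × FB} (c : Dec P (Fin (n + 2)))

/-- The union of the last two pieces. -/
abbrev tail : FB × FB := (P.1.sub (fun x => n ≤ (c.1 x).val), P.2.sub (fun y => n ≤ (c.2 y).val))

/-- The decomposition of the union of the last two pieces. -/
abbrev tailDec : Dec c.tail (Fin 2) :=
  (fun x => if (c.1 x.1).val = n then 0 else 1, fun y => if (c.2 y.1).val = n then 0 else 1)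

/-- The last but one piece. -/
def tailMap₀ : c.part ⟨n, by omega⟩ ⟶ c.tailDec.part 0 :=
  biHom
    { toFun := fun x => ⟨⟨x.1, by have := congrArg Fin.val x.2; simp at this; omega⟩,
        by have := congrArg Fin.val x.2; simp at this; simp [this]⟩
      invFun := fun x => ⟨x.1.1, by have := x.2; simp at this; exact Fin.ext this⟩
      left_inv := fun _ => rfl
      right_inv := fun _ => rfl }
    { toFun := fun x => ⟨⟨x.1, by have := congrArg Fin.val x.2; simp at this; omega⟩,
        by have := congrArg Fin.val x.2; simp at this; simp [this]⟩
      invFun := fun x => ⟨x.1.1, by have := x.2; simp at this; exact Fin.ext this⟩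
      left_inv := fun _ => rfl
      right_inv := fun _ => rfl }

/-- The last piece. -/
def tailMap₁ : c.part ⟨n + 1, by omega⟩ ⟶ c.tailDec.part 1 :=
  biHom
    { toFun := fun x => ⟨⟨x.1, by have := congrArg Fin.val x.2; simp at this; omega⟩,
        by have := congrArg Fin.val x.2; simp at this; simp [this]⟩
      invFun := fun x => ⟨x.1.1, by
        have h := x.2; have h1 := x.1.2; have h2 := (c.1 x.1.1).isLt
        simp at h h1; exact Fin.ext (by simp; omega)⟩
      left_inv := fun _ => rfl
      right_inv := fun _ => rfl }
    { toFun := fun x => ⟨⟨x.1, by have := congrArg Fin.val x.2; simp at this; omega⟩,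
        by have := congrArg Fin.val x.2; simp at this; simp [this]⟩
      invFun := fun x => ⟨x.1.1, by
        have h := x.2; have h1 := x.1.2; have h2 := (c.2 x.1.1).isLt
        simp at h h1; exact Fin.ext (by simp; omega)⟩
      left_inv := fun _ => rfl
      right_inv := fun _ => rfl }

/-- The decomposition of `(X \ {s}, Y \ {t})` in which the last two pieces are merged. -/
abbrev merge (s : P.1) (t : P.2) : Dec (biDel P s t) (Fin (n + 1)) :=
  (fun x => ⟨min (c.1 x.1).val n, by omega⟩, fun y => ⟨min (c.2 y.1).val n, by omega⟩)

/-- The pieces other than the last two are not changed by `merge`, if `s` and `t` belong to the last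
two. -/
def mergeMap {s : P.1} {t : P.2} (hs : n ≤ (c.1 s).val) (ht : n ≤ (c.2 t).val) (l : Fin (n + 1))
    (hl : l.val < n) : c.part ⟨l.val, by omega⟩ ⟶ (c.merge s t).part l :=
  biHom
    { toFun := fun x => ⟨⟨x.1, by
          have := congrArg Fin.val x.2; simp at this; rintro h; rw [h] at this; omega⟩,
        by have := congrArg Fin.val x.2; simp at this; exact Fin.ext (by simp; omega)⟩
      invFun := fun x => ⟨x.1.1, by
        have := congrArg Fin.val x.2; simp at this; exact Fin.ext (by simp; omega)⟩
      left_inv := fun _ => rfl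
      right_inv := fun _ => rfl }
    { toFun := fun x => ⟨⟨x.1, by
          have := congrArg Fin.val x.2; simp at this; rintro h; rw [h] at this; omega⟩,
        by have := congrArg Fin.val x.2; simp at this; exact Fin.ext (by simp; omega)⟩
      invFun := fun x => ⟨x.1.1, by
        have := congrArg Fin.val x.2; simp at this; exact Fin.ext (by simp; omega)⟩
      left_inv := fun _ => rfl
      right_inv := fun _ => rfl }

/-- The last piece of `merge` is the union of the last two pieces, without `s` and `t`. -/
def mergeLast {s : P.1} {t : P.2} (hs : n ≤ (c.1 s).val) (ht : n ≤ (c.2 t).val) (l : Fin (n + 1))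
    (hl : ¬ l.val < n) : biDel c.tail ⟨s, hs⟩ ⟨t, ht⟩ ⟶ (c.merge s t).part l :=
  biHom
    { toFun := fun x => ⟨⟨x.1.1, fun h => x.2 (Subtype.ext h)⟩,
        by have := x.1.2; simp at this; exact Fin.ext (by simp; omega)⟩
      invFun := fun x => ⟨⟨x.1.1, by have := congrArg Fin.val x.2; simp at this; omega⟩,
        fun h => x.1.2 (congrArg Subtype.val h)⟩
      left_inv := fun _ => rfl
      right_inv := fun _ => rfl }
    { toFun := fun x => ⟨⟨x.1.1, fun h => x.2 (Subtype.ext h)⟩,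
        by have := x.1.2; simp at this; exact Fin.ext (by simp; omega)⟩
      invFun := fun x => ⟨⟨x.1.1, by have := congrArg Fin.val x.2; simp at this; omega⟩,
        fun h => x.1.2 (congrArg Subtype.val h)⟩
      left_inv := fun _ => rfl
      right_inv := fun _ => rfl }

end Dec

/-- The factors of the value of `id ⊚ μ` on a tensor `a₀ ⊗ ⋯ ⊗ aₙ₊₁`, for `s` and `t` in the last two
pieces: the factors `a₀, …, aₙ₋₁` followed by the component of `μ(aₙ ⊗ aₙ₊₁)`. -/
def applyLastFun (ε : Twist) {M : BiMod k} (μ : day M M ⟶ day M (kk11 k)) {n : ℕ} {P : FB × FB}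
    (c : Dec P (Fin (n + 2))) {s : P.1} {t : P.2} (hs : n ≤ (c.1 s).val) (ht : n ≤ (c.2 t).val)
    (a : ∀ i, M.obj (c.part i)) (l : Fin (n + 1)) : M.obj ((c.merge s t).part l) :=
  if hl : l.val < n then (M.map (c.mergeMap hs ht l hl)).hom (a ⟨l.val, by omega⟩)
  else (M.map (c.mergeLast hs ht l hl)).hom
    (muTw ε μ c.tail c.tailDec ⟨s, hs⟩ ⟨t, ht⟩ ((M.map c.tailMap₀).hom (a ⟨n, by omega⟩))
      ((M.map c.tailMap₁).hom (a ⟨n + 1, by omega⟩)))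

/-- A change of `a` in one place changes `applyLastFun` in one place. -/
lemma applyLastFun_update (ε : Twist) {M : BiMod k} (μ : day M M ⟶ day M (kk11 k)) {n : ℕ}
    {P : FB × FB} (c : Dec P (Fin (n + 2))) {s : P.1} {t : P.2} (hs : n ≤ (c.1 s).val)
    (ht : n ≤ (c.2 t).val) (a : ∀ i, M.obj (c.part i)) (i : Fin (n + 2)) :
    ∃ (l : Fin (n + 1)) (L : M.obj (c.part i) →ₗ[k] M.obj ((c.merge s t).part l)), ∀ z,
      applyLastFun ε μ c hs ht (Function.update a i z) =
        Function.update (applyLastFun ε μ c hs ht a) l (L z) := by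
  rcases lt_trichotomy i.val n with h | h | h
  · refine ⟨⟨i.val, by omega⟩, (M.map (c.mergeMap hs ht ⟨i.val, by omega⟩ h)).hom, fun z => ?_⟩
    funext l
    by_cases hl : l = ⟨i.val, by omega⟩
    · subst hl
      simp [applyLastFun, h]
    · have hl' : l.val ≠ i.val := fun h => hl (Fin.ext h)
      rw [Function.update_of_ne hl]
      unfold applyLastFun
      split_ifs with h1
      · rw [Function.update_of_ne (fun h => hl' (congrArg Fin.val h))]
      · rw [Function.update_of_ne (fun h2 => by simp [← h2] at h),
          Function.update_of_ne (fun h2 => by simp [← h2] at h)]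
  · obtain ⟨i, hi⟩ := i
    obtain rfl : n = i := h.symm
    refine ⟨Fin.last n, (M.map (c.mergeLast hs ht (Fin.last n) (by simp))).hom ∘ₗ
      (muTw ε μ c.tail c.tailDec ⟨s, hs⟩ ⟨t, ht⟩).flip
        ((M.map c.tailMap₁).hom (a ⟨n + 1, by omega⟩)) ∘ₗ (M.map c.tailMap₀).hom, fun z => ?_⟩
    funext l
    by_cases hl : l = Fin.last n
    · subst hl
      simp [applyLastFun]
    · have hl' : l.val < n := by
        have := fun h => hl (Fin.ext h); simp at this; omega
      rw [Function.update_of_ne hl]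
      unfold applyLastFun
      rw [dif_pos hl', dif_pos hl', Function.update_of_ne (fun h2 => by simp at h2; omega)]
  · obtain ⟨i, hi⟩ := i
    obtain rfl : i = n + 1 := by dsimp only at h; omega
    refine ⟨Fin.last n, (M.map (c.mergeLast hs ht (Fin.last n) (by simp))).hom ∘ₗ
      (muTw ε μ c.tail c.tailDec ⟨s, hs⟩ ⟨t, ht⟩)
        ((M.map c.tailMap₀).hom (a ⟨n, by omega⟩)) ∘ₗ (M.map c.tailMap₁).hom, fun z => ?_⟩
    funext l
    by_cases hl : l = Fin.last n
    · subst hl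
      simp [applyLastFun]
    · have hl' : l.val < n := by
        have := fun h => hl (Fin.ext h); simp at this; omega
      rw [Function.update_of_ne hl]
      unfold applyLastFun
      rw [dif_pos hl', dif_pos hl', Function.update_of_ne (fun h2 => by simp at h2; omega)]

/-- `applyLastFun` as a multilinear map. -/
def applyLastMulti (ε : Twist) {M : BiMod k} (μ : day M M ⟶ day M (kk11 k)) {n : ℕ} {P : FB × FB}
    (c : Dec P (Fin (n + 2))) {s : P.1} {t : P.2} (hs : n ≤ (c.1 s).val) (ht : n ≤ (c.2 t).val) :
    MultilinearMap k (fun i => M.obj (c.part i)) (tensPart M (c.merge s t)) where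
  toFun a := PiTensorProduct.tprod k (applyLastFun ε μ c hs ht a)
  map_update_add' {inst} a i x y := by
    rw [Subsingleton.elim inst (instDecidableEqFin _)]
    obtain ⟨l, L, h⟩ := applyLastFun_update ε μ c hs ht a i
    rw [h, h, h, L.map_add, MultilinearMap.map_update_add]
  map_update_smul' {inst} a i r x := by
    rw [Subsingleton.elim inst (instDecidableEqFin _)]
    obtain ⟨l, L, h⟩ := applyLastFun_update ε μ c hs ht a i
    rw [h, h, L.map_smul, MultilinearMap.map_update_smul]

open Classical in
/-- The component for `s`, `t` of `id ⊚ μ : M^{⊚n} ⊚ M^{⊚2} → M^{⊚n} ⊚ M ⊚ k_(1,1)`, with `μ` applied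
to the last two factors (and with the sign of `muTw` for `ε = -`). -/
def applyLast (ε : Twist) {M : BiMod k} (μ : day M M ⟶ day M (kk11 k)) (n : ℕ) (P : FB × FB)
    (s : P.1) (t : P.2) :
    (tpow (n + 2) M).obj P →ₗ[k] (tpow (n + 1) M).obj (biDel P s t) :=
  DirectSum.toModule k (Dec P (Fin (n + 2))) _ (fun c =>
    if h : n ≤ (c.1 s).val ∧ n ≤ (c.2 t).val then
      DirectSum.lof k (Dec (biDel P s t) (Fin (n + 1))) (fun c => tensPart M c) (c.merge s t) ∘ₗ
        PiTensorProduct.lift (applyLastMulti ε μ c h.1 h.2)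
    else 0)

/-- The coproduct of `S_⊚^*` or `Λ_⊚^*`, in bidegree `(n, 2)`, followed by `μ` on the second factor and by
the product, as a map on `M^{⊚(n+2)}`. The coproduct is the transfer
`v ↦ ∑ sgn(σ) σ v` over the cosets of `S_n × S_2` in `S_{n+2}`. -/
def extendPre (ε : Twist) {M : BiMod k} (μ : day M M ⟶ day M (kk11 k)) (n : ℕ) (P : FB × FB)
    (s : P.1) (t : P.2) :
    (tpow (n + 2) M).obj P →ₗ[k] (gpow ε (n + 1) M).obj (biDel P s t) :=
  ((2 * n.factorial : k)⁻¹) • ∑ σ : Equiv.Perm (Fin (n + 2)), (ε.chi σ : ℤ) •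
    (gpowMk ε (n + 1) M (biDel P s t) ∘ₗ applyLast ε μ n P s t ∘ₗ permAct M σ P)

lemma extendPre_apply (ε : Twist) {M : BiMod k} (μ : day M M ⟶ day M (kk11 k)) (n : ℕ)
    (P : FB × FB) (s : P.1) (t : P.2) (v : (tpow (n + 2) M).obj P) :
    extendPre ε μ n P s t v = ((2 * n.factorial : k)⁻¹) • ∑ σ : Equiv.Perm (Fin (n + 2)),
      (ε.chi σ : ℤ) • gpowMk ε (n + 1) M (biDel P s t) (applyLast ε μ n P s t (permAct M σ P v)) := by
  simp [extendPre]

lemma powRel_le_ker_extendPre (ε : Twist) {M : BiMod k} (μ : day M M ⟶ day M (kk11 k)) (n : ℕ)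
    (P : FB × FB) (s : P.1) (t : P.2) :
    powRel ε (n + 2) M P ≤ LinearMap.ker (extendPre ε μ n P s t) := by
  refine Submodule.span_le.2 ?_
  rintro _ ⟨τ, v, rfl⟩
  have key (σ : Equiv.Perm (Fin (n + 2))) : permAct M σ P (permAct M τ P v)
      = permAct M (σ * τ) P v := by rw [permAct_mul]; rfl
  rw [SetLike.mem_coe, LinearMap.mem_ker, map_sub, sub_eq_zero, map_zsmul]
  rw [extendPre_apply, extendPre_apply, smul_comm, Finset.smul_sum]
  congr 1
  refine Fintype.sum_equiv (Equiv.mulRight τ) _ _ fun σ => ?_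
  rw [Equiv.coe_mulRight, ε.chi_mul, smul_smul, mul_comm, key]
  simp

/-- The components `S^{n+2} M (X, Y) → S^{n+1} M (X \ {s}, Y \ {t})` (for `ε = +`), respectively
`Λ^{n+2} M (X, Y) → Λ^{n+1} M (X \ {s}, Y \ {t})` (for `ε = -`), of the extension of `μ` to a morphism
`S^{n+2} M → S^{n+1} M ⊚ k_(1,1)`, respectively `Λ^{n+2} M → Λ^{n+1} M ⊚ k_(1,1)`. -/
def extend (ε : Twist) {M : BiMod k} (μ : day M M ⟶ day M (kk11 k)) (n : ℕ) (P : FB × FB)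
    (s : P.1) (t : P.2) :
    (gpow ε (n + 2) M).obj P →ₗ[k] (gpow ε (n + 1) M).obj (biDel P s t) :=
  Submodule.liftQ _ (extendPre ε μ n P s t) (powRel_le_ker_extendPre ε μ n P s t)

open Classical in
/-- The sum over all degrees of the components of the extension of `μ` (zero in degrees `0`, `1`). -/
def extendTotal (ε : Twist) {M : BiMod k} (μ : day M M ⟶ day M (kk11 k)) (P : FB × FB)
    (s : P.1) (t : P.2) :
    ((totalPow k ε).obj M).obj P →ₗ[k] ((totalPow k ε).obj M).obj (biDel P s t) :=
  DirectSum.toModule k ℕ _ (fun d =>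
    match d with
    | 0 => 0
    | 1 => 0
    | n + 2 => DirectSum.lof k ℕ (fun d => (gpow ε d M).obj (biDel P s t)) (n + 1) ∘ₗ
        extend ε μ n P s t)

end Contraction
section Dioperads

variable {k : Type v} [Field k]

/-! ### Dioperads without unit -/

/-- `(X \ {s₁}) \ {s₂} = (X \ {s₂}) \ {s₁}`. -/
def delSwap (X : FB) {s₁ s₂ : X} (h : s₂ ≠ s₁) :
    ((X.del s₁).del ⟨s₂, h⟩).carrier ≃ ((X.del s₂).del ⟨s₁, h.symm⟩).carrier where
  toFun x := ⟨⟨x.1.1, fun e => x.2 (Subtype.ext e)⟩, fun e => x.1.2 (congrArg Subtype.val e)⟩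
  invFun x := ⟨⟨x.1.1, fun e => x.2 (Subtype.ext e)⟩, fun e => x.1.2 (congrArg Subtype.val e)⟩
  left_inv _ := rfl
  right_inv _ := rfl

/-- `(X \ {s₁, s₂}, Y \ {t₁, t₂})`, with the elements removed in the two possible orders. -/
def biDelSwap (P : FB × FB) {s₁ s₂ : P.1} {t₁ t₂ : P.2} (hs : s₂ ≠ s₁) (ht : t₂ ≠ t₁) :
    biDel (biDel P s₁ t₁) ⟨s₂, hs⟩ ⟨t₂, ht⟩ ⟶ biDel (biDel P s₂ t₂) ⟨s₁, hs.symm⟩ ⟨t₁, ht.symm⟩ :=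
  biHom (delSwap P.1 hs) (delSwap P.2 ht)

/-- Associativity: the composite
`S³ M → S² M ⊚ k_(1,1) → M ⊚ k_(1,1) ⊚ k_(1,1) → M ⊚ Λ² k_(1,1)` is zero. The components of
`M ⊚ k_(1,1) ⊚ k_(1,1)` are indexed by two ordered walled pairs `(s₁, t₁)`, `(s₂, t₂)`, and
`Λ² k_(1,1)` is the quotient which identifies each order of the two pairs with minus the other one, so
that this means that the components of the first two maps for the two orders coincide.
Here `M` is written as `S¹ M`. -/
def IsAssociative {M : BiMod k} (μ : day M M ⟶ day M (kk11 k)) : Prop :=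
  ∀ (P : FB × FB) (s₁ s₂ : P.1) (t₁ t₂ : P.2) (hs : s₂ ≠ s₁) (ht : t₂ ≠ t₁)
    (v : (gpow .plus 3 M).obj P),
    ((gpow .plus 1 M).map (biDelSwap P hs ht)).hom
      (extend .plus μ 0 (biDel P s₁ t₁) ⟨s₂, hs⟩ ⟨t₂, ht⟩ (extend .plus μ 1 P s₁ t₁ v)) =
    extend .plus μ 0 (biDel P s₂ t₂) ⟨s₁, hs.symm⟩ ⟨t₁, ht.symm⟩ (extend .plus μ 1 P s₂ t₂ v)

variable (k) in
/-- Dioperads without unit. -/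
structure DiOpd where
  /-- the underlying `k(FB × FB)`-module -/
  toBiMod : BiMod k
  /-- the structure morphism -/
  mu : day toBiMod toBiMod ⟶ day toBiMod (kk11 k)
  /-- the value on the pair of empty sets is zero -/
  zero : ∀ P : FB × FB, IsEmpty P.1 → IsEmpty P.2 → Subsingleton (toBiMod.obj P)
  diagonal : IsDiagonal mu
  symmetric : IsSymmetric mu
  associative : IsAssociative mu

namespace DiOpd

/-- Morphisms of dioperads: morphisms of `k(FB × FB)`-modules compatible with `μ`. -/
@[ext]
structure Hom (D E : DiOpd k) where
  hom : D.toBiMod ⟶ E.toBiMod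
  comm : D.mu ≫ dayMap hom (𝟙 (kk11 k)) = dayMap hom hom ≫ E.mu

lemma dayMap_id (M N : BiMod k) : dayMap (𝟙 M) (𝟙 N) = 𝟙 (day M N) := by
  refine NatTrans.ext (funext fun P => ModuleCat.hom_ext (Eq.trans ?_ dsMap_id))
  exact congrArg (dsMap _) (funext fun c => TensorProduct.map_id)

lemma dayMap_comp {M M' M'' N N' N'' : BiMod k} (f : M ⟶ M') (f' : M' ⟶ M'') (g : N ⟶ N')
    (g' : N' ⟶ N'') : dayMap (f ≫ f') (g ≫ g') = dayMap f g ≫ dayMap f' g' := by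
  refine NatTrans.ext (funext fun P => ModuleCat.hom_ext (Eq.trans ?_ (dsMap_comp _ _ _ _).symm))
  exact congrArg (dsMap _) (funext fun c => TensorProduct.map_comp _ _ _ _)

/-- The category of dioperads without unit. -/
instance : Category (DiOpd k) where
  Hom := Hom
  id D := ⟨𝟙 _, by rw [dayMap_id, dayMap_id, Category.comp_id, Category.id_comp]⟩
  comp {D E F} f g := ⟨f.hom ≫ g.hom, by
    have h : dayMap (f.hom ≫ g.hom) (𝟙 (kk11 k)) =
        dayMap f.hom (𝟙 (kk11 k)) ≫ dayMap g.hom (𝟙 (kk11 k)) := by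
      rw [← dayMap_comp, Category.comp_id]
    rw [h, dayMap_comp, ← Category.assoc, f.comm, Category.assoc, g.comm, Category.assoc]⟩
  id_comp f := Hom.ext (Category.id_comp _)
  comp_id f := Hom.ext (Category.comp_id _)
  assoc f g h := Hom.ext (Category.assoc _ _ _)

variable (k) in
/-- The underlying `k(FB × FB)`-module. -/
def forget : DiOpd k ⥤ BiMod k where
  obj D := D.toBiMod
  map f := f.hom

end DiOpd

end Dioperads

/-! ### The walled Brauer categories -/

/-- A morphism `P → Q` of the ordered upward walled Brauer category: for `P = (X, Y)` and `Q = (U, V)`,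
a natural number `n` and bijections `X ⨿ n ≃ U`, `Y ⨿ n ≃ V`. -/
@[ext]
structure UwbOrd (P Q : FB × FB) where
  /-- the degree, which is the number of walled pairs -/
  deg : ℕ
  fst : P.1.carrier ⊕ Fin deg ≃ Q.1.carrier
  snd : P.2.carrier ⊕ Fin deg ≃ Q.2.carrier

/-- The composite `X ⨿ (n + m) = (X ⨿ n) ⨿ m ≃ Y ⨿ m ≃ Z`. -/
def compFin {X Y Z : Type} {n m : ℕ} (a : X ⊕ Fin n ≃ Y) (b : Y ⊕ Fin m ≃ Z) : X ⊕ Fin (n + m) ≃ Z :=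
  (((Equiv.refl X).sumCongr finSumFinEquiv.symm).trans (Equiv.sumAssoc X (Fin n) (Fin m)).symm).trans
    ((a.sumCongr (Equiv.refl (Fin m))).trans b)

section compFin

variable {X Y Z W : Type} {n m l : ℕ} (a : X ⊕ Fin n ≃ Y) (b : Y ⊕ Fin m ≃ Z) (c : Z ⊕ Fin l ≃ W)

lemma compFin_inl (x : X) : compFin a b (Sum.inl x) = b (Sum.inl (a (Sum.inl x))) := rfl

lemma compFin_left (i : Fin n) :
    compFin a b (Sum.inr (Fin.castAdd m i)) = b (Sum.inl (a (Sum.inr i))) := by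
  simp [compFin]

lemma compFin_right (i : Fin m) : compFin a b (Sum.inr (Fin.natAdd n i)) = b (Sum.inr i) := by
  simp [compFin]

lemma compFin_empty_left (e : Y ⊕ Fin m ≃ Z) (i : Fin (0 + m)) (h : 0 + m = m) :
    compFin (Equiv.sumEmpty Y (Fin 0)) e (Sum.inr i) = e (Sum.inr (Fin.cast h i)) := by
  induction i using Fin.addCases with
  | left i => exact i.elim0
  | right i => rw [compFin_right]; congr 2; ext; simp

lemma compFin_empty_right (i : Fin (n + 0)) (h : n + 0 = n) :
    compFin a (Equiv.sumEmpty Y (Fin 0)) (Sum.inr i) = a (Sum.inr (Fin.cast h i)) := by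
  induction i using Fin.addCases with
  | left i => rw [compFin_left]; rfl
  | right i => exact i.elim0

lemma compFin_assoc (i : Fin (n + m + l)) (h : n + m + l = n + (m + l)) :
    compFin (compFin a b) c (Sum.inr i) = compFin a (compFin b c) (Sum.inr (Fin.cast h i)) := by
  induction i using Fin.addCases with
  | left i =>
    induction i using Fin.addCases with
    | left i =>
      rw [compFin_left, compFin_left]
      exact (compFin_left a (compFin b c) i).symm
    | right i =>
      rw [compFin_left, compFin_right]
      have e : Fin.cast h (Fin.castAdd l (Fin.natAdd n i)) = Fin.natAdd n (Fin.castAdd l i) := by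
        ext; simp
      rw [e, compFin_right, compFin_left]
  | right i =>
    rw [compFin_right]
    have e : Fin.cast h (Fin.natAdd (n + m) i) = Fin.natAdd n (Fin.natAdd m i) := by
      ext; simp [add_assoc]
    rw [e, compFin_right, compFin_right]

/-- The permutation which acts by `σ` on the first `n` and by `τ` on the last `m` elements. -/
def blockPerm (σ : Equiv.Perm (Fin n)) (τ : Equiv.Perm (Fin m)) : Equiv.Perm (Fin (n + m)) :=
  finSumFinEquiv.permCongr (σ.sumCongr τ)

lemma compFin_perm (σ : Equiv.Perm (Fin n)) (τ : Equiv.Perm (Fin m)) :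
    compFin (((Equiv.refl X).sumCongr σ).trans a) (((Equiv.refl Y).sumCongr τ).trans b) =
      ((Equiv.refl X).sumCongr (blockPerm σ τ)).trans (compFin a b) := by
  ext x
  rcases x with x | i
  · rfl
  · induction i using Fin.addCases with
    | left i =>
      have : blockPerm σ τ (Fin.castAdd m i) = Fin.castAdd m (σ i) := by simp [blockPerm]
      simp [compFin_left, this]
    | right i =>
      have : blockPerm σ τ (Fin.natAdd n i) = Fin.natAdd n (τ i) := by simp [blockPerm]
      simp [compFin_right, this]

end compFin

lemma Twist.chi_blockPerm (ε : Twist) {n m : ℕ} (σ : Equiv.Perm (Fin n)) (τ : Equiv.Perm (Fin m)) :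
    ε.chi (blockPerm σ τ) = ε.chi σ * ε.chi τ := by
  cases ε <;> simp [Twist.chi, blockPerm]

namespace UwbOrd

/-- The identity. -/
def id (P : FB × FB) : UwbOrd P P := ⟨0, Equiv.sumEmpty _ _, Equiv.sumEmpty _ _⟩

/-- Composition: the walled pairs of the composite are those of `f`, followed by those of `g`. -/
def comp {P Q R : FB × FB} (f : UwbOrd P Q) (g : UwbOrd Q R) : UwbOrd P R where
  deg := f.deg + g.deg
  fst := compFin f.fst g.fst
  snd := compFin f.snd g.snd

/-- The right action of the symmetric group, which changes the order of the walled pairs. -/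
def perm {P Q : FB × FB} (f : UwbOrd P Q) (σ : Equiv.Perm (Fin f.deg)) : UwbOrd P Q where
  deg := f.deg
  fst := ((Equiv.refl _).sumCongr σ).trans f.fst
  snd := ((Equiv.refl _).sumCongr σ).trans f.snd

lemma ext' {P Q : FB × FB} {f g : UwbOrd P Q} (h : f.deg = g.deg)
    (h1 : ∀ x, f.fst (Sum.inl x) = g.fst (Sum.inl x))
    (h2 : ∀ i : Fin f.deg, f.fst (Sum.inr i) = g.fst (Sum.inr (Fin.cast h i)))
    (h3 : ∀ x, f.snd (Sum.inl x) = g.snd (Sum.inl x))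
    (h4 : ∀ i : Fin f.deg, f.snd (Sum.inr i) = g.snd (Sum.inr (Fin.cast h i))) : f = g := by
  obtain ⟨n, a, b⟩ := f
  obtain ⟨m, a', b'⟩ := g
  dsimp only at h
  subst h
  congr 1
  · ext x; rcases x with x | x
    · exact h1 x
    · exact h2 x
  · ext x; rcases x with x | x
    · exact h3 x
    · exact h4 x

lemma id_comp {P Q : FB × FB} (f : UwbOrd P Q) : (id P).comp f = f :=
  ext' (zero_add _) (fun _ => rfl) (fun i => compFin_empty_left _ i _) (fun _ => rfl)
    (fun i => compFin_empty_left _ i _)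

lemma comp_id {P Q : FB × FB} (f : UwbOrd P Q) : f.comp (id Q) = f :=
  ext' (add_zero _) (fun _ => rfl) (fun i => compFin_empty_right _ i _) (fun _ => rfl)
    (fun i => compFin_empty_right _ i _)

lemma assoc {P Q R S : FB × FB} (f : UwbOrd P Q) (g : UwbOrd Q R) (h : UwbOrd R S) :
    (f.comp g).comp h = f.comp (g.comp h) :=
  ext' (add_assoc _ _ _) (fun _ => rfl) (fun i => compFin_assoc _ _ _ i _) (fun _ => rfl)
    (fun i => compFin_assoc _ _ _ i _)

lemma perm_comp_perm {P Q R : FB × FB} (f : UwbOrd P Q) (g : UwbOrd Q R)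
    (σ : Equiv.Perm (Fin f.deg)) (τ : Equiv.Perm (Fin g.deg)) :
    (f.perm σ).comp (g.perm τ) = (f.comp g).perm (blockPerm σ τ) := by
  unfold comp perm
  congr 1
  · exact compFin_perm _ _ σ τ
  · exact compFin_perm _ _ σ τ

lemma perm_one {P Q : FB × FB} (f : UwbOrd P Q) : f.perm 1 = f := by
  unfold perm
  congr 1
  · ext x; rcases x with x | x <;> rfl
  · ext x; rcases x with x | x <;> rfl

end UwbOrd

section Uwb

variable (k : Type v) [Field k]

/-- Objects of the twisted `k`-linear upward walled Brauer category: pairs of finite sets. -/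
@[ext]
structure Uwb (k : Type v) (ε : Twist) : Type 1 where
  pair : FB × FB

variable {k}

/-- The relations which define `k[UwbOrd(P, Q)] ⊗_{S_n} k^±`: `f σ ⊗ 1 = f ⊗ σ 1`. -/
def uwbRel (k : Type v) [Field k] (ε : Twist) (P Q : FB × FB) : Submodule k (UwbOrd P Q →₀ k) :=
  Submodule.span k {w | ∃ (f : UwbOrd P Q) (σ : Equiv.Perm (Fin f.deg)),
    w = Finsupp.single (f.perm σ) 1 - ((ε.chi σ : ℤ) : k) • Finsupp.single f 1}

/-- The morphisms of the twisted `k`-linear upward walled Brauer category. -/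
abbrev UwbHom (k : Type v) [Field k] (ε : Twist) (P Q : FB × FB) : Type v :=
  (UwbOrd P Q →₀ k) ⧸ uwbRel k ε P Q

namespace UwbHom

variable {ε : Twist}

variable (k ε) in
/-- The class of a morphism of the ordered upward walled Brauer category. -/
def cls {P Q : FB × FB} (f : UwbOrd P Q) : UwbHom k ε P Q :=
  (uwbRel k ε P Q).mkQ (Finsupp.single f 1)

lemma cls_perm {P Q : FB × FB} (f : UwbOrd P Q) (σ : Equiv.Perm (Fin f.deg)) :
    cls k ε (f.perm σ) = ((ε.chi σ : ℤ) : k) • cls k ε f := by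
  rw [← sub_eq_zero, cls, cls, ← map_smul, ← map_sub]
  exact (Submodule.Quotient.mk_eq_zero _).2 (Submodule.subset_span ⟨f, σ, rfl⟩)

lemma hom_ext {P Q : FB × FB} {V : Type*} [AddCommGroup V] [Module k V]
    {f g : UwbHom k ε P Q →ₗ[k] V} (h : ∀ a, f (cls k ε a) = g (cls k ε a)) : f = g := by
  refine Submodule.linearMap_qext _ (Finsupp.lhom_ext' fun a => LinearMap.ext_ring ?_)
  exact h a

/-- The linear map on morphisms determined by a map on the classes. -/
def lift {P Q : FB × FB} {V : Type*} [AddCommGroup V] [Module k V] (F : UwbOrd P Q → V)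
    (hF : ∀ f (σ : Equiv.Perm (Fin f.deg)), F (f.perm σ) = ((ε.chi σ : ℤ) : k) • F f) :
    UwbHom k ε P Q →ₗ[k] V :=
  Submodule.liftQ _ (Finsupp.linearCombination k F) (by
    refine Submodule.span_le.2 ?_
    rintro _ ⟨f, σ, rfl⟩
    rw [SetLike.mem_coe, LinearMap.mem_ker, map_sub, map_smul, Finsupp.linearCombination_single,
      Finsupp.linearCombination_single, hF, one_smul, one_smul, sub_self])

@[simp] lemma lift_cls {P Q : FB × FB} {V : Type*} [AddCommGroup V] [Module k V]
    (F : UwbOrd P Q → V)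
    (hF : ∀ f (σ : Equiv.Perm (Fin f.deg)), F (f.perm σ) = ((ε.chi σ : ℤ) : k) • F f)
    (f : UwbOrd P Q) : lift F hF (cls k ε f) = F f := by
  change Finsupp.linearCombination k F (Finsupp.single f 1) = F f
  rw [Finsupp.linearCombination_single, one_smul]

/-- The bilinear composition induced by that of the ordered category. -/
def compL (P Q R : FB × FB) : UwbHom k ε P Q →ₗ[k] UwbHom k ε Q R →ₗ[k] UwbHom k ε P R :=
  lift (fun f => lift (fun g => cls k ε (f.comp g)) (fun g τ => by
      have h := f.perm_comp_perm g 1 τ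
      rw [f.perm_one] at h
      rw [h]
      refine (cls_perm (f.comp g) (blockPerm 1 τ)).trans
        ((congrArg (fun u : ℤˣ => ((u : ℤ) : k) • cls k ε (f.comp g)) (ε.chi_blockPerm 1 τ)).trans ?_)
      cases ε <;> simp [Twist.chi]))
    (fun f σ => hom_ext fun g => by
      have h := f.perm_comp_perm g σ 1
      rw [g.perm_one] at h
      rw [LinearMap.smul_apply, lift_cls, lift_cls, h]
      refine (cls_perm (f.comp g) (blockPerm σ 1)).trans
        ((congrArg (fun u : ℤˣ => ((u : ℤ) : k) • cls k ε (f.comp g)) (ε.chi_blockPerm σ 1)).trans ?_)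
      cases ε <;> simp [Twist.chi])

@[simp] lemma compL_cls {P Q R : FB × FB} (f : UwbOrd P Q) (g : UwbOrd Q R) :
    compL P Q R (cls k ε f) (cls k ε g) = cls k ε (f.comp g) := by
  simp [compL]

lemma induction {P Q : FB × FB} {p : UwbHom k ε P Q → Prop} (a : UwbHom k ε P Q) (h0 : p 0)
    (hadd : ∀ x y, p x → p y → p (x + y)) (hsmul : ∀ (r : k) x, p x → p (r • x))
    (hc : ∀ f, p (cls k ε f)) : p a := by
  obtain ⟨w, rfl⟩ := (uwbRel k ε P Q).mkQ_surjective a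
  induction w using Finsupp.induction_linear with
  | zero => simpa using h0
  | add x y hx hy => rw [map_add]; exact hadd _ _ hx hy
  | single f r =>
    have : Finsupp.single f r = r • Finsupp.single f (1 : k) := by simp
    rw [this, map_smul]
    exact hsmul _ _ (hc f)

lemma compL_assoc {P Q R S : FB × FB} (f : UwbHom k ε P Q) (g : UwbHom k ε Q R)
    (h : UwbHom k ε R S) :
    compL P R S (compL P Q R f g) h = compL P Q S f (compL Q R S g h) := by
  induction f using UwbHom.induction with
  | h0 => simp
  | hadd x y hx hy => simp [hx, hy]
  | hsmul r x hx => simp [hx]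
  | hc f =>
    induction g using UwbHom.induction with
    | h0 => simp
    | hadd x y hx hy => simp [hx, hy]
    | hsmul r x hx => simp [hx]
    | hc g =>
      induction h using UwbHom.induction with
      | h0 => simp
      | hadd x y hx hy => simp only [map_add, hx, hy]
      | hsmul r x hx => simp only [map_smul, hx]
      | hc h => simp [UwbOrd.assoc]

end UwbHom

namespace Uwb

variable {ε : Twist}

/-- The twisted `k`-linear upward walled Brauer category `(k uwb)_±`. -/
instance : Category (Uwb k ε) where
  Hom P Q := UwbHom k ε P.pair Q.pair
  id P := UwbHom.cls k ε (UwbOrd.id P.pair)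
  comp f g := UwbHom.compL _ _ _ f g
  id_comp {P Q} f := by
    refine LinearMap.congr_fun (g := LinearMap.id) (UwbHom.hom_ext fun a => ?_) f
    simp [UwbOrd.id_comp]
  comp_id {P Q} f := by
    refine LinearMap.congr_fun (f := (UwbHom.compL _ _ _).flip _) (g := LinearMap.id)
      (UwbHom.hom_ext fun a => ?_) f
    simp [UwbOrd.comp_id]
  assoc f g h := UwbHom.compL_assoc f g h

instance (P Q : Uwb k ε) : AddCommGroup (P ⟶ Q) :=
  inferInstanceAs (AddCommGroup (UwbHom k ε P.pair Q.pair))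

instance (P Q : Uwb k ε) : Module k (P ⟶ Q) :=
  inferInstanceAs (Module k (UwbHom k ε P.pair Q.pair))

instance : Preadditive (Uwb k ε) where
  homGroup _ _ := inferInstance
  add_comp _ _ _ f f' g := LinearMap.congr_fun (map_add (UwbHom.compL _ _ _) f f') g
  comp_add _ _ _ f g g' := map_add (UwbHom.compL _ _ _ f) g g'

instance : Linear k (Uwb k ε) where
  homModule _ _ := inferInstance
  smul_comp _ _ _ r f g := LinearMap.congr_fun (map_smul (UwbHom.compL _ _ _) r f) g
  comp_smul _ _ _ f r g := map_smul (UwbHom.compL _ _ _ f) r g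

variable (k ε) in
/-- The morphism `P → Q` of `(k uwb)_±` given by a morphism of the ordered category. -/
def homOf {P Q : FB × FB} (f : UwbOrd P Q) : (⟨P⟩ : Uwb k ε) ⟶ ⟨Q⟩ := UwbHom.cls k ε f

lemma homOf_comp {P Q R : FB × FB} (f : UwbOrd P Q) (g : UwbOrd Q R) :
    homOf k ε f ≫ homOf k ε g = homOf k ε (f.comp g) := UwbHom.compL_cls f g

end Uwb

/-- The morphism of degree zero given by a morphism of `FB × FB`. -/
def UwbOrd.ofBij {P Q : FB × FB} (φ : P ⟶ Q) : UwbOrd P Q :=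
  ⟨0, (Equiv.sumEmpty _ _).trans φ.1, (Equiv.sumEmpty _ _).trans φ.2⟩

lemma UwbOrd.ofBij_comp {P Q R : FB × FB} (φ : P ⟶ Q) (ψ : Q ⟶ R) :
    (ofBij φ).comp (ofBij ψ) = ofBij (φ ≫ ψ) :=
  UwbOrd.ext' rfl (fun _ => rfl) (fun i => i.elim0) (fun _ => rfl) (fun i => i.elim0)

/-- The bijection `(X \ {s}) ⨿ {1} ≃ X` which sends `1` to `s`. -/
def addPoint (X : FB) (s : X) : (X.del s).carrier ⊕ Fin 1 ≃ X.carrier := by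
  classical
  exact
  { toFun := Sum.elim (fun x => x.1) (fun _ => s)
    invFun := fun x => if h : x = s then Sum.inr 0 else Sum.inl ⟨x, h⟩
    left_inv := by
      rintro (x | i)
      · simp [x.2]
      · simp [Subsingleton.elim i 0]
    right_inv := fun x => by by_cases h : x = s <;> simp [h] }

/-- The morphism of degree one `(X \ {s}, Y \ {t}) → (X, Y)` of the ordered upward walled Brauer
category, given by the inclusions and the walled pair `(s, t)`. -/
def UwbOrd.beta (P : FB × FB) (s : P.1) (t : P.2) : UwbOrd (biDel P s t) P :=
  ⟨1, addPoint P.1 s, addPoint P.2 t⟩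

variable (k)

/-- Modules over `(k dwb)_±`, the opposite category of `(k uwb)_±`: the `k`-linear functors from
`(k dwb)_±` to `k`-vector spaces. -/
abbrev DwbMod (ε : Twist) :=
  ObjectProperty.FullSubcategory (C := (Uwb k ε)ᵒᵖ ⥤ ModuleCat.{v} k) (fun F =>
    F.Additive ∧ ∀ (P Q : Uwb k ε) (r : k) (f : P ⟶ Q), F.map (r • f).op = r • F.map f.op)

/-- The inclusion of `FB × FB` in `(k dwb)_±`, which sends a bijection to the morphism of degree zero
opposite to its inverse. -/
def dwbIncl (ε : Twist) : (FB × FB) ⥤ (Uwb k ε)ᵒᵖ where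
  obj P := Opposite.op ⟨P⟩
  map φ := (Uwb.homOf k ε (UwbOrd.ofBij (biHom (Equiv.symm φ.1) (Equiv.symm φ.2)))).op
  map_id P := by
    refine congrArg Quiver.Hom.op (congrArg (Uwb.homOf k ε) ?_)
    exact UwbOrd.ext' rfl (fun _ => rfl) (fun i => i.elim0) (fun _ => rfl) (fun i => i.elim0)
  map_comp f g := by
    rw [← op_comp, Uwb.homOf_comp, UwbOrd.ofBij_comp]
    rfl

/-- Restriction of `(k dwb)_±`-modules to `k(FB × FB)`-modules. -/
def dwbRestrict (ε : Twist) : DwbMod k ε ⥤ BiMod k :=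
  ObjectProperty.ι _ ⋙ (Functor.whiskeringLeft _ _ _).obj (dwbIncl k ε)

variable {k}

/-- A `(k dwb)_±`-module structure on `S_⊚^* D` (for `ε = +`) or on `Λ_⊚^* D` (for `ε = -`), that is, a
`(k dwb)_±`-module `A` together with an isomorphism `e` of its underlying `k(FB × FB)`-module with
`S_⊚^* D` or `Λ_⊚^* D`, is induced by `μ` if the morphisms of degree one act by the extension of `μ`. -/
def IsInduced {ε : Twist} (D : DiOpd k) (A : DwbMod k ε)
    (e : (dwbRestrict k ε).obj A ≅ (totalPow k ε).obj D.toBiMod) : Prop :=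
  ∀ (P : FB × FB) (s : P.1) (t : P.2),
    A.obj.map (Uwb.homOf k ε (UwbOrd.beta P s t)).op ≫ e.hom.app (biDel P s t) =
      e.hom.app P ≫ ModuleCat.ofHom (extendTotal ε D.mu P s t)

end Uwb

end

/-! Bijections and the morphisms `UwbOrd.beta` generate the walled Brauer category. A module over
its opposite therefore amounts to a k(FB × FB)-module with contractions of single walled pairs that
are natural in bijections and, for two walled pairs with no point in common, commute up to the sign
`ε.sgn` (1 for +, -1 for -). In one direction, a morphism with n walled pairs acts by n successive
contractions. The commutation rule makes a permutation of the pairs act through k^±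
(`Contractions.act_perm`), and concatenation of pairs gives functoriality (`Contractions.act_comp`),
so contractions define a module (`Contractions.toDwbMod`). In the other direction, an isomorphism of
underlying modules that respects the degree-one morphisms respects all morphisms
(`existsUnique_dwbMod_iso`), which is the uniqueness statement. What remains is that the extensions
of `μ` to the symmetric and exterior powers are natural and commute up to `ε.sgn`.

A generator of the powers is a family of vertices, each with two finite sets of legs and decorated
by an element of the dioperad (`Config`). The contraction of (s, t) vanishes if s and t are legs of
one vertex; otherwise it replaces the vertices of s and t by their composite along these legs
(`circMul`) and leaves the others alone. This is `Config.extend_gen`: in the transfer that defines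
the coproduct, only the permutations in S_n × S_2 contribute, all of them equally, and the factor
1/(2 n!) cancels their number.

Two contractions join the vertices by two edges. A loop or a double edge gives zero in both orders,
by diagonality. Edges without a common vertex give the same composites in both orders. Otherwise the
edges form a chain of three vertices, with three possible orientations up to exchange of the edges,
and the two orders are compared by `circMul_assoc`, `circMul_leftComm` and `circMul_rightComm`.

Signs come only from moving the two vertices to be composed to the last places. In each nonzero
shape the two orders differ by an odd number of exchanges, hence by `ε.sgn`. The bookkeeping is done
once for both signs and used twice: with ε = + on three vertices, where associativity in S³ yields
the three identities because S¹ of a module is the module itself, and then with arbitrary ε and any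
number of vertices, where these identities yield the commutation rule
(`Config.contractionsCommute`). -/

noncomputable section

/-! ### Bijections of pairs and deleted points -/

/-- The first component of a morphism of `FB × FB`, as a bijection. -/
abbrev fstEquiv {P Q : FB × FB} (φ : P ⟶ Q) : P.1.carrier ≃ Q.1.carrier := φ.1

/-- The second component of a morphism of `FB × FB`, as a bijection. -/
abbrev sndEquiv {P Q : FB × FB} (φ : P ⟶ Q) : P.2.carrier ≃ Q.2.carrier := φ.2

lemma biMor_ext {P Q : FB × FB} {φ ψ : P ⟶ Q} (h1 : ∀ x, fstEquiv φ x = fstEquiv ψ x)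
    (h2 : ∀ y, sndEquiv φ y = sndEquiv ψ y) : φ = ψ :=
  Prod.ext (Equiv.ext h1) (Equiv.ext h2)

/-- The restriction of a bijection to the complements of a walled pair and of its image. -/
def delMap {P Q : FB × FB} (φ : P ⟶ Q) {s : P.1} {t : P.2} {s' : Q.1} {t' : Q.2}
    (hs : fstEquiv φ s = s') (ht : sndEquiv φ t = t') : biDel P s t ⟶ biDel Q s' t' :=
  biHom ((fstEquiv φ).subtypeEquiv (fun x => by simp [← hs]))
    ((sndEquiv φ).subtypeEquiv (fun x => by simp [← ht]))

/-- The sign by which two walled pairs commute. -/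
def Twist.sgn : Twist → ℤˣ
  | .plus => 1
  | .minus => -1

lemma Twist.chi_one (ε : Twist) {n : ℕ} : ε.chi (1 : Equiv.Perm (Fin n)) = 1 := by
  cases ε <;> simp [Twist.chi]

lemma Twist.chi_swap (ε : Twist) {n : ℕ} {i j : Fin n} (h : i ≠ j) :
    ε.chi (Equiv.swap i j) = ε.sgn := by
  cases ε <;> simp [Twist.chi, Twist.sgn, Equiv.Perm.sign_swap h]

/-! ### Modules over the walled Brauer categories from contractions -/

section Contractions

variable {k : Type v} [Field k]

/-- Contractions of walled pairs on a `k(FB × FB)`-module, natural and commuting up to the sign. -/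
structure Contractions (ε : Twist) (T : BiMod k) where
  b : ∀ (P : FB × FB) (s : P.1) (t : P.2), T.obj P →ₗ[k] T.obj (biDel P s t)
  nat : ∀ {P Q : FB × FB} (φ : P ⟶ Q) (s : P.1) (t : P.2) (v : T.obj P),
    b Q (fstEquiv φ s) (sndEquiv φ t) ((T.map φ).hom v) = (T.map (delMap φ rfl rfl)).hom (b P s t v)
  comm : ∀ (P : FB × FB) (s₁ s₂ : P.1) (t₁ t₂ : P.2) (hs : s₂ ≠ s₁) (ht : t₂ ≠ t₁) (v : T.obj P),
    (T.map (biDelSwap P hs ht)).hom (b (biDel P s₁ t₁) ⟨s₂, hs⟩ ⟨t₂, ht⟩ (b P s₁ t₁ v)) =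
      (ε.sgn : ℤ) • b (biDel P s₂ t₂) ⟨s₁, hs.symm⟩ ⟨t₁, ht.symm⟩ (b P s₂ t₂ v)

/-- The bijection `X ⨿ n ≃ U \ {u}` obtained from a bijection `X ⨿ (n + 1) ≃ U` with `n ↦ u`. -/
def resEquiv {X U : Type} {n : ℕ} (f : X ⊕ Fin (n + 1) ≃ U) :
    X ⊕ Fin n ≃ {u : U // u ≠ f (Sum.inr (Fin.last n))} :=
  Equiv.ofBijective (Sum.elim (fun x => ⟨f (Sum.inl x), by simp⟩)
    (fun i => ⟨f (Sum.inr i.castSucc), by simp⟩)) (by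
    constructor
    · rintro (x | i) (y | j) h <;> simpa using congrArg Subtype.val h
    · rintro ⟨u, hu⟩
      obtain ⟨z, rfl⟩ := f.surjective u
      rcases z with x | i
      · exact ⟨Sum.inl x, rfl⟩
      · induction i using Fin.lastCases with
        | last => exact absurd rfl hu
        | cast i => exact ⟨Sum.inr i, rfl⟩)

namespace Contractions

variable {ε : Twist} {T : BiMod k} (B : Contractions ε T)

lemma nat' {P Q : FB × FB} (φ : P ⟶ Q) {s : P.1} {t : P.2} {s' : Q.1} {t' : Q.2}
    (hs : fstEquiv φ s = s') (ht : sndEquiv φ t = t') (v : T.obj P) :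
    B.b Q s' t' ((T.map φ).hom v) = (T.map (delMap φ hs ht)).hom (B.b P s t v) := by
  subst hs ht
  exact B.nat φ s t v

/-- The action of the morphism of the ordered category given by two bijections. -/
def act : ∀ (n : ℕ) {P Q : FB × FB} (_ : P.1.carrier ⊕ Fin n ≃ Q.1.carrier)
    (_ : P.2.carrier ⊕ Fin n ≃ Q.2.carrier), T.obj Q →ₗ[k] T.obj P
  | 0, _, _, f₁, f₂ =>
    (T.map (biHom ((Equiv.sumEmpty _ _).symm.trans f₁).symm
      ((Equiv.sumEmpty _ _).symm.trans f₂).symm)).hom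
  | n + 1, P, Q, f₁, f₂ =>
    act n (P := P) (Q := biDel Q (f₁ (Sum.inr (Fin.last n))) (f₂ (Sum.inr (Fin.last n))))
      (resEquiv f₁) (resEquiv f₂) ∘ₗ
      B.b Q (f₁ (Sum.inr (Fin.last n))) (f₂ (Sum.inr (Fin.last n)))

/-- Follows from naturality of the contractions, one walled pair at a time. It absorbs the
bijections by which complements formed in different orders differ. -/
lemma act_map : ∀ (n : ℕ) {P Q Q' : FB × FB} (f₁ : P.1.carrier ⊕ Fin n ≃ Q.1.carrier)
    (f₂ : P.2.carrier ⊕ Fin n ≃ Q.2.carrier) (g₁ : P.1.carrier ⊕ Fin n ≃ Q'.1.carrier)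
    (g₂ : P.2.carrier ⊕ Fin n ≃ Q'.2.carrier) (ψ : Q ⟶ Q') (_ : ∀ x, fstEquiv ψ (f₁ x) = g₁ x)
    (_ : ∀ x, sndEquiv ψ (f₂ x) = g₂ x) (v : T.obj Q),
    B.act n g₁ g₂ ((T.map ψ).hom v) = B.act n f₁ f₂ v
  | 0, P, Q, Q', f₁, f₂, g₁, g₂, ψ, h₁, h₂, v => by
    refine (BiMod.map_map T _ _ v).trans (congrArg (fun φ => (T.map φ).hom v) ?_)
    refine biMor_ext (fun x => ?_) (fun x => ?_)
    · change (Equiv.sumEmpty _ _) (g₁.symm (fstEquiv ψ x)) = (Equiv.sumEmpty _ _) (f₁.symm x)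
      rw [← f₁.apply_symm_apply x, h₁]; simp
    · change (Equiv.sumEmpty _ _) (g₂.symm (sndEquiv ψ x)) = (Equiv.sumEmpty _ _) (f₂.symm x)
      rw [← f₂.apply_symm_apply x, h₂]; simp
  | n + 1, P, Q, Q', f₁, f₂, g₁, g₂, ψ, h₁, h₂, v => by
    refine (congrArg (B.act n (resEquiv g₁) (resEquiv g₂))
      (B.nat' ψ (h₁ (Sum.inr (Fin.last n))) (h₂ (Sum.inr (Fin.last n))) v)).trans ?_
    refine act_map n (P := P) (Q := biDel Q _ _) (Q' := biDel Q' _ _) (resEquiv f₁) (resEquiv f₂)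
      (resEquiv g₁) (resEquiv g₂) _ ?_ ?_ _
    · rintro (x | i)
      · exact Subtype.ext (h₁ _)
      · exact Subtype.ext (h₁ _)
    · rintro (x | i)
      · exact Subtype.ext (h₂ _)
      · exact Subtype.ext (h₂ _)

/-- The contracted points enter through equations and the remaining bijections only through their
values, so that two orders of contraction can be compared without transport between types. -/
lemma act_two {n : ℕ} {P Q : FB × FB} (f₁ : P.1.carrier ⊕ Fin (n + 2) ≃ Q.1.carrier)
    (f₂ : P.2.carrier ⊕ Fin (n + 2) ≃ Q.2.carrier) {s₁ s₂ : Q.1} {t₁ t₂ : Q.2}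
    (hs₁ : f₁ (Sum.inr (Fin.last (n + 1))) = s₁)
    (hs₂ : f₁ (Sum.inr (Fin.last n).castSucc) = s₂)
    (ht₁ : f₂ (Sum.inr (Fin.last (n + 1))) = t₁) (ht₂ : f₂ (Sum.inr (Fin.last n).castSucc) = t₂)
    (hs : s₂ ≠ s₁) (ht : t₂ ≠ t₁) :
    ∃ (h₁ : P.1.carrier ⊕ Fin n ≃ (biDel (biDel Q s₁ t₁) ⟨s₂, hs⟩ ⟨t₂, ht⟩).1.carrier)
      (h₂ : P.2.carrier ⊕ Fin n ≃ (biDel (biDel Q s₁ t₁) ⟨s₂, hs⟩ ⟨t₂, ht⟩).2.carrier),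
      (∀ x, (h₁ x).1.1 = f₁ (Sum.map _root_.id (fun i => i.castSucc.castSucc) x)) ∧
      (∀ x, (h₂ x).1.1 = f₂ (Sum.map _root_.id (fun i => i.castSucc.castSucc) x)) ∧
      ∀ v, B.act (n + 2) f₁ f₂ v =
        B.act n h₁ h₂ (B.b (biDel Q s₁ t₁) ⟨s₂, hs⟩ ⟨t₂, ht⟩ (B.b Q s₁ t₁ v)) := by
  subst hs₁ hs₂ ht₁ ht₂
  refine ⟨resEquiv (resEquiv f₁), resEquiv (resEquiv f₂), ?_, ?_, fun v => rfl⟩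
  · rintro (x | i) <;> rfl
  · rintro (x | i) <;> rfl

/-- Change of the order of the walled pairs. -/
abbrev permEquiv {X U : Type} {n : ℕ} (σ : Equiv.Perm (Fin n)) (f : X ⊕ Fin n ≃ U) :
    X ⊕ Fin n ≃ U := ((Equiv.refl X).sumCongr σ).trans f

/-- The last two pairs are contracted first, so their exchange is exactly the commutation rule. -/
lemma act_swap_last (n : ℕ) {P Q : FB × FB} (f₁ : P.1.carrier ⊕ Fin (n + 2) ≃ Q.1.carrier)
    (f₂ : P.2.carrier ⊕ Fin (n + 2) ≃ Q.2.carrier) (v : T.obj Q) :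
    B.act (n + 2) (permEquiv (Equiv.swap (Fin.last n).castSucc (Fin.last n).succ) f₁)
      (permEquiv (Equiv.swap (Fin.last n).castSucc (Fin.last n).succ) f₂) v =
      (ε.sgn : ℤ) • B.act (n + 2) f₁ f₂ v := by
  have hl : (Fin.last n).castSucc ≠ Fin.last (n + 1) := (Fin.castSucc_lt_last _).ne
  have hi : ∀ i : Fin n, Equiv.swap (Fin.last n).castSucc (Fin.last n).succ i.castSucc.castSucc =
      i.castSucc.castSucc := fun i => Equiv.swap_apply_of_ne_of_ne
    (by simpa using (Fin.castSucc_lt_last i).ne) (by simpa using (Fin.castSucc_lt_last _).ne)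
  obtain ⟨h₁, h₂, e₁, e₂, e⟩ := B.act_two f₁ f₂ rfl rfl rfl rfl
    (f₁.injective.ne (by simpa using hl)) (f₂.injective.ne (by simpa using hl))
  obtain ⟨h₁', h₂', e₁', e₂', e'⟩ := B.act_two
    (permEquiv (Equiv.swap (Fin.last n).castSucc (Fin.last n).succ) f₁)
    (permEquiv (Equiv.swap (Fin.last n).castSucc (Fin.last n).succ) f₂)
    (s₁ := f₁ (Sum.inr (Fin.last n).castSucc)) (s₂ := f₁ (Sum.inr (Fin.last (n + 1))))
    (t₁ := f₂ (Sum.inr (Fin.last n).castSucc)) (t₂ := f₂ (Sum.inr (Fin.last (n + 1))))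
    (by simp [← Fin.succ_last]) (by simp [← Fin.succ_last]) (by simp [← Fin.succ_last])
    (by simp [← Fin.succ_last])
    (f₁.injective.ne (by simpa using hl.symm)) (f₂.injective.ne (by simpa using hl.symm))
  -- Both sides are now the same n remaining pairs applied to the two double contractions of `v`.
  -- After `B.comm` these differ by `biDelSwap`, which `act_map` removes.
  rw [e', e, ← map_zsmul, ← B.comm _ _ _ _ _ (f₁.injective.ne (by simpa using hl.symm))
    (f₂.injective.ne (by simpa using hl.symm))]
  refine (B.act_map n _ _ _ _ _ (fun x => Subtype.ext (Subtype.ext ?_))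
    (fun x => Subtype.ext (Subtype.ext ?_)) _).symm
  · refine (e₁' x).trans (Eq.trans ?_ (e₁ x).symm)
    rcases x with x | i
    · rfl
    · exact congrArg (fun i => f₁ (Sum.inr i)) (hi i)
  · refine (e₂' x).trans (Eq.trans ?_ (e₂ x).symm)
    rcases x with x | i
    · rfl
    · exact congrArg (fun i => f₂ (Sum.inr i)) (hi i)

/-- The recursive definition, freed from the particular form of the points and of `resEquiv`: a
bijection to the complement is determined by its values. -/
lemma act_succ {n : ℕ} {P Q : FB × FB} (f₁ : P.1.carrier ⊕ Fin (n + 1) ≃ Q.1.carrier)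
    (f₂ : P.2.carrier ⊕ Fin (n + 1) ≃ Q.2.carrier) {s : Q.1} {t : Q.2}
    (hs : f₁ (Sum.inr (Fin.last n)) = s) (ht : f₂ (Sum.inr (Fin.last n)) = t)
    (g₁ : P.1.carrier ⊕ Fin n ≃ (biDel Q s t).1.carrier)
    (g₂ : P.2.carrier ⊕ Fin n ≃ (biDel Q s t).2.carrier)
    (h₁ : ∀ x, (g₁ x).1 = f₁ (Sum.map _root_.id Fin.castSucc x))
    (h₂ : ∀ x, (g₂ x).1 = f₂ (Sum.map _root_.id Fin.castSucc x)) (v : T.obj Q) :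
    B.act (n + 1) f₁ f₂ v = B.act n g₁ g₂ (B.b Q s t v) := by
  subst hs ht
  have e₁ : g₁ = resEquiv f₁ := by
    refine Equiv.ext fun x => Subtype.ext ((h₁ x).trans ?_)
    rcases x with x | x <;> rfl
  have e₂ : g₂ = resEquiv f₂ := by
    refine Equiv.ext fun x => Subtype.ext ((h₂ x).trans ?_)
    rcases x with x | x <;> rfl
  rw [e₁, e₂]
  rfl

/-- This is what lets the action descend to the quotient by the relations of k^±. -/
lemma act_perm : ∀ (n : ℕ) (σ : Equiv.Perm (Fin n)) {P Q : FB × FB}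
    (f₁ : P.1.carrier ⊕ Fin n ≃ Q.1.carrier) (f₂ : P.2.carrier ⊕ Fin n ≃ Q.2.carrier) (v : T.obj Q),
    B.act n (permEquiv σ f₁) (permEquiv σ f₂) v = (ε.chi σ : ℤ) • B.act n f₁ f₂ v := by
  have one : ∀ (n : ℕ) {P Q : FB × FB}
      (f₁ : P.1.carrier ⊕ Fin n ≃ Q.1.carrier) (f₂ : P.2.carrier ⊕ Fin n ≃ Q.2.carrier)
      (v : T.obj Q), B.act n (permEquiv 1 f₁) (permEquiv 1 f₂) v =
        (ε.chi (1 : Equiv.Perm (Fin n)) : ℤ) • B.act n f₁ f₂ v := by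
    intro n P Q f₁ f₂ v
    have h₁ : permEquiv 1 f₁ = f₁ := by ext x; rcases x with x | x <;> rfl
    have h₂ : permEquiv 1 f₂ = f₂ := by ext x; rcases x with x | x <;> rfl
    rw [h₁, h₂, ε.chi_one, Units.val_one, one_zsmul]
  intro n
  induction n with
  | zero =>
    intro σ P Q f₁ f₂ v
    rw [Subsingleton.elim σ 1]
    exact one 0 f₁ f₂ v
  | succ n ih =>
    intro σ
    -- Both sides are multiplicative in σ, so adjacent transpositions suffice.
    have hσ : σ ∈ Submonoid.closure
        (Set.range fun i : Fin n => Equiv.swap i.castSucc i.succ) := by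
      rw [Equiv.Perm.mclosure_swap_castSucc_succ]; trivial
    induction hσ using Submonoid.closure_induction with
    | one => intro P Q f₁ f₂ v; exact one _ f₁ f₂ v
    | mul σ τ _ _ h h' =>
      intro P Q f₁ f₂ v
      have e₁ : permEquiv (σ * τ) f₁ = permEquiv τ (permEquiv σ f₁) := by
        ext x; rcases x with x | x <;> rfl
      have e₂ : permEquiv (σ * τ) f₂ = permEquiv τ (permEquiv σ f₂) := by
        ext x; rcases x with x | x <;> rfl
      rw [e₁, e₂, h', h, smul_smul, ε.chi_mul, Units.val_mul, mul_comm]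
    | mem σ hσ =>
      obtain ⟨i, rfl⟩ := hσ
      intro P Q f₁ f₂ v
      dsimp only
      rw [ε.chi_swap (Fin.castSucc_lt_succ).ne]
      cases n with
      | zero => exact i.elim0
      | succ m =>
        induction i using Fin.lastCases with
        | last => exact B.act_swap_last m f₁ f₂ v
        -- This transposition fixes the last pair, which is contracted first; the rest is the
        -- induction hypothesis.
        | cast j =>
          have hne : j.castSucc ≠ j.succ := (Fin.castSucc_lt_succ).ne
          have hl : Equiv.swap j.castSucc.castSucc j.castSucc.succ (Fin.last (m + 1)) =
              Fin.last (m + 1) := Equiv.swap_apply_of_ne_of_ne (Fin.castSucc_lt_last _).ne'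
                (by rw [Fin.succ_castSucc]; exact (Fin.castSucc_lt_last _).ne')
          have hi : ∀ i : Fin (m + 1), Equiv.swap j.castSucc.castSucc j.castSucc.succ i.castSucc =
              (Equiv.swap j.castSucc j.succ i).castSucc := by
            intro i
            rw [Fin.succ_castSucc]
            exact (Fin.castSucc_injective _).swap_apply _ _ _
          refine (B.act_succ
            (permEquiv (Equiv.swap j.castSucc.castSucc j.castSucc.succ) f₁)
            (permEquiv (Equiv.swap j.castSucc.castSucc j.castSucc.succ) f₂) (s := f₁ (Sum.inr (Fin.last (m + 1))))
            (t := f₂ (Sum.inr (Fin.last (m + 1))))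
            (congrArg (fun i => f₁ (Sum.inr i)) hl) (congrArg (fun i => f₂ (Sum.inr i)) hl)
            (permEquiv (Equiv.swap j.castSucc j.succ) (resEquiv f₁))
            (permEquiv (Equiv.swap j.castSucc j.succ) (resEquiv f₂)) ?_ ?_ v).trans ?_
          · rintro (x | i)
            · rfl
            · exact congrArg (fun i => f₁ (Sum.inr i)) (hi i).symm
          · rintro (x | i)
            · rfl
            · exact congrArg (fun i => f₂ (Sum.inr i)) (hi i).symm
          · rw [ih, ε.chi_swap hne]
            rfl

/-- The pairs of a composite are those of `f` followed by those of `g`, and contraction starts from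
the end. So the pairs of `g` are removed one by one until only a bijection is left. -/
lemma act_comp {n : ℕ} {P Q : FB × FB} (f₁ : P.1.carrier ⊕ Fin n ≃ Q.1.carrier)
    (f₂ : P.2.carrier ⊕ Fin n ≃ Q.2.carrier) : ∀ (m : ℕ) {R : FB × FB}
    (g₁ : Q.1.carrier ⊕ Fin m ≃ R.1.carrier) (g₂ : Q.2.carrier ⊕ Fin m ≃ R.2.carrier) (v : T.obj R),
    B.act (n + m) (compFin f₁ g₁) (compFin f₂ g₂) v = B.act n f₁ f₂ (B.act m g₁ g₂ v)
  | 0, R, g₁, g₂, v => by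
    -- With no pairs in `g`, the comparison is along the inverse of the bijection given by `g`.
    refine (B.act_map n (compFin f₁ g₁) (compFin f₂ g₂) f₁ f₂ _ ?_ ?_ v).symm
    · rintro (x | i)
      · change (Equiv.sumEmpty _ _) (g₁.symm (g₁ (Sum.inl (f₁ (Sum.inl x))))) = _
        rw [Equiv.symm_apply_apply]; rfl
      · refine Eq.trans (congrArg _ (compFin_left f₁ g₁ i)) ?_
        change (Equiv.sumEmpty _ _) (g₁.symm (g₁ (Sum.inl (f₁ (Sum.inr i))))) = _
        rw [Equiv.symm_apply_apply]; rfl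
    · rintro (x | i)
      · change (Equiv.sumEmpty _ _) (g₂.symm (g₂ (Sum.inl (f₂ (Sum.inl x))))) = _
        rw [Equiv.symm_apply_apply]; rfl
      · refine Eq.trans (congrArg _ (compFin_left f₂ g₂ i)) ?_
        change (Equiv.sumEmpty _ _) (g₂.symm (g₂ (Sum.inl (f₂ (Sum.inr i))))) = _
        rw [Equiv.symm_apply_apply]; rfl
  | m + 1, R, g₁, g₂, v => by
    have ih := act_comp f₁ f₂ m (R := biDel R (g₁ (Sum.inr (Fin.last m)))
      (g₂ (Sum.inr (Fin.last m)))) (resEquiv g₁) (resEquiv g₂)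
      (B.b R (g₁ (Sum.inr (Fin.last m))) (g₂ (Sum.inr (Fin.last m))) v)
    refine Eq.trans ?_ ih
    refine B.act_succ (n := n + m) (P := P) (Q := R) (compFin (m := m + 1) f₁ g₁)
      (compFin (m := m + 1) f₂ g₂) (s := g₁ (Sum.inr (Fin.last m))) (t := g₂ (Sum.inr (Fin.last m)))
      (compFin_right f₁ g₁ (Fin.last m)) (compFin_right f₂ g₂ (Fin.last m))
      (compFin f₁ (resEquiv g₁)) (compFin f₂ (resEquiv g₂)) ?_ ?_ v
    · rintro (x | i)
      · rfl
      · induction i using Fin.addCases with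
        | left i =>
          rw [compFin_left]
          exact (compFin_left f₁ g₁ i).symm
        | right i =>
          rw [compFin_right]
          exact (compFin_right f₁ g₁ i.castSucc).symm
    · rintro (x | i)
      · rfl
      · induction i using Fin.addCases with
        | left i =>
          rw [compFin_left]
          exact (compFin_left f₂ g₂ i).symm
        | right i =>
          rw [compFin_right]
          exact (compFin_right f₂ g₂ i.castSucc).symm

/-- The action of a morphism of `(k uwb)_±`. -/
def actHom (P Q : FB × FB) : UwbHom k ε P Q →ₗ[k] T.obj Q →ₗ[k] T.obj P :=
  UwbHom.lift (fun f => B.act f.deg f.fst f.snd) (fun f σ => LinearMap.ext fun v => by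
    rw [LinearMap.smul_apply, Int.cast_smul_eq_zsmul]
    exact B.act_perm f.deg σ f.fst f.snd v)

@[simp] lemma actHom_cls {P Q : FB × FB} (f : UwbOrd P Q) :
    B.actHom P Q (UwbHom.cls k ε f) = B.act f.deg f.fst f.snd := UwbHom.lift_cls _ _ _

lemma actHom_comp {P Q R : FB × FB} (f : UwbHom k ε P Q) (g : UwbHom k ε Q R) :
    B.actHom P R (UwbHom.compL P Q R f g) = B.actHom P Q f ∘ₗ B.actHom Q R g := by
  induction f using UwbHom.induction with
  | h0 => simp
  | hadd x y hx hy => simp [hx, hy, LinearMap.add_comp]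
  | hsmul r x hx => simp [hx, LinearMap.smul_comp]
  | hc f =>
    induction g using UwbHom.induction with
    | h0 => simp
    | hadd x y hx hy => simp only [map_add, hx, hy, LinearMap.comp_add]
    | hsmul r x hx => simp only [map_smul, hx, LinearMap.comp_smul]
    | hc g =>
      rw [UwbHom.compL_cls, actHom_cls, actHom_cls, actHom_cls]
      exact LinearMap.ext fun v => B.act_comp f.fst f.snd g.deg g.fst g.snd v

/-- The `(k dwb)_±`-module defined by contractions. -/
def toDwbMod : DwbMod k ε where
  obj :=
    { obj := fun P => T.obj P.unop.pair
      map := fun f => ModuleCat.ofHom (B.actHom _ _ f.unop)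
      map_id := fun P => by
        refine ModuleCat.hom_ext ((B.actHom_cls _).trans ?_)
        exact congrArg ModuleCat.Hom.hom (T.map_id P.unop.pair)
      map_comp := fun f g => ModuleCat.hom_ext (B.actHom_comp g.unop f.unop) }
  property := by
    refine ⟨⟨fun {P Q f g} => ModuleCat.hom_ext (map_add (B.actHom _ _) f.unop g.unop)⟩,
      fun P Q r f => ModuleCat.hom_ext (map_smul (B.actHom _ _) r f)⟩

/-- The underlying `k(FB × FB)`-module of `toDwbMod`. -/
def restrictIso : (dwbRestrict k ε).obj B.toDwbMod ≅ T :=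
  NatIso.ofComponents (fun P => Iso.refl (T.obj P)) (fun {P Q} φ => by
    refine (Category.comp_id _).trans (Eq.trans ?_ (Category.id_comp _).symm)
    exact ModuleCat.hom_ext (B.actHom_cls (UwbOrd.ofBij _)))

lemma toDwbMod_beta (P : FB × FB) (s : P.1) (t : P.2) :
    B.toDwbMod.obj.map (Uwb.homOf k ε (UwbOrd.beta P s t)).op = ModuleCat.ofHom (B.b P s t) := by
  refine ModuleCat.hom_ext ((B.actHom_cls _).trans (LinearMap.ext fun v => ?_))
  refine (B.act_succ (n := 0) (P := biDel P s t) (UwbOrd.beta P s t).fst (UwbOrd.beta P s t).snd rfl rfl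
    (Equiv.sumEmpty _ _) (Equiv.sumEmpty _ _) ?_ ?_ v).trans ?_
  · rintro (x | i)
    · rfl
    · exact i.elim0
  · rintro (x | i)
    · rfl
    · exact i.elim0
  · exact LinearMap.congr_fun (congrArg ModuleCat.Hom.hom (T.map_id (biDel P s t))) _

lemma act_nat {T' : BiMod k} (B' : Contractions ε T') (g : T ⟶ T')
    (h : ∀ P s t v, (g.app (biDel P s t)).hom (B.b P s t v) = B'.b P s t ((g.app P).hom v)) :
    ∀ (n : ℕ) {P Q : FB × FB} (f₁ : P.1.carrier ⊕ Fin n ≃ Q.1.carrier)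
    (f₂ : P.2.carrier ⊕ Fin n ≃ Q.2.carrier) (v : T.obj Q),
    (g.app P).hom (B.act n f₁ f₂ v) = B'.act n f₁ f₂ ((g.app Q).hom v)
  | 0, P, Q, f₁, f₂, v => BiMod.nat g _ v
  | n + 1, P, Q, f₁, f₂, v =>
    (act_nat B' g h n (Q := biDel Q _ _) (resEquiv f₁) (resEquiv f₂) _).trans
      (congrArg (B'.act n (resEquiv f₁) (resEquiv f₂)) (h _ _ _ v))

lemma actHom_nat {T' : BiMod k} (B' : Contractions ε T') (g : T ⟶ T')
    (h : ∀ P s t v, (g.app (biDel P s t)).hom (B.b P s t v) = B'.b P s t ((g.app P).hom v))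
    {P Q : FB × FB} (f : UwbHom k ε P Q) :
    (g.app P).hom ∘ₗ B.actHom P Q f = B'.actHom P Q f ∘ₗ (g.app Q).hom := by
  induction f using UwbHom.induction with
  | h0 => simp
  | hadd x y hx hy => simp only [map_add, LinearMap.add_comp, LinearMap.comp_add, hx, hy]
  | hsmul r x hx => simp only [map_smul, LinearMap.smul_comp, LinearMap.comp_smul, hx]
  | hc f =>
    rw [actHom_cls, actHom_cls]
    exact LinearMap.ext fun v => B.act_nat B' g h f.deg f.fst f.snd v

/-- Morphisms compatible with the contractions are morphisms of `(k dwb)_±`-modules. -/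
def mapDwbMod {T' : BiMod k} (B' : Contractions ε T') (g : T ⟶ T')
    (h : ∀ P s t v, (g.app (biDel P s t)).hom (B.b P s t v) = B'.b P s t ((g.app P).hom v)) :
    B.toDwbMod ⟶ B'.toDwbMod :=
  ObjectProperty.homMk
    { app := fun P => g.app P.unop.pair
      naturality := fun P Q f => ModuleCat.hom_ext (B.actHom_nat B' g h f.unop) }

end Contractions

/-! ### Generators of the walled Brauer category and uniqueness of the module structure -/

/-- The action of the morphisms of `(k uwb)_±` on a `(k dwb)_±`-module. -/
def dwbAct {ε : Twist} (A : DwbMod k ε) (P Q : FB × FB) :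
    UwbHom k ε P Q →ₗ[k] (A.obj.obj (.op ⟨Q⟩) ⟶ A.obj.obj (.op ⟨P⟩)) where
  toFun f := A.obj.map (Quiver.Hom.op (X := (⟨P⟩ : Uwb k ε)) (Y := ⟨Q⟩) f)
  map_add' _ _ := A.property.1.map_add
  map_smul' r _ := A.property.2 _ _ r _

/-- Bijections and morphisms of degree one generate `(k uwb)_±`. -/
lemma dwbMod_naturality {ε : Twist} {A A' : DwbMod k ε}
    (g : ∀ P : FB × FB, A.obj.obj (.op ⟨P⟩) ⟶ A'.obj.obj (.op ⟨P⟩))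
    (h₀ : ∀ {P Q : FB × FB} (φ : P ⟶ Q), dwbAct A P Q (UwbHom.cls k ε (UwbOrd.ofBij φ)) ≫ g P =
        g Q ≫ dwbAct A' P Q (UwbHom.cls k ε (UwbOrd.ofBij φ)))
    (h₁ : ∀ (P : FB × FB) (s : P.1) (t : P.2),
      dwbAct A _ P (UwbHom.cls k ε (UwbOrd.beta P s t)) ≫ g (biDel P s t) =
        g P ≫ dwbAct A' _ P (UwbHom.cls k ε (UwbOrd.beta P s t)))
    {P Q : FB × FB} (f : UwbHom k ε P Q) :
    dwbAct A P Q f ≫ g P = g Q ≫ dwbAct A' P Q f := by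
  have hc : ∀ (A : DwbMod k ε) {P Q R : FB × FB} (a : UwbOrd P Q) (b : UwbOrd Q R),
      dwbAct A P R (UwbHom.cls k ε (a.comp b)) =
        dwbAct A Q R (UwbHom.cls k ε b) ≫ dwbAct A P Q (UwbHom.cls k ε a) := by
    intro A P Q R a b
    rw [← UwbHom.compL_cls]
    exact A.obj.map_comp (Uwb.homOf k ε b).op (Uwb.homOf k ε a).op
  have key : ∀ (n : ℕ) {P Q : FB × FB} (f₁ : P.1.carrier ⊕ Fin n ≃ Q.1.carrier)
      (f₂ : P.2.carrier ⊕ Fin n ≃ Q.2.carrier),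
      dwbAct A P Q (UwbHom.cls k ε ⟨n, f₁, f₂⟩) ≫ g P =
        g Q ≫ dwbAct A' P Q (UwbHom.cls k ε ⟨n, f₁, f₂⟩) := by
    intro n
    induction n with
    | zero =>
      intro P Q f₁ f₂
      have e : (⟨0, f₁, f₂⟩ : UwbOrd P Q) = UwbOrd.ofBij (biHom
          ((Equiv.sumEmpty _ _).symm.trans f₁) ((Equiv.sumEmpty _ _).symm.trans f₂)) :=
        UwbOrd.ext' rfl (fun _ => rfl) (fun i => i.elim0) (fun _ => rfl) (fun i => i.elim0)
      rw [e, h₀]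
    | succ n ih =>
      intro P Q f₁ f₂
      -- A morphism with n + 1 pairs is a morphism with n pairs to the complement of the last pair,
      -- followed by the degree-one morphism of that pair.
      have e : (⟨n + 1, f₁, f₂⟩ : UwbOrd P Q) =
          UwbOrd.comp (Q := biDel Q (f₁ (Sum.inr (Fin.last n))) (f₂ (Sum.inr (Fin.last n))))
            ⟨n, resEquiv f₁, resEquiv f₂⟩ (UwbOrd.beta Q _ _) := by
        refine UwbOrd.ext' rfl (fun _ => rfl) (fun i => ?_) (fun _ => rfl) (fun i => ?_)
        · induction i using Fin.addCases with
          | left i => exact (compFin_left (resEquiv f₁) (addPoint Q.1 _) i).symm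
          | right i =>
            obtain rfl : i = 0 := Subsingleton.elim _ _
            exact (compFin_right (resEquiv f₁) (addPoint Q.1 _) 0).symm
        · induction i using Fin.addCases with
          | left i => exact (compFin_left (resEquiv f₂) (addPoint Q.2 _) i).symm
          | right i =>
            obtain rfl : i = 0 := Subsingleton.elim _ _
            exact (compFin_right (resEquiv f₂) (addPoint Q.2 _) 0).symm
      rw [e, hc, hc, Category.assoc, ih, ← Category.assoc, h₁, Category.assoc]
  induction f using UwbHom.induction with
  | h0 => simp
  | hadd x y hx hy => rw [map_add, map_add, Preadditive.add_comp, Preadditive.comp_add, hx, hy]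
  | hsmul r x hx => rw [map_smul, map_smul, Linear.smul_comp, Linear.comp_smul, hx]
  | hc f => exact key f.deg f.fst f.snd

/-- An isomorphism of underlying `k(FB × FB)`-modules under which the morphisms of degree one
correspond is an isomorphism of `(k dwb)_±`-modules, in a unique way. -/
lemma existsUnique_dwbMod_iso {ε : Twist} {A A' : DwbMod k ε} {T : BiMod k}
    (e : (dwbRestrict k ε).obj A ≅ T) (e' : (dwbRestrict k ε).obj A' ≅ T)
    (b : ∀ (P : FB × FB) (s : P.1) (t : P.2), T.obj P ⟶ T.obj (biDel P s t))
    (h : ∀ (P : FB × FB) (s : P.1) (t : P.2),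
      A.obj.map (Uwb.homOf k ε (UwbOrd.beta P s t)).op ≫ e.hom.app (biDel P s t) =
        e.hom.app P ≫ b P s t)
    (h' : ∀ (P : FB × FB) (s : P.1) (t : P.2),
      A'.obj.map (Uwb.homOf k ε (UwbOrd.beta P s t)).op ≫ e'.hom.app (biDel P s t) =
        e'.hom.app P ≫ b P s t) :
    ∃! i : A ≅ A', (dwbRestrict k ε).map i.hom ≫ e'.hom = e.hom := by
  let g (P : FB × FB) : A.obj.obj (.op ⟨P⟩) ≅ A'.obj.obj (.op ⟨P⟩) := e.app P ≪≫ (e'.app P).symm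
  have hg : ∀ P, (g P).hom ≫ e'.hom.app P = e.hom.app P := fun P =>
    (Category.assoc _ _ _).trans ((congrArg (e.hom.app P ≫ ·) (e'.inv_hom_id_app P)).trans
      (Category.comp_id _))
  have h₁ : ∀ (P : FB × FB) (s : P.1) (t : P.2),
      dwbAct A _ P (UwbHom.cls k ε (UwbOrd.beta P s t)) ≫ (g (biDel P s t)).hom =
        (g P).hom ≫ dwbAct A' _ P (UwbHom.cls k ε (UwbOrd.beta P s t)) := by
    intro P s t
    refine (cancel_mono (e'.app (biDel P s t)).hom).1 ?_
    refine (Category.assoc _ _ _).trans ?_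
    refine (congrArg (dwbAct A _ P (UwbHom.cls k ε (UwbOrd.beta P s t)) ≫ ·) (hg _)).trans ?_
    refine (h P s t).trans (Eq.trans ?_ (Category.assoc _ _ _).symm)
    refine Eq.trans ?_ (congrArg ((g P).hom ≫ ·) (h' P s t).symm)
    exact (congrArg (· ≫ b P s t) (hg P).symm).trans (Category.assoc _ _ _)
  -- A degree-zero morphism acts as the inverse bijection does on the underlying module, so
  -- naturality is used at the inverse of φ.
  have h₀ : ∀ {P Q : FB × FB} (φ : P ⟶ Q),
      dwbAct A P Q (UwbHom.cls k ε (UwbOrd.ofBij φ)) ≫ (g P).hom =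
        (g Q).hom ≫ dwbAct A' P Q (UwbHom.cls k ε (UwbOrd.ofBij φ)) := fun {P Q} φ =>
    (e ≪≫ e'.symm).hom.naturality (X := Q) (Y := P) (biHom (fstEquiv φ).symm (sndEquiv φ).symm)
  let j : A.obj ≅ A'.obj := NatIso.ofComponents (fun P => g P.unop.pair)
    (fun {P Q} f => dwbMod_naturality (fun P => (g P).hom) h₀ h₁ f.unop)
  refine ⟨ObjectProperty.isoMk _ j, NatTrans.ext (funext hg), fun i hi => ?_⟩
  -- Uniqueness: every component is forced, because `e'` is invertible.
  refine Iso.ext (ObjectProperty.hom_ext _ (NatTrans.ext (funext fun P => ?_)))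
  refine (cancel_mono (e'.app P.unop.pair).hom).1 (Eq.trans ?_ (hg _).symm)
  exact congrArg (fun α => α.app P.unop.pair) hi

end Contractions

section Composition

variable {k : Type v} [Field k]

/-! ### Naturality of the components of `μ` -/

section dsOf

variable {ι κ : Type} {A : ι → Type v} {B : κ → Type v}
    [∀ i, AddCommGroup (A i)] [∀ i, Module k (A i)] [∀ i, AddCommGroup (B i)]
    [∀ i, Module k (B i)]

open Classical in
variable (k A) in
/-- The inclusion of a summand of a direct sum. -/
def dsOf (i : ι) : A i →ₗ[k] ⨁ i, A i := DirectSum.lof k ι A i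

/-- `dsOf` fixes one decidability instance for the index type; this lemma converts from whatever
instance `DirectSum.lof` carries. -/
lemma lof_eq_dsOf [inst : DecidableEq ι] (i : ι) : DirectSum.lof k ι A i = dsOf k A i := by
  rw [Subsingleton.elim inst (fun a b => Classical.propDecidable (a = b))]
  rfl

lemma dsMap_dsOf (p : ι → κ) (f : ∀ i, A i →ₗ[k] B (p i)) (i : ι) (a : A i) :
    dsMap p f (dsOf k A i a) = dsOf k B (p i) (f i a) := dsMap_lof p f i a

open Classical in
lemma component_dsOf (i j : ι) (a : A i) :
    DirectSum.component k ι A j (dsOf k A i a) = if h : i = j then h ▸ a else 0 :=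
  (DirectSum.component.of (R := k) (M := A) j i a).trans (by split_ifs with h <;> [(subst h; rfl); rfl])

lemma dsOf_ext {V : Type*} [AddCommGroup V] [Module k V] {f g : (⨁ i, A i) →ₗ[k] V}
    (h : ∀ i a, f (dsOf k A i a) = g (dsOf k A i a)) : f = g := by
  classical
  refine DirectSum.linearMap_ext _ fun i => LinearMap.ext fun a => ?_
  rw [lof_eq_dsOf]
  exact h i a

end dsOf

/-- A pure tensor of `M ⊚ N`. -/
def dayMk {M N : BiMod k} {P : FB × FB} (c : Dec P (Fin 2)) (x : M.obj (c.part 0))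
    (y : N.obj (c.part 1)) : (day M N).obj P :=
  dsOf k (fun c : Dec P (Fin 2) => (M.obj (c.part 0)) ⊗[k] (N.obj (c.part 1))) c (x ⊗ₜ y)

lemma dayMap_dayMk {M M' N N' : BiMod k} (f : M ⟶ M') (g : N ⟶ N') {P : FB × FB}
    (c : Dec P (Fin 2)) (x : M.obj (c.part 0)) (y : N.obj (c.part 1)) :
    ((dayMap f g).app P).hom (dayMk c x y) = dayMk c ((f.app _).hom x) ((g.app _).hom y) :=
  dsMap_dsOf (k := k) (fun c : Dec P (Fin 2) => c) (fun c =>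
    TensorProduct.map (f.app (c.part 0)).hom (g.app (c.part 1)).hom) c (x ⊗ₜ y)

lemma map_dayMk {M N : BiMod k} {P Q : FB × FB} (φ : P ⟶ Q)
    (c : Dec P (Fin 2)) (x : M.obj (c.part 0)) (y : N.obj (c.part 1)) :
    ((day M N).map φ).hom (dayMk c x y) =
      dayMk (c.push φ) ((M.map (c.pushMap φ 0)).hom x) ((N.map (c.pushMap φ 1)).hom y) :=
  dsMap_dsOf (k := k) (A := fun c : Dec P (Fin 2) => (M.obj (c.part 0)) ⊗[k] (N.obj (c.part 1)))
    (B := fun c : Dec Q (Fin 2) => (M.obj (c.part 0)) ⊗[k] (N.obj (c.part 1)))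
    (fun c => c.push φ) (fun c =>
    TensorProduct.map (M.map (c.pushMap φ 0)).hom (N.map (c.pushMap φ 1)).hom) c (x ⊗ₜ y)

lemma dayBraid_dayMk {M N : BiMod k} {P : FB × FB} (c : Dec P (Fin 2)) (x : M.obj (c.part 0))
    (y : N.obj (c.part 1)) :
    ((dayBraid M N).app P).hom (dayMk c x y) = dayMk (c.relabel (Equiv.swap 0 1))
      ((N.map (c.relabelMap (Equiv.swap 0 1) 0)).hom y)
      ((M.map (c.relabelMap (Equiv.swap 0 1) 1)).hom x) :=
  dsMap_dsOf (k := k) (A := fun c : Dec P (Fin 2) => (M.obj (c.part 0)) ⊗[k] (N.obj (c.part 1)))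
    (B := fun c : Dec P (Fin 2) => (N.obj (c.part 0)) ⊗[k] (M.obj (c.part 1)))
    (fun c => c.relabel (Equiv.swap 0 1)) (fun c =>
    TensorProduct.map (N.map (c.relabelMap (Equiv.swap 0 1) 0)).hom
      (M.map (c.relabelMap (Equiv.swap 0 1) 1)).hom ∘ₗ
      (TensorProduct.comm k (M.obj (c.part 0)) (N.obj (c.part 1))).toLinearMap) c (x ⊗ₜ y)

lemma muComp_apply {M : BiMod k} (μ : day M M ⟶ day M (kk11 k)) (P : FB × FB) (c : Dec P (Fin 2))
    (s : P.1) (t : P.2) (x : M.obj (c.part 0)) (y : M.obj (c.part 1)) :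
    muComp μ P c s t x y = proj11 M P s t ((μ.app P).hom (dayMk c x y)) := by
  classical
  refine congrArg (fun w => proj11 M P s t ((μ.app P).hom w)) ?_
  exact LinearMap.congr_fun (lof_eq_dsOf (k := k)
    (A := fun c : Dec P (Fin 2) => (M.obj (c.part 0)) ⊗[k] (M.obj (c.part 1))) c) (x ⊗ₜ y)

/-- The first piece of a decomposition that is equal to `pointDec`. -/
def pointDecMap' {P : FB × FB} {s : P.1} {t : P.2} {c : Dec P (Fin 2)} (h : c = pointDec P s t) :
    c.part 0 ⟶ biDel P s t :=
  biHom (Equiv.subtypeEquivRight (fun x => by subst h; simp [pointDec]))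
    (Equiv.subtypeEquivRight (fun x => by subst h; simp [pointDec]))

open Classical in
-- The decomposition stays a variable, constrained by an equation, so that its image under a
-- bijection can be tested in the same form.
lemma proj11_dayMk (M : BiMod k) (P : FB × FB) (s : P.1) (t : P.2) (c : Dec P (Fin 2))
    (x : M.obj (c.part 0)) (f : (kk11 k).obj (c.part 1)) :
    proj11 M P s t (dayMk c x f) =
    if h : c = pointDec P s t then
      (show PLift (Nat.card (c.part 1).1 = 1 ∧ Nat.card (c.part 1).2 = 1) → k from f)
        (PLift.up (h ▸ card_pointDec P s t)) • (M.map (pointDecMap' h)).hom x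
    else 0 := by
  let F := (M.map (pointDecMap P s t)).hom ∘ₗ
    (TensorProduct.rid k (M.obj ((pointDec P s t).part 0))).toLinearMap ∘ₗ
    LinearMap.lTensor _ (LinearMap.proj (PLift.up (card_pointDec P s t)) :
      (PLift _ → k) →ₗ[k] k)
  refine (congrArg F (component_dsOf (k := k)
    (A := fun c : Dec P (Fin 2) => (M.obj (c.part 0)) ⊗[k] ((kk11 k).obj (c.part 1)))
    c (pointDec P s t) (x ⊗ₜ f))).trans ?_
  split_ifs with h
  · subst h
    exact (M.map (pointDecMap P s t)).hom.map_smul _ _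
  · exact map_zero F

open Classical in
-- A bijection carries the summand selected by (s, t) to the one selected by their images, and no
-- other summand there; naturality of `proj11` rests on this.
lemma push_eq_pointDec {P Q : FB × FB} (φ : P ⟶ Q) {s : P.1} {t : P.2} {s' : Q.1} {t' : Q.2}
    (hs : fstEquiv φ s = s') (ht : sndEquiv φ t = t') (c : Dec P (Fin 2)) :
    c.push φ = pointDec Q s' t' ↔ c = pointDec P s t := by
  subst hs ht
  constructor
  · intro h
    refine Prod.ext (funext fun x => ?_) (funext fun y => ?_)
    · refine (congrArg c.1 ((fstEquiv φ).symm_apply_apply x).symm).trans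
        ((congrFun (congrArg Prod.fst h) (fstEquiv φ x)).trans ?_)
      simp only [pointDec]
      exact if_congr (fstEquiv φ).injective.eq_iff rfl rfl
    · refine (congrArg c.2 ((sndEquiv φ).symm_apply_apply y).symm).trans
        ((congrFun (congrArg Prod.snd h) (sndEquiv φ y)).trans ?_)
      simp only [pointDec]
      exact if_congr (sndEquiv φ).injective.eq_iff rfl rfl
  · rintro rfl
    refine Prod.ext (funext fun x => ?_) (funext fun y => ?_)
    · simp only [pointDec]
      exact if_congr (fstEquiv φ).symm_apply_eq rfl rfl
    · simp only [pointDec]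
      exact if_congr (sndEquiv φ).symm_apply_eq rfl rfl

lemma day_hom_ext {M N : BiMod k} {P : FB × FB} {V : Type v} [AddCommGroup V] [Module k V]
    {f g : (day M N).obj P →ₗ[k] V}
    (h : ∀ c (x : M.obj (Dec.part c 0)) (y : N.obj (Dec.part c 1)),
      f (dayMk c x y) = g (dayMk c x y)) : f = g := by
  refine dsOf_ext fun c a => ?_
  let D := dsOf k (fun c : Dec P (Fin 2) => (M.obj (c.part 0)) ⊗[k] (N.obj (c.part 1))) c
  exact LinearMap.congr_fun (TensorProduct.ext' (g := f ∘ₗ D) (h := g ∘ₗ D) fun x y => h c x y) a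

lemma proj11_nat (M : BiMod k) {P Q : FB × FB} (φ : P ⟶ Q) {s : P.1} {t : P.2} {s' : Q.1}
    {t' : Q.2} (hs : fstEquiv φ s = s') (ht : sndEquiv φ t = t') (w : (day M (kk11 k)).obj P) :
    proj11 M Q s' t' (((day M (kk11 k)).map φ).hom w) =
      (M.map (delMap φ hs ht)).hom (proj11 M P s t w) := by
  classical
  refine LinearMap.congr_fun (f := proj11 M Q s' t' ∘ₗ ((day M (kk11 k)).map φ).hom)
    (g := (M.map (delMap φ hs ht)).hom ∘ₗ proj11 M P s t) (day_hom_ext fun c x f => ?_) w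
  rw [LinearMap.comp_apply, LinearMap.comp_apply]
  refine (congrArg (proj11 M Q s' t') (map_dayMk _ _ _ _)).trans ?_
  refine (proj11_dayMk M Q s' t' (c.push φ) _ _).trans ?_
  refine Eq.trans ?_ (congrArg (M.map (delMap φ hs ht)).hom (proj11_dayMk M P s t c x f)).symm
  by_cases h : c = pointDec P s t
  · rw [dif_pos h, dif_pos ((push_eq_pointDec φ hs ht c).2 h), map_smul]
    refine congrArg₂ _ rfl (BiMod.map_eq M ?_ x)
    rfl
  · rw [dif_neg h, dif_neg (fun h' => h ((push_eq_pointDec φ hs ht c).1 h')), map_zero]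

lemma proj11_map {M N : BiMod k} (α : M ⟶ N) (P : FB × FB) (s : P.1) (t : P.2)
    (w : (day M (kk11 k)).obj P) :
    proj11 N P s t (((dayMap α (𝟙 (kk11 k))).app P).hom w) =
      (α.app (biDel P s t)).hom (proj11 M P s t w) := by
  classical
  refine LinearMap.congr_fun (f := proj11 N P s t ∘ₗ ((dayMap α (𝟙 (kk11 k))).app P).hom)
    (g := (α.app (biDel P s t)).hom ∘ₗ proj11 M P s t) (day_hom_ext fun c x f => ?_) w
  rw [LinearMap.comp_apply, LinearMap.comp_apply]
  refine (congrArg (proj11 N P s t) (dayMap_dayMk _ _ _ _ _)).trans ?_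
  refine (proj11_dayMk N P s t c _ _).trans ?_
  refine Eq.trans ?_ (congrArg (α.app (biDel P s t)).hom (proj11_dayMk M P s t c x f)).symm
  by_cases h : c = pointDec P s t
  · rw [dif_pos h, dif_pos h, map_smul]
    exact congrArg₂ _ rfl (BiMod.nat α _ x).symm
  · rw [dif_neg h, dif_neg h, map_zero]

lemma muComp_map {M N : BiMod k} (μ : day M M ⟶ day M (kk11 k)) (ν : day N N ⟶ day N (kk11 k))
    (α : M ⟶ N) (h : μ ≫ dayMap α (𝟙 (kk11 k)) = dayMap α α ≫ ν) (P : FB × FB) (c : Dec P (Fin 2))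
    (s : P.1) (t : P.2) (x : M.obj (c.part 0)) (y : M.obj (c.part 1)) :
    muComp ν P c s t ((α.app _).hom x) ((α.app _).hom y) = (α.app _).hom (muComp μ P c s t x y) := by
  classical
  rw [muComp_apply, muComp_apply, ← proj11_map]
  refine congrArg (proj11 N P s t) ?_
  refine Eq.trans ?_ (congrArg (fun a => (a.app P).hom (dayMk c x y)) h).symm
  exact congrArg (ν.app P).hom (dayMap_dayMk _ _ _ _ _).symm

lemma muComp_push {M : BiMod k} (μ : day M M ⟶ day M (kk11 k)) {P Q : FB × FB} (φ : P ⟶ Q)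
    (c : Dec P (Fin 2)) {s : P.1} {t : P.2} {s' : Q.1} {t' : Q.2} (hs : fstEquiv φ s = s')
    (ht : sndEquiv φ t = t') (x : M.obj (c.part 0)) (y : M.obj (c.part 1)) :
    muComp μ Q (c.push φ) s' t' ((M.map (c.pushMap φ 0)).hom x) ((M.map (c.pushMap φ 1)).hom y) =
      (M.map (delMap φ hs ht)).hom (muComp μ P c s t x y) := by
  classical
  rw [muComp_apply, muComp_apply, ← proj11_nat]
  refine congrArg (proj11 M Q s' t') ?_
  refine Eq.trans ?_ (congrArg (fun a => a.hom (dayMk c x y)) (μ.naturality φ))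
  exact congrArg (μ.app Q).hom (map_dayMk _ _ _ _).symm

/-- A form of `muComp_push` in which the decomposition of the target is arbitrary. -/
lemma muComp_congr {M : BiMod k} (μ : day M M ⟶ day M (kk11 k)) {P Q : FB × FB} (φ : P ⟶ Q)
    (c : Dec P (Fin 2)) (c' : Dec Q (Fin 2)) {s : P.1} {t : P.2} {s' : Q.1} {t' : Q.2}
    (hs : fstEquiv φ s = s') (ht : sndEquiv φ t = t')
    (r₀ : c.part 0 ⟶ c'.part 0) (r₁ : c.part 1 ⟶ c'.part 1)
    (hc₁ : ∀ x, c'.1 (fstEquiv φ x) = c.1 x) (hc₂ : ∀ x, c'.2 (sndEquiv φ x) = c.2 x)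
    (h₀₁ : ∀ x, (fstEquiv r₀ x).1 = fstEquiv φ x.1) (h₀₂ : ∀ x, (sndEquiv r₀ x).1 = sndEquiv φ x.1)
    (h₁₁ : ∀ x, (fstEquiv r₁ x).1 = fstEquiv φ x.1) (h₁₂ : ∀ x, (sndEquiv r₁ x).1 = sndEquiv φ x.1)
    (x : M.obj (c.part 0)) (y : M.obj (c.part 1)) :
    muComp μ Q c' s' t' ((M.map r₀).hom x) ((M.map r₁).hom y) =
      (M.map (delMap φ hs ht)).hom (muComp μ P c s t x y) := by
  obtain rfl : c' = c.push φ := by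
    refine Prod.ext (funext fun x => ?_) (funext fun x => ?_)
    · obtain ⟨x, rfl⟩ := (fstEquiv φ).surjective x
      rw [hc₁]
      exact congrArg c.1 ((fstEquiv φ).symm_apply_apply x).symm
    · obtain ⟨x, rfl⟩ := (sndEquiv φ).surjective x
      rw [hc₂]
      exact congrArg c.2 ((sndEquiv φ).symm_apply_apply x).symm
  rw [← muComp_push μ φ c hs ht]
  have e₀ : r₀ = c.pushMap φ 0 :=
    biMor_ext (fun x => Subtype.ext (h₀₁ x)) (fun x => Subtype.ext (h₀₂ x))
  have e₁ : r₁ = c.pushMap φ 1 :=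
    biMor_ext (fun x => Subtype.ext (h₁₁ x)) (fun x => Subtype.ext (h₁₂ x))
  rw [e₀, e₁]

lemma muComp_symm {M : BiMod k} {μ : day M M ⟶ day M (kk11 k)} (hμ : IsSymmetric μ) (P : FB × FB)
    (c : Dec P (Fin 2)) (s : P.1) (t : P.2) (x : M.obj (c.part 0)) (y : M.obj (c.part 1)) :
    muComp μ P (c.relabel (Equiv.swap 0 1)) s t ((M.map (c.relabelMap (Equiv.swap 0 1) 0)).hom y)
      ((M.map (c.relabelMap (Equiv.swap 0 1) 1)).hom x) = muComp μ P c s t x y := by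
  classical
  rw [muComp_apply, muComp_apply]
  refine congrArg (proj11 M P s t) ?_
  refine Eq.trans ?_ (congrArg (fun a => (a.app P).hom (dayMk c x y)) hμ)
  exact congrArg (μ.app P).hom (dayBraid_dayMk c x y).symm

/-! ### Composition along a walled pair -/

/-- The pair of sets obtained from two disjoint pairs by removal of `s` from the first and `t` from the
second. -/
abbrev circ (Q₀ Q₁ : FB × FB) (s : Q₀.1) (t : Q₁.2) : FB × FB :=
  (⟨(Q₀.1.del s).carrier ⊕ Q₁.1.carrier⟩, ⟨Q₀.2.carrier ⊕ (Q₁.2.del t).carrier⟩)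

/-- The disjoint union of two pairs. -/
abbrev biSum (Q₀ Q₁ : FB × FB) : FB × FB :=
  (⟨Q₀.1.carrier ⊕ Q₁.1.carrier⟩, ⟨Q₀.2.carrier ⊕ Q₁.2.carrier⟩)

/-- The decomposition of `biSum`. -/
abbrev sumDec (Q₀ Q₁ : FB × FB) : Dec (biSum Q₀ Q₁) (Fin 2) :=
  (Sum.elim (fun _ => 0) (fun _ => 1), Sum.elim (fun _ => 0) (fun _ => 1))

/-- A bijection from a type to the fibre of a sum. -/
def inlFib (X Y : Type) : X ≃ {z : X ⊕ Y // Sum.elim (fun _ => (0 : Fin 2)) (fun _ => 1) z = 0} :=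
  Equiv.ofBijective (fun x => ⟨Sum.inl x, rfl⟩)
    ⟨fun x y h => by simpa using congrArg Subtype.val h,
      by rintro ⟨x | y, h⟩; exacts [⟨x, rfl⟩, absurd h (by simp)]⟩

/-- A bijection from a type to the fibre of a sum. -/
def inrFib (X Y : Type) : Y ≃ {z : X ⊕ Y // Sum.elim (fun _ => (0 : Fin 2)) (fun _ => 1) z = 1} :=
  Equiv.ofBijective (fun x => ⟨Sum.inr x, rfl⟩)
    ⟨fun x y h => by simpa using congrArg Subtype.val h,
      by rintro ⟨x | y, h⟩; exacts [absurd h (by simp), ⟨y, rfl⟩]⟩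

/-- `(X ⨿ Y) \ {s} = (X \ {s}) ⨿ Y`. -/
def delInl (X Y : Type) (s : X) : {z : X ⊕ Y // z ≠ Sum.inl s} ≃ {x : X // x ≠ s} ⊕ Y :=
  Equiv.symm <| Equiv.ofBijective
    (Sum.elim (fun x => ⟨Sum.inl x.1, by simpa using x.2⟩) (fun y => ⟨Sum.inr y, by simp⟩))
    ⟨by rintro (x | x) (y | y) h <;> simpa [Subtype.ext_iff] using h, by
      rintro ⟨x | y, h⟩
      exacts [⟨Sum.inl ⟨x, by simpa using h⟩, rfl⟩, ⟨Sum.inr y, rfl⟩]⟩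

/-- `(X ⨿ Y) \ {t} = X ⨿ (Y \ {t})`. -/
def delInr (X Y : Type) (t : Y) : {z : X ⊕ Y // z ≠ Sum.inr t} ≃ X ⊕ {y : Y // y ≠ t} :=
  Equiv.symm <| Equiv.ofBijective
    (Sum.elim (fun x => ⟨Sum.inl x, by simp⟩) (fun y => ⟨Sum.inr y.1, by simpa using y.2⟩))
    ⟨by rintro (x | x) (y | y) h <;> simpa [Subtype.ext_iff] using h, by
      rintro ⟨x | y, h⟩
      exacts [⟨Sum.inl x, rfl⟩, ⟨Sum.inr ⟨y, by simpa using h⟩, rfl⟩]⟩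

/-- The removal of a walled pair from a disjoint union. -/
def delSum (Q₀ Q₁ : FB × FB) (s : Q₀.1) (t : Q₁.2) :
    biDel (biSum Q₀ Q₁) (Sum.inl s) (Sum.inr t) ⟶ circ Q₀ Q₁ s t :=
  biHom (delInl Q₀.1 Q₁.1 s) (delInr Q₀.2 Q₁.2 t)

/-- The composition of two elements along a walled pair. -/
def circMul {M : BiMod k} (μ : day M M ⟶ day M (kk11 k)) {Q₀ Q₁ : FB × FB} (s : Q₀.1) (t : Q₁.2)
    (x : M.obj Q₀) (y : M.obj Q₁) : M.obj (circ Q₀ Q₁ s t) :=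
  (M.map (delSum Q₀ Q₁ s t)).hom (muComp μ (biSum Q₀ Q₁) (sumDec Q₀ Q₁) (Sum.inl s) (Sum.inr t)
    ((M.map (biHom (Q := (sumDec Q₀ Q₁).part 0) (inlFib _ _) (inlFib _ _))).hom x)
    ((M.map (biHom (Q := (sumDec Q₀ Q₁).part 1) (inrFib _ _) (inrFib _ _))).hom y))

/-- The bijection from a disjoint union to a set with a map to `Fin 2`. -/
lemma sum_fibre_bijective {X Y Z : Type} {c : Z → Fin 2} (r₀ : X ≃ {z // c z = 0})
    (r₁ : Y ≃ {z // c z = 1}) :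
    Function.Bijective (Sum.elim (fun x => (r₀ x).1) (fun y => (r₁ y).1) : X ⊕ Y → Z) := by
  constructor
  · rintro (x | x) (y | y) h
    · exact congrArg Sum.inl (r₀.injective (Subtype.ext h))
    · have h0 := (r₀ x).2
      rw [show (r₀ x).1 = (r₁ y).1 from h, (r₁ y).2] at h0
      simp at h0
    · have h0 := (r₁ x).2
      rw [show (r₁ x).1 = (r₀ y).1 from h, (r₀ y).2] at h0
      simp at h0
    · exact congrArg Sum.inr (r₁.injective (Subtype.ext h))
  · intro z
    have h : c z = 0 ∨ c z = 1 := by generalize c z = i; revert i; decide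
    rcases h with h | h
    · exact ⟨Sum.inl (r₀.symm ⟨z, h⟩), by simp⟩
    · exact ⟨Sum.inr (r₁.symm ⟨z, h⟩), by simp⟩

/-- A decomposition into two pieces is isomorphic to a disjoint union, and naturality of μ reduces
its component to the standard one. The bijection ρ is given by its values on the elements of the
pieces; these determine it and are all that later comparisons need. -/
lemma muComp_eq_circMul {M : BiMod k} (μ : day M M ⟶ day M (kk11 k)) {P Q₀ Q₁ : FB × FB}
    (c : Dec P (Fin 2)) (r₀ : Q₀ ⟶ c.part 0) (r₁ : Q₁ ⟶ c.part 1) (s₀ : Q₀.1) (t₀ : Q₁.2)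
    {s : P.1} {t : P.2} (hs : (fstEquiv r₀ s₀).1 = s) (ht : (sndEquiv r₁ t₀).1 = t) :
    ∃ ρ : circ Q₀ Q₁ s₀ t₀ ⟶ biDel P s t,
      (∀ x, (fstEquiv ρ (Sum.inl x)).1 = (fstEquiv r₀ x.1).1) ∧
      (∀ x, (fstEquiv ρ (Sum.inr x)).1 = (fstEquiv r₁ x).1) ∧
      (∀ x, (sndEquiv ρ (Sum.inl x)).1 = (sndEquiv r₀ x).1) ∧
      (∀ x, (sndEquiv ρ (Sum.inr x)).1 = (sndEquiv r₁ x.1).1) ∧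
      ∀ x y, muComp μ P c s t ((M.map r₀).hom x) ((M.map r₁).hom y) =
        (M.map ρ).hom (circMul μ s₀ t₀ x y) := by
  let φ : biSum Q₀ Q₁ ⟶ P :=
    biHom (Equiv.ofBijective _ (sum_fibre_bijective (fstEquiv r₀) (fstEquiv r₁)))
      (Equiv.ofBijective _ (sum_fibre_bijective (sndEquiv r₀) (sndEquiv r₁)))
  let D := delSum Q₀ Q₁ s₀ t₀
  let ρ : circ Q₀ Q₁ s₀ t₀ ⟶ biDel P s t :=
    biHom (fstEquiv D).symm (sndEquiv D).symm ≫ delMap φ (s := Sum.inl s₀) (t := Sum.inr t₀) hs ht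
  refine ⟨ρ, fun x => ?_, fun x => ?_, fun x => ?_, fun x => ?_, fun x y => ?_⟩
  · rfl
  · rfl
  · rfl
  · rfl
  · let i₀ : Q₀ ⟶ (sumDec Q₀ Q₁).part 0 := biHom (inlFib _ _) (inlFib _ _)
    let i₁ : Q₁ ⟶ (sumDec Q₀ Q₁).part 1 := biHom (inrFib _ _) (inrFib _ _)
    -- `muComp_congr` compares pieces of two decompositions, so the identifications are factored
    -- through the pieces of the disjoint union.
    have e₀ : r₀ = i₀ ≫ biHom ((fstEquiv i₀).symm.trans (fstEquiv r₀))
        ((sndEquiv i₀).symm.trans (sndEquiv r₀)) :=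
      biMor_ext (fun x => congrArg (fstEquiv r₀) ((fstEquiv i₀).symm_apply_apply x).symm)
        (fun x => congrArg (sndEquiv r₀) ((sndEquiv i₀).symm_apply_apply x).symm)
    have e₁ : r₁ = i₁ ≫ biHom ((fstEquiv i₁).symm.trans (fstEquiv r₁))
        ((sndEquiv i₁).symm.trans (sndEquiv r₁)) :=
      biMor_ext (fun x => congrArg (fstEquiv r₁) ((fstEquiv i₁).symm_apply_apply x).symm)
        (fun x => congrArg (sndEquiv r₁) ((sndEquiv i₁).symm_apply_apply x).symm)
    have key := muComp_congr μ φ (sumDec Q₀ Q₁) c (s := Sum.inl s₀) (t := Sum.inr t₀) hs ht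
      (biHom ((fstEquiv i₀).symm.trans (fstEquiv r₀)) ((sndEquiv i₀).symm.trans (sndEquiv r₀)))
      (biHom ((fstEquiv i₁).symm.trans (fstEquiv r₁)) ((sndEquiv i₁).symm.trans (sndEquiv r₁)))
      (by rintro (x | x); exacts [(fstEquiv r₀ x).2, (fstEquiv r₁ x).2])
      (by rintro (x | x); exacts [(sndEquiv r₀ x).2, (sndEquiv r₁ x).2])
      (fun z => by
        obtain ⟨x, rfl⟩ := (fstEquiv i₀).surjective z
        exact congrArg (fun x => (fstEquiv r₀ x).1) ((fstEquiv i₀).symm_apply_apply x))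
      (fun z => by
        obtain ⟨x, rfl⟩ := (sndEquiv i₀).surjective z
        exact congrArg (fun x => (sndEquiv r₀ x).1) ((sndEquiv i₀).symm_apply_apply x))
      (fun z => by
        obtain ⟨x, rfl⟩ := (fstEquiv i₁).surjective z
        exact congrArg (fun x => (fstEquiv r₁ x).1) ((fstEquiv i₁).symm_apply_apply x))
      (fun z => by
        obtain ⟨x, rfl⟩ := (sndEquiv i₁).surjective z
        exact congrArg (fun x => (sndEquiv r₁ x).1) ((sndEquiv i₁).symm_apply_apply x))
      ((M.map i₀).hom x) ((M.map i₁).hom y)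
    rw [BiMod.map_map, BiMod.map_map, ← e₀, ← e₁] at key
    rw [key]
    unfold circMul
    rw [BiMod.map_map]
    refine congrArg (fun ψ => (M.map ψ).hom _) ?_
    refine biMor_ext (fun x => ?_) (fun x => ?_)
    · exact congrArg (fstEquiv (delMap φ (s := Sum.inl s₀) (t := Sum.inr t₀) hs ht))
        ((fstEquiv D).symm_apply_apply x).symm
    · exact congrArg (sndEquiv (delMap φ (s := Sum.inl s₀) (t := Sum.inr t₀) hs ht))
        ((sndEquiv D).symm_apply_apply x).symm

lemma muTw_eq_circMul (ε : Twist) {M : BiMod k} (μ : day M M ⟶ day M (kk11 k)) {P Q₀ Q₁ : FB × FB}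
    (c : Dec P (Fin 2)) (r₀ : Q₀ ⟶ c.part 0) (r₁ : Q₁ ⟶ c.part 1) (s₀ : Q₀.1) (t₀ : Q₁.2)
    {s : P.1} {t : P.2} (hs : (fstEquiv r₀ s₀).1 = s) (ht : (sndEquiv r₁ t₀).1 = t) :
    ∃ ρ : circ Q₀ Q₁ s₀ t₀ ⟶ biDel P s t,
      (∀ x, (fstEquiv ρ (Sum.inl x)).1 = (fstEquiv r₀ x.1).1) ∧
      (∀ x, (fstEquiv ρ (Sum.inr x)).1 = (fstEquiv r₁ x).1) ∧
      (∀ x, (sndEquiv ρ (Sum.inl x)).1 = (sndEquiv r₀ x).1) ∧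
      (∀ x, (sndEquiv ρ (Sum.inr x)).1 = (sndEquiv r₁ x.1).1) ∧
      ∀ x y, muTw ε μ P c s t ((M.map r₀).hom x) ((M.map r₁).hom y) =
        (M.map ρ).hom (circMul μ s₀ t₀ x y) := by
  obtain ⟨ρ, h₁, h₂, h₃, h₄, h⟩ := muComp_eq_circMul μ c r₀ r₁ s₀ t₀ hs ht
  refine ⟨ρ, h₁, h₂, h₃, h₄, fun x y => ?_⟩
  have e₁ : c.1 s = 0 := hs ▸ (fstEquiv r₀ s₀).2
  have e₂ : c.2 t = 1 := ht ▸ (sndEquiv r₁ t₀).2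
  have e : ε.orient (c.1 s) (c.2 t) = 1 := by rw [e₁, e₂]; cases ε <;> rfl
  rw [muTw, e, one_smul, h]

/-- Here t belongs to the first piece and s to the second. Symmetry of μ exchanges the pieces
without a sign, and the remaining factor `ε.orient 1 0` is `ε.sgn`. -/
lemma muTw_eq_circMul_swap (ε : Twist) {M : BiMod k} {μ : day M M ⟶ day M (kk11 k)}
    (hμ : IsSymmetric μ) {P Q₀ Q₁ : FB × FB}
    (c : Dec P (Fin 2)) (r₀ : Q₀ ⟶ c.part 1) (r₁ : Q₁ ⟶ c.part 0) (s₀ : Q₀.1) (t₀ : Q₁.2)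
    {s : P.1} {t : P.2} (hs : (fstEquiv r₀ s₀).1 = s) (ht : (sndEquiv r₁ t₀).1 = t) :
    ∃ ρ : circ Q₀ Q₁ s₀ t₀ ⟶ biDel P s t,
      (∀ x, (fstEquiv ρ (Sum.inl x)).1 = (fstEquiv r₀ x.1).1) ∧
      (∀ x, (fstEquiv ρ (Sum.inr x)).1 = (fstEquiv r₁ x).1) ∧
      (∀ x, (sndEquiv ρ (Sum.inl x)).1 = (sndEquiv r₀ x).1) ∧
      (∀ x, (sndEquiv ρ (Sum.inr x)).1 = (sndEquiv r₁ x.1).1) ∧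
      ∀ x y, muTw ε μ P c s t ((M.map r₁).hom y) ((M.map r₀).hom x) =
        (ε.sgn : ℤ) • (M.map ρ).hom (circMul μ s₀ t₀ x y) := by
  obtain ⟨ρ, h₁, h₂, h₃, h₄, h⟩ := muComp_eq_circMul μ (c.relabel (Equiv.swap 0 1))
    (r₀ ≫ c.relabelMap (Equiv.swap 0 1) 0) (r₁ ≫ c.relabelMap (Equiv.swap 0 1) 1) s₀ t₀
    (s := s) (t := t) hs ht
  refine ⟨ρ, h₁, h₂, h₃, h₄, fun x y => ?_⟩
  have e₁ : c.1 s = 1 := hs ▸ (fstEquiv r₀ s₀).2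
  have e₂ : c.2 t = 0 := ht ▸ (sndEquiv r₁ t₀).2
  have e : ε.orient (c.1 s) (c.2 t) = (ε.sgn : ℤ) := by rw [e₁, e₂]; cases ε <;> rfl
  rw [muTw, e, LinearMap.smul_apply, LinearMap.smul_apply, ← h, ← muComp_symm hμ]
  exact congrArg₂ (fun a b => (ε.sgn : ℤ) • muComp μ P (c.relabel (Equiv.swap 0 1)) s t a b)
    (BiMod.map_map M r₀ (c.relabelMap (Equiv.swap 0 1) 0) x)
    (BiMod.map_map M r₁ (c.relabelMap (Equiv.swap 0 1) 1) y)

lemma circMul_map {M N : BiMod k} (μ : day M M ⟶ day M (kk11 k)) (ν : day N N ⟶ day N (kk11 k))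
    (α : M ⟶ N) (h : μ ≫ dayMap α (𝟙 (kk11 k)) = dayMap α α ≫ ν) {Q₀ Q₁ : FB × FB} (s : Q₀.1)
    (t : Q₁.2) (x : M.obj Q₀) (y : M.obj Q₁) :
    circMul ν s t ((α.app _).hom x) ((α.app _).hom y) = (α.app _).hom (circMul μ s t x y) := by
  unfold circMul
  rw [BiMod.nat, ← muComp_map μ ν α h, BiMod.nat, BiMod.nat]

end Composition

/-! ### Configurations -/

/-- A decomposition of a pair of sets into pieces that are identified with given pairs of sets. -/
structure Config (P : FB × FB) (I : Type) where
  Q : I → FB × FB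
  p₁ : ∀ i, (Q i).1.carrier → P.1.carrier
  p₂ : ∀ i, (Q i).2.carrier → P.2.carrier
  bij₁ : Function.Bijective (fun z : Σ i, (Q i).1.carrier => p₁ z.1 z.2)
  bij₂ : Function.Bijective (fun z : Σ i, (Q i).2.carrier => p₂ z.1 z.2)

lemma BiMod.map_id_apply {k : Type v} [Field k] (M : BiMod k) {P : FB × FB} (x : M.obj P) :
    (M.map (𝟙 P)).hom x = x := congrArg (fun f => f.hom x) (M.map_id P)

/-! ### Families of maps that are jointly bijective -/

section Fibres

variable {X I : Type} {A : I → Type} {p : ∀ i, A i → X}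
  (h : Function.Bijective (fun z : Σ i, A i => p z.1 z.2))

/-- The index of the piece that contains an element. -/
def pieceOf (x : X) : I := ((Equiv.ofBijective _ h).symm x).1

lemma pieceOf_apply (i : I) (a : A i) : pieceOf h (p i a) = i :=
  congrArg Sigma.fst ((Equiv.ofBijective _ h).symm_apply_apply ⟨i, a⟩)

include h in
lemma eq_of_apply_eq {i : I} {a b : A i} (e : p i a = p i b) : a = b := by
  have := h.1 (a₁ := ⟨i, a⟩) (a₂ := ⟨i, b⟩) e
  simpa using this

include h in
lemma exists_piece (x : X) : ∃ i a, p i a = x := by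
  obtain ⟨⟨i, a⟩, rfl⟩ := h.2 x
  exact ⟨i, a, rfl⟩

/-- The identification of a piece with a fibre. -/
def pieceEquiv {J : Type} (e : I ≃ J) (i : I) : A i ≃ {x : X // e (pieceOf h x) = e i} :=
  Equiv.ofBijective (fun a => ⟨p i a, by rw [pieceOf_apply]⟩) (by
    refine ⟨fun a b e => eq_of_apply_eq h (congrArg Subtype.val e), ?_⟩
    rintro ⟨x, hx⟩
    obtain ⟨j, a, rfl⟩ := exists_piece h x
    rw [pieceOf_apply, e.injective.eq_iff] at hx
    subst hx
    exact ⟨a, rfl⟩)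

end Fibres

namespace Config

variable {k : Type v} [Field k] {P : FB × FB} {I : Type} {d : ℕ}

/-- The decomposition that belongs to a configuration with numbered pieces. -/
def dec (C : Config P I) (e : I ≃ Fin d) : Dec P (Fin d) :=
  (fun x => e (pieceOf C.bij₁ x), fun y => e (pieceOf C.bij₂ y))

lemma dec_fst (C : Config P I) (e : I ≃ Fin d) (i : I) (x : (C.Q i).1) :
    (C.dec e).1 (C.p₁ i x) = e i := congrArg e (pieceOf_apply C.bij₁ i x)

lemma dec_snd (C : Config P I) (e : I ≃ Fin d) (i : I) (x : (C.Q i).2) :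
    (C.dec e).2 (C.p₂ i x) = e i := congrArg e (pieceOf_apply C.bij₂ i x)

/-- The identification of a piece. -/
def incl (C : Config P I) (e : I ≃ Fin d) (i : I) : C.Q i ⟶ (C.dec e).part (e i) :=
  biHom (Q := (C.dec e).part (e i)) (pieceEquiv C.bij₁ e i) (pieceEquiv C.bij₂ e i)

/-- A morphism to a piece of a decomposition that is compatible with the given identification. -/
structure IsIncl (C : Config P I) {c : Dec P (Fin d)} (i : I) {j : Fin d} (r : C.Q i ⟶ c.part j) :
    Prop where
  fst : ∀ x, (fstEquiv r x).1 = C.p₁ i x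
  snd : ∀ x, (sndEquiv r x).1 = C.p₂ i x

lemma isIncl_incl (C : Config P I) (e : I ≃ Fin d) (i : I) : C.IsIncl i (C.incl e i) :=
  ⟨fun _ => rfl, fun _ => rfl⟩

lemma IsIncl.eq {C : Config P I} {c : Dec P (Fin d)} {i : I} {j : Fin d} {r r' : C.Q i ⟶ c.part j}
    (h : C.IsIncl i r) (h' : C.IsIncl i r') : r = r' :=
  biMor_ext (fun x => Subtype.ext ((h.fst x).trans (h'.fst x).symm))
    (fun x => Subtype.ext ((h.snd x).trans (h'.snd x).symm))

/-- The factors of the tensor that belongs to a configuration with elements on its pieces. -/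
def val {M : BiMod k} (C : Config P I) (e : I ≃ Fin d) (a : ∀ i, M.obj (C.Q i)) (j : Fin d) :
    M.obj ((C.dec e).part j) :=
  (M.map (C.incl e (e.symm j) ≫ biHom (Equiv.subtypeEquivRight (by simp))
    (Equiv.subtypeEquivRight (by simp)))).hom (a (e.symm j))

/-- `val` is defined through `e.symm j`, which is only propositionally the wanted index. Since
compatible identifications of a piece are unique, any of them may be used instead. -/
lemma val_eq {M : BiMod k} (C : Config P I) (e : I ≃ Fin d) (a : ∀ i, M.obj (C.Q i)) {i : I}
    {j : Fin d} (h : e i = j) {r : C.Q i ⟶ (C.dec e).part j} (hr : C.IsIncl i r) :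
    C.val e a j = (M.map r).hom (a i) := by
  have key : ∀ (i' : I) (_ : i' = i) (r' : C.Q i' ⟶ (C.dec e).part j), C.IsIncl i' r' →
      (M.map r').hom (a i') = (M.map r).hom (a i) := by
    rintro i' rfl r' hr'
    rw [hr.eq hr']
  exact key _ (by rw [← h, e.symm_apply_apply]) _ ⟨fun _ => rfl, fun _ => rfl⟩

lemma exists_val_eq {M : BiMod k} (C : Config P I) (e : I ≃ Fin d) (a : ∀ i, M.obj (C.Q i)) {i : I}
    {j : Fin d} (h : j = e i) :
    ∃ r : C.Q i ⟶ (C.dec e).part j, C.IsIncl i r ∧ C.val e a j = (M.map r).hom (a i) := by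
  subst h
  exact ⟨C.incl e i, C.isIncl_incl e i, C.val_eq e a rfl (C.isIncl_incl e i)⟩

/-- A pure tensor in a summand of `M^{⊚d}`. -/
def _root_.tpowMk {M : BiMod k} (c : Dec P (Fin d)) (a : ∀ j, M.obj (c.part j)) :
    (tpow d M).obj P :=
  dsOf k (fun c : Dec P (Fin d) => tensPart M c) c (PiTensorProduct.tprod k a)

/-- The pure tensor in `M^{⊚d}` that belongs to a configuration. -/
def pre {M : BiMod k} (C : Config P I) (e : I ≃ Fin d) (a : ∀ i, M.obj (C.Q i)) :
    (tpow d M).obj P := tpowMk (C.dec e) (C.val e a)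

/-- The placements of the pieces determine the decomposition, and compatible identifications
determine the factors. Through this criterion, equality of tensors becomes a check on elements,
piece by piece. -/
lemma tpowMk_eq_pre {M : BiMod k} (C : Config P I) (e : I ≃ Fin d) (a : ∀ i, M.obj (C.Q i))
    (c : Dec P (Fin d)) (a' : ∀ j, M.obj (c.part j))
    (h : ∀ i, ∃ r : C.Q i ⟶ c.part (e i), C.IsIncl i r ∧ a' (e i) = (M.map r).hom (a i)) :
    tpowMk c a' = C.pre e a := by
  obtain rfl : c = C.dec e := by
    refine Prod.ext (funext fun x => ?_) (funext fun x => ?_)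
    · obtain ⟨i, x, rfl⟩ := exists_piece C.bij₁ x
      obtain ⟨r, hr, -⟩ := h i
      rw [dec_fst, ← hr.fst]
      exact (fstEquiv r x).2
    · obtain ⟨i, x, rfl⟩ := exists_piece C.bij₂ x
      obtain ⟨r, hr, -⟩ := h i
      rw [dec_snd, ← hr.snd]
      exact (sndEquiv r x).2
  refine congrArg (tpowMk _) (funext fun j => ?_)
  obtain ⟨i, rfl⟩ := e.surjective j
  obtain ⟨r, hr, hi⟩ := h i
  rw [hi, C.val_eq e a rfl hr]

lemma _root_.map_tpowMk {M : BiMod k} {Q : FB × FB} (φ : P ⟶ Q) (c : Dec P (Fin d))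
    (a : ∀ j, M.obj (c.part j)) :
    ((tpow d M).map φ).hom (tpowMk c a) =
      tpowMk (c.push φ) (fun j => (M.map (c.pushMap φ j)).hom (a j)) :=
  (dsMap_dsOf (k := k) (A := fun c : Dec P (Fin d) => tensPart M c)
    (B := fun c : Dec Q (Fin d) => tensPart M c) (fun c => c.push φ) (fun c =>
    PiTensorProduct.map (fun i => (M.map (c.pushMap φ i)).hom)) c _).trans
  (congrArg (dsOf k _ _) (PiTensorProduct.map_tprod _ _))

lemma _root_.tpowMap_tpowMk {M N : BiMod k} (f : M ⟶ N) (c : Dec P (Fin d))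
    (a : ∀ j, M.obj (c.part j)) :
    ((tpowMap d f).app P).hom (tpowMk c a) = tpowMk c (fun j => (f.app _).hom (a j)) :=
  (dsMap_dsOf (k := k) (A := fun c : Dec P (Fin d) => tensPart M c)
    (B := fun c : Dec P (Fin d) => tensPart N c) (fun c => c) (fun c =>
    PiTensorProduct.map (fun i => (f.app (c.part i)).hom)) c _).trans
  (congrArg (dsOf k _ _) (PiTensorProduct.map_tprod _ _))

lemma _root_.permAct_tpowMk (M : BiMod k) (σ : Equiv.Perm (Fin d)) (c : Dec P (Fin d))
    (a : ∀ j, M.obj (c.part j)) :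
    permAct M σ P (tpowMk c a) =
      tpowMk (c.relabel σ) (fun j => (M.map (c.relabelMap σ j)).hom (a (σ.symm j))) :=
  (dsMap_dsOf (k := k) (A := fun c : Dec P (Fin d) => tensPart M c)
    (B := fun c : Dec P (Fin d) => tensPart M c) (fun c => c.relabel σ) _ c _).trans
  (congrArg (dsOf k _ _) (permAct_aux M σ c a))

lemma _root_.tpow_hom_ext {M : BiMod k} {V : Type*} [AddCommGroup V] [Module k V]
    {f g : (tpow d M).obj P →ₗ[k] V} (h : ∀ c a, f (tpowMk c a) = g (tpowMk c a)) : f = g := by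
  refine dsOf_ext fun c w => ?_
  let D := dsOf k (fun c : Dec P (Fin d) => tensPart M c) c
  exact LinearMap.congr_fun (f := f ∘ₗ D) (g := g ∘ₗ D)
    (PiTensorProduct.ext (MultilinearMap.ext fun a => h c a)) w

/-- A configuration separates the names of the pieces from their numbers, and a place permutation
affects the numbers alone. -/
lemma permAct_pre {M : BiMod k} (C : Config P I) (e : I ≃ Fin d) (a : ∀ i, M.obj (C.Q i))
    (σ : Equiv.Perm (Fin d)) : permAct M σ P (C.pre e a) = C.pre (e.trans σ) a := by
  refine (permAct_tpowMk M σ _ _).trans (C.tpowMk_eq_pre (e.trans σ) a _ _ fun i => ?_)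
  obtain ⟨r, hr, h⟩ := C.exists_val_eq e a (i := i) (j := σ.symm (σ (e i)))
    (σ.symm_apply_apply _)
  refine ⟨r ≫ Dec.relabelMap σ (C.dec e) (σ (e i)), ⟨hr.fst, hr.snd⟩, ?_⟩
  exact (congrArg (M.map (Dec.relabelMap σ (C.dec e) (σ (e i)))).hom h).trans (BiMod.map_map M _ _ _)

lemma pre_reindex {M : BiMod k} {I' : Type} (C : Config P I) (C' : Config P I') (α : I ≃ I')
    (e' : I' ≃ Fin d) (a : ∀ i, M.obj (C.Q i)) (a' : ∀ i, M.obj (C'.Q i))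
    (h : ∀ i, ∃ r : C.Q i ⟶ C'.Q (α i), (∀ x, C'.p₁ _ (fstEquiv r x) = C.p₁ i x) ∧
      (∀ x, C'.p₂ _ (sndEquiv r x) = C.p₂ i x) ∧ a' (α i) = (M.map r).hom (a i)) :
    C'.pre e' a' = C.pre (α.trans e') a := by
  refine C.tpowMk_eq_pre (α.trans e') a _ _ fun i => ?_
  obtain ⟨r, h₁, h₂, h₃⟩ := h i
  refine ⟨r ≫ C'.incl e' (α i), ⟨h₁, h₂⟩, ?_⟩
  refine (C'.val_eq e' a' rfl (C'.isIncl_incl e' (α i))).trans ?_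
  exact (congrArg (M.map (C'.incl e' (α i))).hom h₃).trans (BiMod.map_map M _ _ _)

/-- The element of the symmetric or exterior power that belongs to a configuration. -/
def gen (ε : Twist) {M : BiMod k} (C : Config P I) (e : I ≃ Fin d) (a : ∀ i, M.obj (C.Q i)) :
    (gpow ε d M).obj P := gpowMk ε d M P (C.pre e a)

lemma _root_.gpowMk_permAct (ε : Twist) (M : BiMod k) (σ : Equiv.Perm (Fin d))
    (v : (tpow d M).obj P) :
    gpowMk ε d M P (permAct M σ P v) = (ε.chi σ : ℤ) • gpowMk ε d M P v := by
  have h : gpowMk ε d M P ((ε.chi σ : ℤ) • permAct M σ P v - v) = 0 :=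
    (Submodule.Quotient.mk_eq_zero _).2 (Submodule.subset_span ⟨σ, v, rfl⟩)
  rw [map_sub, sub_eq_zero, map_zsmul] at h
  rw [← h, smul_smul]
  simp

lemma gen_trans (ε : Twist) {M : BiMod k} (C : Config P I) (e : I ≃ Fin d)
    (a : ∀ i, M.obj (C.Q i)) (σ : Equiv.Perm (Fin d)) :
    C.gen ε (e.trans σ) a = (ε.chi σ : ℤ) • C.gen ε e a := by
  unfold gen
  rw [← permAct_pre, gpowMk_permAct]

/-- Comparison of the elements that belong to two configurations with equivalent pieces. -/
lemma gen_reindex (ε : Twist) {M : BiMod k} {I' : Type} (C : Config P I) (C' : Config P I')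
    (α : I ≃ I') (e : I ≃ Fin d) (e' : I' ≃ Fin d) (a : ∀ i, M.obj (C.Q i))
    (a' : ∀ i, M.obj (C'.Q i))
    (h : ∀ i, ∃ r : C.Q i ⟶ C'.Q (α i), (∀ x, C'.p₁ _ (fstEquiv r x) = C.p₁ i x) ∧
      (∀ x, C'.p₂ _ (sndEquiv r x) = C.p₂ i x) ∧ a' (α i) = (M.map r).hom (a i)) :
    C'.gen ε e' a' = (ε.chi (e.symm.trans (α.trans e')) : ℤ) • C.gen ε e a := by
  rw [← gen_trans, gen, pre_reindex C C' α e' a a' h]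
  refine congrArg (fun e => C.gen ε e a) (Equiv.ext fun i => ?_)
  simp

/-- The image of a configuration under a bijection. -/
def map (C : Config P I) {Q : FB × FB} (φ : P ⟶ Q) : Config Q I where
  Q := C.Q
  p₁ i x := fstEquiv φ (C.p₁ i x)
  p₂ i x := sndEquiv φ (C.p₂ i x)
  bij₁ := (fstEquiv φ).bijective.comp C.bij₁
  bij₂ := (sndEquiv φ).bijective.comp C.bij₂

lemma map_gen (ε : Twist) {M : BiMod k} (C : Config P I) (e : I ≃ Fin d) (a : ∀ i, M.obj (C.Q i))
    {Q : FB × FB} (φ : P ⟶ Q) :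
    ((gpow ε d M).map φ).hom (C.gen ε e a) = (C.map φ).gen ε e a := by
  refine congrArg (gpowMk ε d M Q) ((map_tpowMk φ _ _).trans
    ((C.map φ).tpowMk_eq_pre e a _ _ fun i => ?_))
  refine ⟨C.incl e i ≫ Dec.pushMap φ (C.dec e) (e i), ⟨fun _ => rfl, fun _ => rfl⟩, ?_⟩
  exact (congrArg _ (C.val_eq e a rfl (C.isIncl_incl e i))).trans (BiMod.map_map M _ _ _)

lemma gpowMap_gen (ε : Twist) {M N : BiMod k} (f : M ⟶ N) (C : Config P I) (e : I ≃ Fin d)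
    (a : ∀ i, M.obj (C.Q i)) :
    ((gpowMap ε d f).app P).hom (C.gen ε e a) = C.gen ε e (fun i => (f.app _).hom (a i)) := by
  refine congrArg (gpowMk ε d N P) ((tpowMap_tpowMk f _ _).trans
    (C.tpowMk_eq_pre e _ _ _ fun i => ?_))
  refine ⟨C.incl e i, C.isIncl_incl e i, ?_⟩
  exact (congrArg _ (C.val_eq e a rfl (C.isIncl_incl e i))).trans (BiMod.nat f _ _)

/-- The configuration given by a decomposition. -/
def ofDec (c : Dec P (Fin d)) : Config P (Fin d) where
  Q i := c.part i
  p₁ _ x := x.1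
  p₂ _ x := x.1
  bij₁ := (Equiv.sigmaFiberEquiv c.1).bijective
  bij₂ := (Equiv.sigmaFiberEquiv c.2).bijective

lemma tpowMk_eq_ofDec {M : BiMod k} (c : Dec P (Fin d)) (a : ∀ j, M.obj (c.part j)) :
    tpowMk c a = (ofDec c).pre (Equiv.refl _) a :=
  (ofDec c).tpowMk_eq_pre (Equiv.refl _) a c a fun i =>
    ⟨𝟙 _, ⟨fun _ => rfl, fun _ => rfl⟩, (BiMod.map_id_apply M _).symm⟩

/-- Pure tensors span, and each comes from the configuration formed by the pieces of its
decomposition. -/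
lemma _root_.gpow_hom_ext {ε : Twist} {M : BiMod k} {V : Type*} [AddCommGroup V] [Module k V]
    {f g : (gpow ε d M).obj P →ₗ[k] V}
    (h : ∀ (C : Config P (Fin d)) a, f (C.gen ε (Equiv.refl _) a) = g (C.gen ε (Equiv.refl _) a)) :
    f = g := by
  refine Submodule.linearMap_qext _ (tpow_hom_ext fun c a => ?_)
  rw [tpowMk_eq_ofDec]
  exact h (ofDec c) a

end Config

/-! ### Contraction of a configuration -/

/-- The numbering of `Option J` in which `none` is the last element. -/
def optFin {J : Type} {n : ℕ} (f : J ≃ Fin n) : Option J ≃ Fin (n + 1) :=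
  (Equiv.optionCongr f).trans finSuccEquivLast.symm

@[simp] lemma optFin_none {J : Type} {n : ℕ} (f : J ≃ Fin n) : optFin f none = Fin.last n := by
  simp [optFin]

@[simp] lemma optFin_some {J : Type} {n : ℕ} (f : J ≃ Fin n) (j : J) :
    optFin f (some j) = (f j).castSucc := by
  simp [optFin]

lemma optFin_trans {J : Type} {n : ℕ} (f : J ≃ Fin n) (τ : Equiv.Perm (Fin n)) :
    optFin (f.trans τ) = (optFin f).trans (blockPerm τ (1 : Equiv.Perm (Fin 1))) := by
  refine Equiv.ext fun i => ?_
  rcases i with _ | j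
  · have : blockPerm τ (1 : Equiv.Perm (Fin 1)) (Fin.natAdd n 0) = Fin.natAdd n 0 := by
      simp [blockPerm]
    rw [Equiv.trans_apply, optFin_none, optFin_none]
    exact this.symm
  · have : blockPerm τ (1 : Equiv.Perm (Fin 1)) (Fin.castAdd 1 (f j)) = Fin.castAdd 1 (τ (f j)) := by
      simp [blockPerm]
    rw [Equiv.trans_apply, optFin_some, optFin_some]
    exact this.symm

namespace Config

variable {k : Type v} [Field k] {P : FB × FB}

section Pieces

variable {I : Type} (C : Config P I)

lemma p₁_ne {i j : I} (h : i ≠ j) (x : (C.Q i).1) (y : (C.Q j).1) : C.p₁ i x ≠ C.p₁ j y :=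
  fun e => h (by rw [← pieceOf_apply C.bij₁ i x, e, pieceOf_apply])

lemma p₂_ne {i j : I} (h : i ≠ j) (x : (C.Q i).2) (y : (C.Q j).2) : C.p₂ i x ≠ C.p₂ j y :=
  fun e => h (by rw [← pieceOf_apply C.bij₂ i x, e, pieceOf_apply])

lemma p₁_ne_of_ne {i : I} {x y : (C.Q i).1} (h : x ≠ y) : C.p₁ i x ≠ C.p₁ i y :=
  fun e => h (eq_of_apply_eq C.bij₁ e)

lemma p₂_ne_of_ne {i : I} {x y : (C.Q i).2} (h : x ≠ y) : C.p₂ i x ≠ C.p₂ i y :=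
  fun e => h (eq_of_apply_eq C.bij₂ e)

end Pieces

variable {J : Type} (C : Config P (Option (Option J))) (s₀ : (C.Q (some none)).1.carrier)
  (t₀ : (C.Q none).2.carrier)

/-- The pieces of a contraction. -/
def contractQ : Option J → FB × FB
  | none => circ (C.Q (some none)) (C.Q none) s₀ t₀
  | some j => C.Q (some (some j))

variable {s : P.1.carrier} {t : P.2.carrier} (hs : C.p₁ (some none) s₀ = s) (ht : C.p₂ none t₀ = t)

/-- The placement of the pieces of a contraction. -/
def contractFst : ∀ i : Option J, (C.contractQ s₀ t₀ i).1.carrier → (biDel P s t).1.carrier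
  | none => Sum.elim (fun x => ⟨C.p₁ (some none) x.1, hs ▸ C.p₁_ne_of_ne x.2⟩)
      (fun y => ⟨C.p₁ none y, hs ▸ C.p₁_ne (by simp) _ _⟩)
  | some j => fun x => ⟨C.p₁ (some (some j)) x, hs ▸ C.p₁_ne (by simp) _ _⟩

/-- The placement of the pieces of a contraction. -/
def contractSnd : ∀ i : Option J, (C.contractQ s₀ t₀ i).2.carrier → (biDel P s t).2.carrier
  | none => Sum.elim (fun x => ⟨C.p₂ (some none) x, ht ▸ C.p₂_ne (by simp) _ _⟩)
      (fun y => ⟨C.p₂ none y.1, ht ▸ C.p₂_ne_of_ne y.2⟩)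
  | some j => fun x => ⟨C.p₂ (some (some j)) x, ht ▸ C.p₂_ne (by simp) _ _⟩

/-- The merged piece consists of the old piece of s without s and the old piece of t; each half
inherits injectivity and its share of surjectivity from the old placement. -/
lemma contractFst_bijective : Function.Bijective
    (fun z : Σ i, (C.contractQ s₀ t₀ i).1.carrier => C.contractFst s₀ t₀ (t := t) hs z.1 z.2) := by
  constructor
  · rintro ⟨_ | j, x⟩ ⟨_ | j', y⟩ h <;> replace h := congrArg Subtype.val h
    · rcases x with x | x <;> rcases y with y | y
      · exact Sigma.ext rfl (heq_of_eq (congrArg Sum.inl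
          (Subtype.ext (eq_of_apply_eq C.bij₁ h))))
      · exact absurd h (C.p₁_ne (by simp) _ _)
      · exact absurd h (C.p₁_ne (by simp) _ _)
      · exact Sigma.ext rfl (heq_of_eq (congrArg Sum.inr (eq_of_apply_eq C.bij₁ h)))
    · rcases x with x | x <;> exact absurd h (C.p₁_ne (by simp) _ _)
    · rcases y with y | y <;> exact absurd h (C.p₁_ne (by simp) _ _)
    · have := C.bij₁.1 (a₁ := ⟨some (some j), x⟩) (a₂ := ⟨some (some j'), y⟩) h
      cases this
      rfl
  · rintro ⟨u, hu⟩
    obtain ⟨_ | _ | j, x, rfl⟩ := exists_piece C.bij₁ u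
    · exact ⟨⟨none, Sum.inr x⟩, rfl⟩
    · exact ⟨⟨none, Sum.inl ⟨x, fun e => hu (by rw [← hs, e])⟩⟩, rfl⟩
    · exact ⟨⟨some j, x⟩, rfl⟩

lemma contractSnd_bijective : Function.Bijective
    (fun z : Σ i, (C.contractQ s₀ t₀ i).2.carrier => C.contractSnd s₀ t₀ (s := s) ht z.1 z.2) := by
  constructor
  · rintro ⟨_ | j, x⟩ ⟨_ | j', y⟩ h <;> replace h := congrArg Subtype.val h
    · rcases x with x | x <;> rcases y with y | y
      · exact Sigma.ext rfl (heq_of_eq (congrArg Sum.inl (eq_of_apply_eq C.bij₂ h)))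
      · exact absurd h (C.p₂_ne (by simp) _ _)
      · exact absurd h (C.p₂_ne (by simp) _ _)
      · exact Sigma.ext rfl (heq_of_eq (congrArg Sum.inr
          (Subtype.ext (eq_of_apply_eq C.bij₂ h))))
    · rcases x with x | x <;> exact absurd h (C.p₂_ne (by simp) _ _)
    · rcases y with y | y <;> exact absurd h (C.p₂_ne (by simp) _ _)
    · have := C.bij₂.1 (a₁ := ⟨some (some j), x⟩) (a₂ := ⟨some (some j'), y⟩) h
      cases this
      rfl
  · rintro ⟨u, hu⟩
    obtain ⟨_ | _ | j, x, rfl⟩ := exists_piece C.bij₂ u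
    · exact ⟨⟨none, Sum.inr ⟨x, fun e => hu (by rw [← ht, e])⟩⟩, rfl⟩
    · exact ⟨⟨none, Sum.inl x⟩, rfl⟩
    · exact ⟨⟨some j, x⟩, rfl⟩

/-- The configuration in which the last two pieces are composed along a walled pair. -/
def contract : Config (biDel P s t) (Option J) where
  Q := C.contractQ s₀ t₀
  p₁ := C.contractFst s₀ t₀ hs
  p₂ := C.contractSnd s₀ t₀ ht
  bij₁ := C.contractFst_bijective s₀ t₀ hs
  bij₂ := C.contractSnd_bijective s₀ t₀ ht

variable {M : BiMod k}

/-- Elements on the pieces of a contraction. -/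
def contractElt (a : ∀ i, M.obj (C.Q i)) (z : M.obj (circ (C.Q (some none)) (C.Q none) s₀ t₀)) :
    ∀ i, M.obj ((C.contract s₀ t₀ hs ht).Q i)
  | none => z
  | some j => a (some (some j))

/-- The elements on the pieces of a contraction that are given by `μ`. -/
abbrev contractVal (μ : day M M ⟶ day M (kk11 k)) (a : ∀ i, M.obj (C.Q i)) :
    ∀ i, M.obj ((C.contract s₀ t₀ hs ht).Q i) :=
  C.contractElt s₀ t₀ hs ht a (circMul μ s₀ t₀ (a (some none)) (a none))

end Config

/-! ### The map `id ⊚ μ` on pure tensors -/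

section ApplyLast

variable {k : Type v} [Field k] {M : BiMod k} (ε : Twist) (μ : day M M ⟶ day M (kk11 k)) {n : ℕ}
  {P : FB × FB}

lemma applyLast_tpowMk_pos (c : Dec P (Fin (n + 2))) {s : P.1} {t : P.2} (hs : n ≤ (c.1 s).val)
    (ht : n ≤ (c.2 t).val) (a : ∀ i, M.obj (c.part i)) :
    applyLast ε μ n P s t (tpowMk c a) =
      tpowMk (c.merge s t) (applyLastFun ε μ c hs ht a) := by
  classical
  refine (congrArg (applyLast ε μ n P s t) (LinearMap.congr_fun (lof_eq_dsOf (k := k)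
    (A := fun c : Dec P (Fin (n + 2)) => tensPart M c) c) _).symm).trans ?_
  refine (DirectSum.toModule_lof _ _ _).trans ?_
  rw [dif_pos ⟨hs, ht⟩]
  refine (LinearMap.congr_fun (lof_eq_dsOf (k := k)
    (A := fun c : Dec (biDel P s t) (Fin (n + 1)) => tensPart M c) (c.merge s t)) _).trans ?_
  exact congrArg (dsOf k _ _) (PiTensorProduct.lift.tprod _)

lemma applyLast_tpowMk_neg (c : Dec P (Fin (n + 2))) {s : P.1} {t : P.2}
    (h : ¬ (n ≤ (c.1 s).val ∧ n ≤ (c.2 t).val)) (a : ∀ i, M.obj (c.part i)) :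
    applyLast ε μ n P s t (tpowMk c a) = 0 := by
  classical
  refine (congrArg (applyLast ε μ n P s t) (LinearMap.congr_fun (lof_eq_dsOf (k := k)
    (A := fun c : Dec P (Fin (n + 2)) => tensPart M c) c) _).symm).trans ?_
  refine (DirectSum.toModule_lof _ _ _).trans ?_
  rw [dif_neg h]
  rfl

lemma tpowMk_eq_zero {d : ℕ} (c : Dec P (Fin d)) (a : ∀ i, M.obj (c.part i)) (i : Fin d)
    (h : a i = 0) : tpowMk c a = 0 :=
  (congrArg (dsOf k _ _) (MultilinearMap.map_coord_zero _ i h)).trans (map_zero _)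

variable {μ} in
-- If the common piece is among the last two, the last factor of the result is a component of μ that
-- vanishes by diagonality; if it is not, the map is zero on this summand.
lemma applyLast_tpowMk_eq_zero (hμ : IsDiagonal μ) (c : Dec P (Fin (n + 2))) {s : P.1} {t : P.2}
    (h : c.1 s = c.2 t) (a : ∀ i, M.obj (c.part i)) :
    applyLast ε μ n P s t (tpowMk c a) = 0 := by
  by_cases h' : n ≤ (c.1 s).val ∧ n ≤ (c.2 t).val
  · rw [applyLast_tpowMk_pos ε μ c h'.1 h'.2]
    refine tpowMk_eq_zero _ _ (Fin.last n) ?_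
    unfold applyLastFun
    rw [dif_neg (by simp), muTw, hμ]
    · simp
    · simp only [h]
  · exact applyLast_tpowMk_neg ε μ c h' a

end ApplyLast

namespace Config

variable {k : Type v} [Field k] {M : BiMod k} (ε : Twist) (μ : day M M ⟶ day M (kk11 k)) {n : ℕ}
  {P : FB × FB}

/-- Used to move a sign between one factor and the whole tensor. -/
lemma pre_smul {I : Type} {d : ℕ} (C : Config P I) (e : I ≃ Fin d) (a a' : ∀ i, M.obj (C.Q i))
    (i : I) (r : k) (h : a' i = r • a i) (h' : ∀ j, j ≠ i → a' j = a j) :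
    C.pre e a' = r • C.pre e a := by
  have key : C.val e a' = Function.update (C.val e a) (e i) (r • C.val e a (e i)) := by
    funext l
    obtain ⟨j, rfl⟩ := e.surjective l
    rw [C.val_eq e a' rfl (C.isIncl_incl e j)]
    by_cases hj : j = i
    · subst hj
      rw [Function.update_self, h, map_smul, C.val_eq e a rfl (C.isIncl_incl e j)]
    · rw [Function.update_of_ne (e.injective.ne hj), h' j hj, C.val_eq e a rfl (C.isIncl_incl e j)]
  unfold pre tpowMk
  rw [key, MultilinearMap.map_update_smul, Function.update_eq_self, map_smul]
  rfl

variable {J : Type} (C : Config P (Option (Option J))) (s₀ : (C.Q (some none)).1.carrier)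
  (t₀ : (C.Q none).2.carrier) {s : P.1.carrier} {t : P.2.carrier}
  (hs : C.p₁ (some none) s₀ = s) (ht : C.p₂ none t₀ = t)

/-- The piece of s stands immediately before that of t, the order in which `circMul` takes its
arguments, so no sign occurs. The numbering `e'` is constrained only by values, so that the lemma
fits every term of the transfer. -/
lemma applyLast_pre (e : Option (Option J) ≃ Fin (n + 2)) (e' : Option J ≃ Fin (n + 1))
    (h₀ : (e (some none)).val = n) (h₁ : (e none).val = n + 1) (h' : (e' none).val = n)
    (hj : ∀ j, (e' (some j)).val = (e (some (some j))).val) (a : ∀ i, M.obj (C.Q i)) :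
    applyLast ε μ n P s t (C.pre e a) =
      (C.contract s₀ t₀ hs ht).pre e' (C.contractVal s₀ t₀ hs ht μ a) := by
  have hs' : n ≤ ((C.dec e).1 s).val := by rw [← hs, dec_fst, h₀]
  have ht' : n ≤ ((C.dec e).2 t).val := by rw [← ht, dec_snd, h₁]; omega
  refine (applyLast_tpowMk_pos ε μ (C.dec e) hs' ht' _).trans (tpowMk_eq_pre _ _ _ _ _ fun i => ?_)
  rcases i with _ | j
  · obtain ⟨r₀, hr₀, e₀⟩ := C.exists_val_eq e a (i := some none) (j := ⟨n, by omega⟩)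
      (Fin.ext h₀.symm)
    obtain ⟨r₁, hr₁, e₁⟩ := C.exists_val_eq e a (i := none) (j := ⟨n + 1, by omega⟩)
      (Fin.ext h₁.symm)
    obtain ⟨ρ, hρ₁, hρ₂, hρ₃, hρ₄, hρ⟩ := muTw_eq_circMul ε μ (Dec.tailDec (C.dec e))
      (r₀ ≫ Dec.tailMap₀ (C.dec e)) (r₁ ≫ Dec.tailMap₁ (C.dec e)) s₀ t₀
      (s := ⟨s, hs'⟩) (t := ⟨t, ht'⟩) (Subtype.ext ((hr₀.fst s₀).trans hs))
      (Subtype.ext ((hr₁.snd t₀).trans ht))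
    have hl : ¬ (e' none).val < n := by omega
    refine ⟨ρ ≫ Dec.mergeLast (C.dec e) hs' ht' (e' none) hl, ⟨?_, ?_⟩, ?_⟩
    · rintro (x | x)
      · exact Subtype.ext ((congrArg Subtype.val (hρ₁ x)).trans (hr₀.fst x.1))
      · exact Subtype.ext ((congrArg Subtype.val (hρ₂ x)).trans (hr₁.fst x))
    · rintro (x | x)
      · exact Subtype.ext ((congrArg Subtype.val (hρ₃ x)).trans (hr₀.snd x))
      · exact Subtype.ext ((congrArg Subtype.val (hρ₄ x)).trans (hr₁.snd x.1))
    · refine (dif_neg hl).trans ?_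
      rw [e₀, e₁, BiMod.map_map, BiMod.map_map, hρ]
      exact BiMod.map_map M _ _ _
  · have hl : (e' (some j)).val < n := by
      have h1 := (e' (some j)).isLt
      have h2 : (e' (some j)).val ≠ (e' none).val :=
        fun h => by simpa using e'.injective (Fin.ext h)
      omega
    obtain ⟨r, hr, er⟩ := C.exists_val_eq e a (i := some (some j))
      (j := ⟨(e' (some j)).val, by omega⟩) (Fin.ext (hj j))
    refine ⟨r ≫ Dec.mergeMap (C.dec e) hs' ht' (e' (some j)) hl,
      ⟨fun x => Subtype.ext (hr.fst x), fun x => Subtype.ext (hr.snd x)⟩, ?_⟩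
    refine (dif_pos hl).trans ?_
    rw [er]
    exact BiMod.map_map M _ _ _

variable {μ} in
-- The piece of t now precedes that of s, and `muTw_eq_circMul_swap` supplies the sign.
lemma applyLast_pre_swap (hμ : IsSymmetric μ) (e : Option (Option J) ≃ Fin (n + 2))
    (e' : Option J ≃ Fin (n + 1)) (h₀ : (e (some none)).val = n + 1) (h₁ : (e none).val = n)
    (h' : (e' none).val = n) (hj : ∀ j, (e' (some j)).val = (e (some (some j))).val)
    (a : ∀ i, M.obj (C.Q i)) :
    applyLast ε μ n P s t (C.pre e a) =
      (ε.sgn : ℤ) • (C.contract s₀ t₀ hs ht).pre e' (C.contractVal s₀ t₀ hs ht μ a) := by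
  have hs' : n ≤ ((C.dec e).1 s).val := by rw [← hs, dec_fst, h₀]; omega
  have ht' : n ≤ ((C.dec e).2 t).val := by rw [← ht, dec_snd, h₁]
  -- The sign is put into the composite factor, after which the tensors can be compared factor by
  -- factor.
  rw [← Int.cast_smul_eq_zsmul k, ← pre_smul (C.contract s₀ t₀ hs ht) e' _
    (C.contractElt s₀ t₀ hs ht a
      ((((ε.sgn : ℤ) : k)) • circMul μ s₀ t₀ (a (some none)) (a none))) none _ rfl
    (fun j hj => by rcases j with _ | j <;> [exact absurd rfl hj; rfl])]
  refine (applyLast_tpowMk_pos ε μ (C.dec e) hs' ht' _).trans (tpowMk_eq_pre _ _ _ _ _ fun i => ?_)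
  rcases i with _ | j
  · obtain ⟨r₀, hr₀, e₀⟩ := C.exists_val_eq e a (i := some none) (j := ⟨n + 1, by omega⟩)
      (Fin.ext h₀.symm)
    obtain ⟨r₁, hr₁, e₁⟩ := C.exists_val_eq e a (i := none) (j := ⟨n, by omega⟩)
      (Fin.ext h₁.symm)
    obtain ⟨ρ, hρ₁, hρ₂, hρ₃, hρ₄, hρ⟩ := muTw_eq_circMul_swap ε hμ (Dec.tailDec (C.dec e))
      (r₀ ≫ Dec.tailMap₁ (C.dec e)) (r₁ ≫ Dec.tailMap₀ (C.dec e)) s₀ t₀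
      (s := ⟨s, hs'⟩) (t := ⟨t, ht'⟩) (Subtype.ext ((hr₀.fst s₀).trans hs))
      (Subtype.ext ((hr₁.snd t₀).trans ht))
    have hl : ¬ (e' none).val < n := by omega
    refine ⟨ρ ≫ Dec.mergeLast (C.dec e) hs' ht' (e' none) hl, ⟨?_, ?_⟩, ?_⟩
    · rintro (x | x)
      · exact Subtype.ext ((congrArg Subtype.val (hρ₁ x)).trans (hr₀.fst x.1))
      · exact Subtype.ext ((congrArg Subtype.val (hρ₂ x)).trans (hr₁.fst x))
    · rintro (x | x)
      · exact Subtype.ext ((congrArg Subtype.val (hρ₃ x)).trans (hr₀.snd x))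
      · exact Subtype.ext ((congrArg Subtype.val (hρ₄ x)).trans (hr₁.snd x.1))
    · refine (dif_neg hl).trans ?_
      rw [e₀, e₁, BiMod.map_map, BiMod.map_map, hρ, ← Int.cast_smul_eq_zsmul k, map_smul]
      refine Eq.trans ?_ (LinearMap.map_smul _ _ _).symm
      exact congrArg _ (BiMod.map_map M _ _ _)
  · have hl : (e' (some j)).val < n := by
      have h1 := (e' (some j)).isLt
      have h2 : (e' (some j)).val ≠ (e' none).val :=
        fun h => by simpa using e'.injective (Fin.ext h)
      omega
    obtain ⟨r, hr, er⟩ := C.exists_val_eq e a (i := some (some j))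
      (j := ⟨(e' (some j)).val, by omega⟩) (Fin.ext (hj j))
    refine ⟨r ≫ Dec.mergeMap (C.dec e) hs' ht' (e' (some j)) hl,
      ⟨fun x => Subtype.ext (hr.fst x), fun x => Subtype.ext (hr.snd x)⟩, ?_⟩
    refine (dif_pos hl).trans ?_
    rw [er]
    exact BiMod.map_map M _ _ _

end Config

/-! ### Block permutations and evaluation of the transfer -/

lemma blockPerm_injective (n m : ℕ) : Function.Injective
    (fun p : Equiv.Perm (Fin n) × Equiv.Perm (Fin m) => blockPerm p.1 p.2) := by
  intro p q h
  exact Equiv.Perm.sumCongrHom_injective (finSumFinEquiv.permCongr.injective h)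

/-- By finiteness, a permutation that maps the last block into itself also preserves the first. -/
lemma mem_range_blockPerm {n m : ℕ} (σ : Equiv.Perm (Fin (n + m)))
    (h : ∀ i : Fin m, n ≤ (σ (Fin.natAdd n i)).val) :
    ∃ p : Equiv.Perm (Fin n) × Equiv.Perm (Fin m), blockPerm p.1 p.2 = σ := by
  have h' : Set.MapsTo (finSumFinEquiv.symm.permCongr σ) (Set.range Sum.inr)
      (Set.range Sum.inr) := by
    rintro _ ⟨i, rfl⟩
    refine ⟨⟨(σ (Fin.natAdd n i)).val - n, by have := h i; omega⟩, ?_⟩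
    rw [Equiv.permCongr_apply, Equiv.eq_symm_apply]
    ext
    have := h i
    simp
    omega
  obtain ⟨p, hp⟩ := Equiv.Perm.mem_sumCongrHom_range_of_perm_mapsTo_inl
    ((Equiv.Perm.perm_mapsTo_inl_iff_mapsTo_inr _).2 h')
  refine ⟨p, ?_⟩
  change finSumFinEquiv.permCongr (Equiv.Perm.sumCongrHom _ _ p) = σ
  rw [hp]
  ext
  simp

namespace Config

variable {k : Type v} [Field k] {M : BiMod k} (ε : Twist) {μ : day M M ⟶ day M (kk11 k)} {n : ℕ}
  {P : FB × FB}

/-- Every permutation of the factors leaves s and t in a common piece, so each term of the transfer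
vanishes. -/
lemma extend_gen_eq_zero (hμ : IsDiagonal μ) {I : Type} (C : Config P I) (e : I ≃ Fin (n + 2))
    (a : ∀ i, M.obj (C.Q i)) (i : I) (s₀ : (C.Q i).1) (t₀ : (C.Q i).2) {s : P.1} {t : P.2}
    (hs : C.p₁ i s₀ = s) (ht : C.p₂ i t₀ = t) : extend ε μ n P s t (C.gen ε e a) = 0 := by
  refine (extendPre_apply ε μ n P s t (C.pre e a)).trans ?_
  rw [Finset.sum_eq_zero, smul_zero]
  intro σ _
  rw [permAct_pre, pre, applyLast_tpowMk_eq_zero ε hμ, map_zero, smul_zero]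
  rw [← hs, ← ht, dec_fst, dec_snd]

/-- Only permutations in S_n × S_2 keep the pieces of s and t in the last two places. For such a
pair (τ, ρ), the character of τ is undone by renumbering the untouched pieces and that of ρ by the
symmetry of μ. All 2 n! terms are therefore equal, and characteristic zero allows their number to
cancel against the normalization. -/
lemma extend_gen [CharZero k] (hμ : IsSymmetric μ) {J : Type} (C : Config P (Option (Option J)))
    (s₀ : (C.Q (some none)).1.carrier) (t₀ : (C.Q none).2.carrier) {s : P.1.carrier}
    {t : P.2.carrier} (hs : C.p₁ (some none) s₀ = s) (ht : C.p₂ none t₀ = t) (f : J ≃ Fin n)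
    (a : ∀ i, M.obj (C.Q i)) :
    extend ε μ n P s t (C.gen ε (optFin (optFin f)) a) =
      (C.contract s₀ t₀ hs ht).gen ε (optFin f) (C.contractVal s₀ t₀ hs ht μ a) := by
  refine (extendPre_apply ε μ n P s t (C.pre (optFin (optFin f)) a)).trans ?_
  rw [← Fintype.sum_of_injective _ (blockPerm_injective n 2)
    (fun _ => (C.contract s₀ t₀ hs ht).gen ε (optFin f) (C.contractVal s₀ t₀ hs ht μ a))]
  · rw [Finset.sum_const, Finset.card_univ, Fintype.card_prod, Fintype.card_perm, Fintype.card_perm,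
      Fintype.card_fin, Fintype.card_fin, ← Nat.cast_smul_eq_nsmul k, smul_smul]
    rw [show ((2 * n.factorial : k)⁻¹) * ((n.factorial * Nat.factorial 2 : ℕ) : k) = 1 from ?_,
      one_smul]
    have : (n.factorial : k) ≠ 0 := Nat.cast_ne_zero.2 n.factorial_ne_zero
    push_cast [Nat.factorial]
    field_simp
  · intro σ hσ
    rw [permAct_pre, pre, applyLast_tpowMk_neg, map_zero, smul_zero]
    rintro ⟨h₁, h₂⟩
    rw [← hs, dec_fst] at h₁
    rw [← ht, dec_snd] at h₂
    refine hσ (mem_range_blockPerm σ ?_)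
    -- The two elements of the last block are the numbers of the pieces of s and of t.
    intro i
    fin_cases i
    · refine h₁.trans (le_of_eq (congrArg (fun i => (σ i).val) ?_))
      ext; simp
    · refine h₂.trans (le_of_eq (congrArg (fun i => (σ i).val) ?_))
      ext; simp
  · rintro ⟨τ, ρ⟩
    dsimp only
    obtain ⟨e, he⟩ : ∃ e : Option (Option J) ≃ Fin (n + 2), optFin (optFin f) = e := ⟨_, rfl⟩
    rw [he]
    have e₀ : (e.trans (blockPerm τ ρ)) (some none) = Fin.natAdd n (ρ 0) := by
      have : e (some none) = Fin.natAdd n (0 : Fin 2) := by subst he; ext; simp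
      rw [Equiv.trans_apply, this]; simp [blockPerm]
    have e₁ : (e.trans (blockPerm τ ρ)) none = Fin.natAdd n (ρ 1) := by
      have : e none = Fin.natAdd n (1 : Fin 2) := by subst he; ext; simp
      rw [Equiv.trans_apply, this]; simp [blockPerm]
    have hj : ∀ j, (optFin (f.trans τ) (some j)).val =
        ((e.trans (blockPerm τ ρ)) (some (some j))).val := by
      intro j
      have : e (some (some j)) = Fin.castAdd 2 (f j) := by subst he; ext; simp
      rw [Equiv.trans_apply, this]; simp [blockPerm]
    rw [permAct_pre, ε.chi_blockPerm]
    have hg : (C.contract s₀ t₀ hs ht).gen ε (optFin (f.trans τ)) (C.contractVal s₀ t₀ hs ht μ a) =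
        (ε.chi τ : ℤ) •
          (C.contract s₀ t₀ hs ht).gen ε (optFin f) (C.contractVal s₀ t₀ hs ht μ a) := by
      rw [optFin_trans, gen_trans, ε.chi_blockPerm, ε.chi_one, mul_one]
    -- The transposition is the case in which the piece of t comes first; its character cancels the
    -- sign of `applyLast_pre_swap`.
    have hρ : ∀ ρ : Equiv.Perm (Fin 2), ρ = 1 ∨ ρ = Equiv.swap 0 1 := by decide
    rcases hρ ρ with rfl | rfl
    · rw [C.applyLast_pre ε μ s₀ t₀ hs ht _ (optFin (f.trans τ)) (by rw [e₀]; simp)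
        (by rw [e₁]; simp) (by simp) hj]
      refine Eq.trans ?_ (congrArg _ hg.symm)
      rw [smul_smul, ε.chi_one]
      simp
    · rw [C.applyLast_pre_swap ε s₀ t₀ hs ht hμ _ (optFin (f.trans τ)) (by rw [e₀]; simp)
        (by rw [e₁]; simp) (by simp) hj, map_zsmul]
      refine Eq.trans ?_ (congrArg (fun z => _ • _ • z) hg.symm)
      rw [smul_smul, smul_smul, ε.chi_swap (by simp)]
      rcases ε <;> simp [Twist.sgn]

end Config

/-! ### Double contractions -/

/-- The exchange of the two last elements. -/
def swapTop (K : Type) : Option (Option K) ≃ Option (Option K) where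
  toFun
    | none => some none
    | some none => none
    | some (some x) => some (some x)
  invFun
    | none => some none
    | some none => none
    | some (some x) => some (some x)
  left_inv := by rintro (_ | _ | x) <;> rfl
  right_inv := by rintro (_ | _ | x) <;> rfl

/-- The extension of a bijection that fixes the last element. -/
def consOpt {K L : Type} (α : K ≃ L) : Option K ≃ Option L where
  toFun
    | none => none
    | some x => some (α x)
  invFun
    | none => none
    | some x => some (α.symm x)
  left_inv := by rintro (_ | x) <;> simp
  right_inv := by rintro (_ | x) <;> simp

/-! ### The sum of all symmetric or exterior powers -/

section Total

variable {k : Type v} [Field k] {ε : Twist} {M : BiMod k} {P : FB × FB}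

variable (ε M P) in
/-- The inclusion of a symmetric or exterior power in the sum of all of them. -/
def totalOf (d : ℕ) : (gpow ε d M).obj P →ₗ[k] ((totalPow k ε).obj M).obj P :=
  dsOf k (fun d => (gpow ε d M).obj P) d

lemma map_totalOf {Q : FB × FB} (φ : P ⟶ Q) (d : ℕ) (v : (gpow ε d M).obj P) :
    (((totalPow k ε).obj M).map φ).hom (totalOf ε M P d v) =
      totalOf ε M Q d (((gpow ε d M).map φ).hom v) :=
  dsMap_dsOf (k := k) (A := fun d => (gpow ε d M).obj P) (B := fun d => (gpow ε d M).obj Q)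
    (fun d => d) (fun d => ((gpow ε d M).map φ).hom) d v

lemma totalPow_map_totalOf {N : BiMod k} (g : M ⟶ N) (d : ℕ) (v : (gpow ε d M).obj P) :
    (((totalPow k ε).map g).app P).hom (totalOf ε M P d v) =
      totalOf ε N P d (((gpowMap ε d g).app P).hom v) :=
  dsMap_dsOf (k := k) (A := fun d => (gpow ε d M).obj P) (B := fun d => (gpow ε d N).obj P)
    (fun d => d) (fun d => ((gpowMap ε d g).app P).hom) d v

variable (μ : day M M ⟶ day M (kk11 k)) (s : P.1) (t : P.2)

lemma extendTotal_totalOf_one (v : (gpow ε 1 M).obj P) :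
    extendTotal ε μ P s t (totalOf ε M P 1 v) = 0 := by
  classical
  refine (congrArg (extendTotal ε μ P s t) (LinearMap.congr_fun (lof_eq_dsOf (k := k)
    (A := fun d => (gpow ε d M).obj P) 1) v).symm).trans ?_
  exact DirectSum.toModule_lof _ _ _

lemma extendTotal_totalOf (n : ℕ) (v : (gpow ε (n + 2) M).obj P) :
    extendTotal ε μ P s t (totalOf ε M P (n + 2) v) =
      totalOf ε M _ (n + 1) (extend ε μ n P s t v) := by
  classical
  refine (congrArg (extendTotal ε μ P s t) (LinearMap.congr_fun (lof_eq_dsOf (k := k)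
    (A := fun d => (gpow ε d M).obj P) (n + 2)) v).symm).trans ?_
  refine (DirectSum.toModule_lof _ _ _).trans ?_
  exact LinearMap.congr_fun (lof_eq_dsOf (k := k)
    (A := fun d => (gpow ε d M).obj (biDel P s t)) (n + 1)) _

lemma total_hom_ext {V : Type*} [AddCommGroup V] [Module k V]
    {f g : ((totalPow k ε).obj M).obj P →ₗ[k] V}
    (h : ∀ (d : ℕ) (C : Config P (Fin d)) a, f (totalOf ε M P d (C.gen ε (Equiv.refl _) a)) =
      g (totalOf ε M P d (C.gen ε (Equiv.refl _) a))) : f = g := by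
  refine dsOf_ext fun d w => ?_
  exact LinearMap.congr_fun (gpow_hom_ext (f := f ∘ₗ totalOf ε M P d) (g := g ∘ₗ totalOf ε M P d)
    (h d)) w

end Total

namespace Config

variable {k : Type v} [Field k] {ε : Twist} {M : BiMod k} {P : FB × FB} {I I' : Type} {d n : ℕ}

variable (ε) in
/-- The element of the sum of all symmetric or exterior powers that belongs to a configuration. -/
def tgen (C : Config P I) (e : I ≃ Fin d) (a : ∀ i, M.obj (C.Q i)) :
    ((totalPow k ε).obj M).obj P := totalOf ε M P d (C.gen ε e a)

/-- The configuration obtained by renaming the pieces. -/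
def comp (C : Config P I) (α : I' ≃ I) : Config P I' where
  Q i := C.Q (α i)
  p₁ i := C.p₁ (α i)
  p₂ i := C.p₂ (α i)
  bij₁ := C.bij₁.comp (Equiv.sigmaCongrLeft (β := fun i => (C.Q i).1.carrier) α).bijective
  bij₂ := C.bij₂.comp (Equiv.sigmaCongrLeft (β := fun i => (C.Q i).2.carrier) α).bijective

/-- Elements on the pieces of `comp`. -/
abbrev compVal (C : Config P I) (α : I' ≃ I) (a : ∀ i, M.obj (C.Q i)) :
    ∀ i, M.obj ((C.comp α).Q i) := fun i => a (α i)

variable (ε) in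
lemma tgen_comp (C : Config P I) (α : I' ≃ I) (e : I ≃ Fin d) (e' : I' ≃ Fin d)
    (a : ∀ i, M.obj (C.Q i)) : C.tgen ε e a =
      (ε.chi (e'.symm.trans (α.trans e)) : ℤ) • (C.comp α).tgen ε e' (C.compVal α a) := by
  unfold tgen
  rw [← map_zsmul]
  refine congrArg _ (gen_reindex ε (C.comp α) C α e' e (C.compVal α a) a fun i => ?_)
  exact ⟨𝟙 _, fun _ => rfl, fun _ => rfl, (M.map_id_apply _).symm⟩

/-- An exchange of two names changes the numbering by a transposition, whose character is `ε.sgn`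
whatever the degree. -/
lemma tgen_comp_swap (C : Config P I) (α : I ≃ I) (e : I ≃ Fin d) (a : ∀ i, M.obj (C.Q i))
    (i j : I) (hij : i ≠ j) (hi : α i = j) (hj : α j = i)
    (h : ∀ l, l ≠ i → l ≠ j → α l = l) :
    C.tgen ε e a = (ε.sgn : ℤ) • (C.comp α).tgen ε e (C.compVal α a) := by
  rw [C.tgen_comp ε α e e, show e.symm.trans (α.trans e) = Equiv.swap (e i) (e j) from ?_,
    ε.chi_swap (e.injective.ne hij)]
  ext l
  obtain ⟨l, rfl⟩ := e.surjective l
  by_cases h₁ : l = i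
  · subst h₁; simp [hi]
  · by_cases h₂ : l = j
    · subst h₂; simp [hj]
    · rw [Equiv.swap_apply_of_ne_of_ne (e.injective.ne h₁) (e.injective.ne h₂)]
      simp [h l h₁ h₂]

/-- This and the next two lemmas exchange neighbouring pieces, counted from the end. They bring the
pieces to be composed to the last places, at the cost of one sign per exchange. -/
lemma tgen_swap₁ {K : Type} (C : Config P (Option (Option K))) (e : Option (Option K) ≃ Fin d)
    (a : ∀ i, M.obj (C.Q i)) : C.tgen ε e a =
      (ε.sgn : ℤ) • (C.comp (swapTop K)).tgen ε e (C.compVal (swapTop K) a) :=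
  C.tgen_comp_swap (swapTop K) e a none (some none) (by simp) rfl rfl
    (by rintro (_ | _ | x) h₁ h₂ <;> first | rfl | exact absurd rfl h₁ | exact absurd rfl h₂)

lemma tgen_swap₂ {K : Type} (C : Config P (Option (Option (Option K))))
    (e : Option (Option (Option K)) ≃ Fin d) (a : ∀ i, M.obj (C.Q i)) : C.tgen ε e a =
      (ε.sgn : ℤ) • (C.comp (consOpt (swapTop K))).tgen ε e (C.compVal (consOpt (swapTop K)) a) :=
  C.tgen_comp_swap (consOpt (swapTop K)) e a (some none) (some (some none)) (by simp) rfl rfl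
    (by rintro (_ | _ | _ | x) h₁ h₂ <;>
      first | rfl | exact absurd rfl h₁ | exact absurd rfl h₂)

lemma tgen_swap₃ {K : Type} (C : Config P (Option (Option (Option (Option K)))))
    (e : Option (Option (Option (Option K))) ≃ Fin d) (a : ∀ i, M.obj (C.Q i)) : C.tgen ε e a =
      (ε.sgn : ℤ) • (C.comp (consOpt (consOpt (swapTop K)))).tgen ε e
        (C.compVal (consOpt (consOpt (swapTop K))) a) :=
  C.tgen_comp_swap (consOpt (consOpt (swapTop K))) e a (some (some none))
    (some (some (some none))) (by simp) rfl rfl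
    (by rintro (_ | _ | _ | _ | x) h₁ h₂ <;>
      first | rfl | exact absurd rfl h₁ | exact absurd rfl h₂)

lemma map_tgen (C : Config P I) (e : I ≃ Fin d) (a : ∀ i, M.obj (C.Q i)) {Q : FB × FB} (φ : P ⟶ Q) :
    (((totalPow k ε).obj M).map φ).hom (C.tgen ε e a) = (C.map φ).tgen ε e a :=
  (map_totalOf φ d _).trans (congrArg _ (C.map_gen ε e a φ))

lemma totalPow_map_tgen {N : BiMod k} (g : M ⟶ N) (C : Config P I) (e : I ≃ Fin d)
    (a : ∀ i, M.obj (C.Q i)) :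
    (((totalPow k ε).map g).app P).hom (C.tgen ε e a) =
      C.tgen ε e (fun i => (g.app _).hom (a i)) :=
  (totalPow_map_totalOf g d _).trans (congrArg _ (C.gpowMap_gen ε g e a))

/-- Configurations with isomorphic pieces give the same element. -/
lemma tgen_congr (C C' : Config P I) (e : I ≃ Fin d) (a : ∀ i, M.obj (C.Q i))
    (a' : ∀ i, M.obj (C'.Q i))
    (h : ∀ i, ∃ r : C.Q i ⟶ C'.Q i, (∀ x, C'.p₁ _ (fstEquiv r x) = C.p₁ i x) ∧
      (∀ x, C'.p₂ _ (sndEquiv r x) = C.p₂ i x) ∧ a' i = (M.map r).hom (a i)) :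
    C'.tgen ε e a' = C.tgen ε e a := by
  unfold tgen
  rw [gen_reindex ε C C' (Equiv.refl I) e e a a' h,
    show e.symm.trans ((Equiv.refl I).trans e) = 1 from Equiv.ext fun _ => by simp, ε.chi_one,
    Units.val_one, one_smul]

variable {μ : day M M ⟶ day M (kk11 k)}

lemma extendTotal_tgen_eq_zero (hμ : IsDiagonal μ) (C : Config P I) (e : I ≃ Fin d)
    (a : ∀ i, M.obj (C.Q i)) (s : P.1) (t : P.2) (h : pieceOf C.bij₁ s = pieceOf C.bij₂ t) :
    extendTotal ε μ P s t (C.tgen ε e a) = 0 := by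
  obtain ⟨i, x, rfl⟩ := exists_piece C.bij₁ s
  obtain ⟨j, y, rfl⟩ := exists_piece C.bij₂ t
  rw [pieceOf_apply, pieceOf_apply] at h
  subst h
  -- In degree 0 there is no piece to contain s, and in degree 1 the extension is zero by
  -- definition.
  match d with
  | 0 => exact (e i).elim0
  | 1 => exact extendTotal_totalOf_one μ _ _ _
  | d + 2 =>
    refine (extendTotal_totalOf μ _ _ d _).trans ?_
    rw [extend_gen_eq_zero ε hμ C e a i x y rfl rfl, map_zero]

lemma extendTotal_tgen [CharZero k] (hμ : IsSymmetric μ) {J : Type}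
    (C : Config P (Option (Option J)))
    (s₀ : (C.Q (some none)).1.carrier) (t₀ : (C.Q none).2.carrier) {s : P.1.carrier}
    {t : P.2.carrier} (hs : C.p₁ (some none) s₀ = s) (ht : C.p₂ none t₀ = t) (f : J ≃ Fin n)
    (a : ∀ i, M.obj (C.Q i)) :
    extendTotal ε μ P s t (C.tgen ε (optFin (optFin f)) a) =
      (C.contract s₀ t₀ hs ht).tgen ε (optFin f) (C.contractVal s₀ t₀ hs ht μ a) :=
  (extendTotal_totalOf μ _ _ n _).trans (congrArg _ (C.extend_gen ε hμ s₀ t₀ hs ht f a))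

end Config

/-! ### Renaming of pieces -/

lemma Twist.sgn_smul_sgn_smul (ε : Twist) {V : Type*} [AddCommGroup V] (v : V) :
    (ε.sgn : ℤ) • (ε.sgn : ℤ) • v = v := by
  cases ε <;> simp [Twist.sgn]

/-- Any element can be made the last one. -/
lemma exists_option_equiv {n : ℕ} (i : Fin (n + 1)) : ∃ α : Option (Fin n) ≃ Fin (n + 1), α none = i :=
  ⟨(finSuccEquiv' i).symm, by simp⟩

/-- Makes the pieces in question the last ones, where `contract` operates; a further piece is placed
by choosing among the names that are left. -/
lemma exists_option₂_equiv {d : ℕ} {i j : Fin d} (h : i ≠ j) :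
    ∃ (n : ℕ) (_ : d = n + 2) (α : Option (Option (Fin n)) ≃ Fin d),
      α none = j ∧ α (some none) = i := by
  obtain ⟨n, rfl⟩ : ∃ n, d = n + 2 := ⟨d - 2, by
    have := i.isLt; have := j.isLt; have := Fin.val_ne_of_ne h; omega⟩
  obtain ⟨α, hα⟩ := exists_option_equiv j
  obtain ⟨i', hi'⟩ := α.surjective i
  rcases i' with _ | i'
  · exact absurd (hi'.symm.trans hα) h
  · obtain ⟨β, hβ⟩ := exists_option_equiv i'
    exact ⟨n, rfl, (consOpt β).trans α, hα, (congrArg (fun x => α (some x)) hβ).trans hi'⟩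

lemma exists_option₃_equiv {d : ℕ} {i j l : Fin d} (h : i ≠ j) (h₁ : l ≠ i) (h₂ : l ≠ j) :
    ∃ (n : ℕ) (_ : d = n + 3) (α : Option (Option (Option (Fin n))) ≃ Fin d),
      α none = j ∧ α (some none) = i ∧ α (some (some none)) = l := by
  obtain ⟨n, rfl, α, hj, hi⟩ := exists_option₂_equiv h
  obtain ⟨_ | _ | l', hl⟩ := α.surjective l
  · exact absurd (hl.symm.trans hj) h₂
  · exact absurd (hl.symm.trans hi) h₁
  · obtain ⟨n, rfl⟩ : ∃ m, n = m + 1 := ⟨n - 1, by have := l'.isLt; omega⟩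
    obtain ⟨β, hβ⟩ := exists_option_equiv l'
    exact ⟨n, rfl, (consOpt (consOpt β)).trans α, hj, hi,
      (congrArg (fun x => α (some (some x))) hβ).trans hl⟩

lemma exists_option₄_equiv {d : ℕ} {i j l m : Fin d} (h : i ≠ j) (h₁ : l ≠ i) (h₂ : l ≠ j)
    (h₃ : m ≠ i) (h₄ : m ≠ j) (h₅ : m ≠ l) :
    ∃ (n : ℕ) (_ : d = n + 4) (α : Option (Option (Option (Option (Fin n)))) ≃ Fin d),
      α none = j ∧ α (some none) = i ∧ α (some (some none)) = l ∧
      α (some (some (some none))) = m := by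
  obtain ⟨n, rfl, α, hj, hi, hl⟩ := exists_option₃_equiv h h₁ h₂
  obtain ⟨_ | _ | _ | m', hm⟩ := α.surjective m
  · exact absurd (hm.symm.trans hj) h₄
  · exact absurd (hm.symm.trans hi) h₃
  · exact absurd (hm.symm.trans hl) h₅
  · obtain ⟨n, rfl⟩ : ∃ m, n = m + 1 := ⟨n - 1, by have := m'.isLt; omega⟩
    obtain ⟨β, hβ⟩ := exists_option_equiv m'
    exact ⟨n, rfl, (consOpt (consOpt (consOpt β))).trans α, hj, hi, hl,
      (congrArg (fun x => α (some (some (some x)))) hβ).trans hm⟩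

/-! ### Bijections that compare iterated compositions -/

section AssocEquivs

variable {A B C : Type}

/-- `(A ⨿ B) \ {b} ⨿ C = A ⨿ (B \ {b} ⨿ C)`. -/
def assocDelRight (b : B) : {w : A ⊕ B // w ≠ Sum.inr b} ⊕ C ≃ A ⊕ ({x : B // x ≠ b} ⊕ C) where
  toFun
    | .inl ⟨.inl x, _⟩ => .inl x
    | .inl ⟨.inr x, h⟩ => .inr (.inl ⟨x, fun e => h (e ▸ rfl)⟩)
    | .inr x => .inr (.inr x)
  invFun
    | .inl x => .inl ⟨.inl x, by simp⟩
    | .inr (.inl x) => .inl ⟨.inr x.1, by simpa using x.2⟩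
    | .inr (.inr x) => .inr x
  left_inv := by rintro (⟨x | x, h⟩ | x) <;> rfl
  right_inv := by rintro (x | x | x) <;> rfl

/-- `(A ⨿ B \ {b}) ⨿ C = A ⨿ (B ⨿ C) \ {b}`. -/
def assocDelLeft (b : B) : (A ⊕ {x : B // x ≠ b}) ⊕ C ≃ A ⊕ {w : B ⊕ C // w ≠ Sum.inl b} where
  toFun
    | .inl (.inl x) => .inl x
    | .inl (.inr x) => .inr ⟨.inl x.1, by simpa using x.2⟩
    | .inr x => .inr ⟨.inr x, by simp⟩
  invFun
    | .inl x => .inl (.inl x)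
    | .inr ⟨.inl x, h⟩ => .inl (.inr ⟨x, fun e => h (e ▸ rfl)⟩)
    | .inr ⟨.inr x, _⟩ => .inr x
  left_inv := by rintro ((x | x) | x) <;> rfl
  right_inv := by rintro (x | ⟨x | x, h⟩) <;> rfl

/-- `A ⨿ (B ⨿ C) = B ⨿ (A ⨿ C)`. -/
def sumLeftComm : A ⊕ (B ⊕ C) ≃ B ⊕ (A ⊕ C) where
  toFun
    | .inl x => .inr (.inl x)
    | .inr (.inl x) => .inl x
    | .inr (.inr x) => .inr (.inr x)
  invFun
    | .inl x => .inr (.inl x)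
    | .inr (.inl x) => .inl x
    | .inr (.inr x) => .inr (.inr x)
  left_inv := by rintro (x | x | x) <;> rfl
  right_inv := by rintro (x | x | x) <;> rfl

/-- `(A ⨿ B) ⨿ C = (A ⨿ C) ⨿ B`. -/
def sumRightComm : (A ⊕ B) ⊕ C ≃ (A ⊕ C) ⊕ B where
  toFun
    | .inl (.inl x) => .inl (.inl x)
    | .inl (.inr x) => .inr x
    | .inr x => .inl (.inr x)
  invFun
    | .inl (.inl x) => .inl (.inl x)
    | .inl (.inr x) => .inr x
    | .inr x => .inl (.inr x)
  left_inv := by rintro ((x | x) | x) <;> rfl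
  right_inv := by rintro ((x | x) | x) <;> rfl

/-- `A ⨿ (B ⨿ C \ {c}) \ {c'} = B ⨿ (A ⨿ C \ {c'}) \ {c}`. -/
def delLeftComm {c c' : C} (h : c' ≠ c) :
    A ⊕ {w : B ⊕ {x : C // x ≠ c} // w ≠ Sum.inr ⟨c', h⟩} ≃
      B ⊕ {w : A ⊕ {x : C // x ≠ c'} // w ≠ Sum.inr ⟨c, h.symm⟩} where
  toFun
    | .inl x => .inr ⟨.inl x, by simp⟩
    | .inr ⟨.inl x, _⟩ => .inl x
    | .inr ⟨.inr x, h⟩ => .inr ⟨.inr ⟨x.1, fun e => h (congrArg Sum.inr (Subtype.ext e))⟩,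
        fun e => x.2 (congrArg Subtype.val (Sum.inr.inj e))⟩
  invFun
    | .inl x => .inr ⟨.inl x, by simp⟩
    | .inr ⟨.inl x, _⟩ => .inl x
    | .inr ⟨.inr x, h⟩ => .inr ⟨.inr ⟨x.1, fun e => h (congrArg Sum.inr (Subtype.ext e))⟩,
        fun e => x.2 (congrArg Subtype.val (Sum.inr.inj e))⟩
  left_inv := by rintro (x | ⟨x | x, h⟩) <;> rfl
  right_inv := by rintro (x | ⟨x | x, h⟩) <;> rfl

/-- `(C \ {c} ⨿ A) \ {c'} ⨿ B = (C \ {c'} ⨿ B) \ {c} ⨿ A`. -/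
def delRightComm {c c' : C} (h : c' ≠ c) :
    {w : {x : C // x ≠ c} ⊕ A // w ≠ Sum.inl ⟨c', h⟩} ⊕ B ≃
      {w : {x : C // x ≠ c'} ⊕ B // w ≠ Sum.inl ⟨c, h.symm⟩} ⊕ A where
  toFun
    | .inl ⟨.inl x, h⟩ => .inl ⟨.inl ⟨x.1, fun e => h (congrArg Sum.inl (Subtype.ext e))⟩,
        fun e => x.2 (congrArg Subtype.val (Sum.inl.inj e))⟩
    | .inl ⟨.inr x, _⟩ => .inr x
    | .inr x => .inl ⟨.inr x, by simp⟩
  invFun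
    | .inl ⟨.inl x, h⟩ => .inl ⟨.inl ⟨x.1, fun e => h (congrArg Sum.inl (Subtype.ext e))⟩,
        fun e => x.2 (congrArg Subtype.val (Sum.inl.inj e))⟩
    | .inl ⟨.inr x, _⟩ => .inr x
    | .inr x => .inl ⟨.inr x, by simp⟩
  left_inv := by rintro (⟨x | x, h⟩ | x) <;> rfl
  right_inv := by rintro (⟨x | x, h⟩ | x) <;> rfl

end AssocEquivs

section AssocIsos

variable {X Y Z : FB × FB}

/-- The bijection that compares `(z ∘ y) ∘ x` with `z ∘ (y ∘ x)`. -/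
def circAssoc (S₁ : Z.1) (T₁ : Y.2) (S₂ : Y.1) (T₂ : X.2) :
    circ (circ Z Y S₁ T₁) X (.inr S₂) T₂ ⟶ circ Z (circ Y X S₂ T₂) S₁ (.inl T₁) :=
  biHom (assocDelRight S₂) (assocDelLeft T₁)

/-- The bijection that compares `x ∘ (z ∘ y)` with `z ∘ (x ∘ y)`. -/
def circLeftComm (S₁ : Z.1) (S₂ : X.1) {T₁ T₂ : Y.2} (h : T₂ ≠ T₁) :
    circ X (circ Z Y S₁ T₁) S₂ (.inr ⟨T₂, h⟩) ⟶ circ Z (circ X Y S₂ T₂) S₁ (.inr ⟨T₁, h.symm⟩) :=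
  biHom sumLeftComm (delLeftComm h)

/-- The bijection that compares `(z ∘ y) ∘ x` with `(z ∘ x) ∘ y`. -/
def circRightComm {S₁ S₂ : Z.1} (h : S₂ ≠ S₁) (T₁ : Y.2) (T₂ : X.2) :
    circ (circ Z Y S₁ T₁) X (.inl ⟨S₂, h⟩) T₂ ⟶ circ (circ Z X S₂ T₂) Y (.inl ⟨S₁, h.symm⟩) T₁ :=
  biHom (delRightComm h) sumRightComm

end AssocIsos

/-! ### Double contractions of three pieces in a chain -/

namespace Config

variable {k : Type v} [Field k] {ε : Twist} {M : BiMod k} {P : FB × FB} {I I' : Type} {d n : ℕ}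
  {J : Type}

/-- Comparison of two configurations that differ in one piece. -/
lemma tgen_congr_none {C : Config P (Option J)} {C' : Config P (Option J)}
    (e : Option J ≃ Fin d) (a : ∀ i, M.obj (C.Q i)) (a' : ∀ i, M.obj (C'.Q i))
    (r : C.Q none ⟶ C'.Q none) (h₁ : ∀ x, C'.p₁ _ (fstEquiv r x) = C.p₁ none x)
    (h₂ : ∀ x, C'.p₂ _ (sndEquiv r x) = C.p₂ none x) (h₃ : a' none = (M.map r).hom (a none))
    (h : ∀ j, ∃ r : C.Q (some j) ⟶ C'.Q (some j), (∀ x, C'.p₁ _ (fstEquiv r x) = C.p₁ (some j) x) ∧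
      (∀ x, C'.p₂ _ (sndEquiv r x) = C.p₂ (some j) x) ∧ a' (some j) = (M.map r).hom (a (some j))) :
    C.tgen ε e a = C'.tgen ε e a' :=
  (tgen_congr C C' e a a' fun i => by
    rcases i with _ | j
    exacts [⟨r, h₁, h₂, h₃⟩, h j]).symm

variable {μ : day M M ⟶ day M (kk11 k)} [CharZero k] (hμ : IsSymmetric μ)

section Assoc

variable (C : Config P (Option (Option (Option J)))) (S₁ : (C.Q (some (some none))).1)
  (T₁ : (C.Q (some none)).2) (S₂ : (C.Q (some none)).1) (T₂ : (C.Q none).2)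
  (f : J ≃ Fin n) (a : ∀ i, M.obj (C.Q i))
  {s₁ s₂ : P.1} {t₁ t₂ : P.2} (hs₁ : C.p₁ (some (some none)) S₁ = s₁) (ht₁ : C.p₂ (some none) T₁ = t₁)
  (hs₂ : C.p₁ (some none) S₂ = s₂) (ht₂ : C.p₂ none T₂ = t₂) (hs : s₂ ≠ s₁) (ht : t₂ ≠ t₁)

/-- The configuration for `z ∘ (y ∘ x)`. -/
abbrev assocConfig : Config (biDel (biDel P s₂ t₂) ⟨s₁, hs.symm⟩ ⟨t₁, ht.symm⟩) (Option J) :=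
  (C.contract S₂ T₂ hs₂ ht₂).contract (s := ⟨s₁, hs.symm⟩) (t := ⟨t₁, ht.symm⟩)
    S₁ (.inl T₁) (Subtype.ext hs₁) (Subtype.ext ht₁)

/-- Elements on the pieces of `assocConfig`. -/
abbrev assocElt (z : M.obj (circ (C.Q (some (some none)))
    (circ (C.Q (some none)) (C.Q none) S₂ T₂) S₁ (.inl T₁))) :
    ∀ i, M.obj ((C.assocConfig S₁ T₁ S₂ T₂ hs₁ ht₁ hs₂ ht₂ hs ht).Q i) :=
  contractElt (C.contract S₂ T₂ hs₂ ht₂) (s := ⟨s₁, hs.symm⟩) (t := ⟨t₁, ht.symm⟩)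
    S₁ (.inl T₁) (Subtype.ext hs₁) (Subtype.ext ht₁)
    (C.contractVal S₂ T₂ hs₂ ht₂ μ a) z

include hμ in
-- The pieces stand in the order z, y, x. Both contractions concern the last two pieces in the right
-- order, so there is no sign.
lemma extendTotal_extendTotal_assoc :
    extendTotal ε μ (biDel P s₂ t₂) ⟨s₁, hs.symm⟩ ⟨t₁, ht.symm⟩ (extendTotal ε μ P s₂ t₂
      (C.tgen ε (optFin (optFin (optFin f))) a)) =
    (C.assocConfig S₁ T₁ S₂ T₂ hs₁ ht₁ hs₂ ht₂ hs ht).tgen ε (optFin f)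
      (C.assocElt (μ := μ) S₁ T₁ S₂ T₂ a hs₁ ht₁ hs₂ ht₂ hs ht
        (circMul (Q₁ := circ (C.Q (some none)) (C.Q none) S₂ T₂) μ S₁ (.inl T₁) (a (some (some none)))
          (circMul μ S₂ T₂ (a (some none)) (a none)))) := by
  rw [extendTotal_tgen hμ C S₂ T₂ hs₂ ht₂]
  exact extendTotal_tgen hμ (C.contract S₂ T₂ hs₂ ht₂) (s := ⟨s₁, hs.symm⟩) (t := ⟨t₁, ht.symm⟩)
    S₁ (.inl T₁) (Subtype.ext hs₁)
    (Subtype.ext ht₁) f _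

include hμ in
lemma map_extendTotal_extendTotal_assoc :
    (((totalPow k ε).obj M).map (biDelSwap P hs ht)).hom
      (extendTotal ε μ (biDel P s₁ t₁) ⟨s₂, hs⟩ ⟨t₂, ht⟩ (extendTotal ε μ P s₁ t₁
        (C.tgen ε (optFin (optFin (optFin f))) a))) =
    (ε.sgn : ℤ) • (C.assocConfig S₁ T₁ S₂ T₂ hs₁ ht₁ hs₂ ht₂ hs ht).tgen ε (optFin f)
      (C.assocElt (μ := μ) S₁ T₁ S₂ T₂ a hs₁ ht₁ hs₂ ht₂ hs ht
        ((M.map (circAssoc S₁ T₁ S₂ T₂)).hom (circMul (Q₀ := circ (C.Q (some (some none))) (C.Q (some none)) S₁ T₁) μ (.inr S₂) T₂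
          (circMul μ S₁ T₁ (a (some (some none))) (a (some none))) (a none)))) := by
  -- From z, y, x to x, z, y in two exchanges, whose signs cancel.
  rw [C.tgen_swap₁, tgen_swap₂, Twist.sgn_smul_sgn_smul]
  rw [extendTotal_tgen hμ ((C.comp (swapTop _)).comp (consOpt (swapTop _))) S₁ T₁ hs₁ ht₁]
  -- The composite z ∘ y has to precede x; this exchange gives the only remaining sign.
  rw [tgen_swap₁, map_zsmul, map_zsmul]
  rw [extendTotal_tgen hμ ((((C.comp (swapTop _)).comp (consOpt (swapTop _))).contract S₁ T₁ hs₁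
    ht₁).comp (swapTop _)) (s := ⟨s₂, hs⟩) (t := ⟨t₂, ht⟩) (.inr S₂) T₂ (Subtype.ext hs₂) (Subtype.ext ht₂), map_tgen]
  congr 1
  refine tgen_congr_none _ _ _ (circAssoc S₁ T₁ S₂ T₂) ?_ ?_ rfl
    fun j => ⟨𝟙 _, fun _ => rfl, fun _ => rfl, (M.map_id_apply _).symm⟩
  · rintro (⟨x | x, h⟩ | x) <;> rfl
  · rintro ((x | x) | x) <;> rfl

end Assoc

section LeftComm

variable (C : Config P (Option (Option (Option J)))) (S₁ : (C.Q (some (some none))).1)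
  (S₂ : (C.Q (some none)).1) {T₁ T₂ : (C.Q none).2} (hT : T₂ ≠ T₁)
  (f : J ≃ Fin n) (a : ∀ i, M.obj (C.Q i))
  {s₁ s₂ : P.1} {t₁ t₂ : P.2} (hs₁ : C.p₁ (some (some none)) S₁ = s₁) (ht₁ : C.p₂ none T₁ = t₁)
  (hs₂ : C.p₁ (some none) S₂ = s₂) (ht₂ : C.p₂ none T₂ = t₂) (hs : s₂ ≠ s₁) (ht : t₂ ≠ t₁)

/-- The configuration for `z ∘ (x ∘ y)`. -/
abbrev leftCommConfig : Config (biDel (biDel P s₂ t₂) ⟨s₁, hs.symm⟩ ⟨t₁, ht.symm⟩) (Option J) :=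
  (C.contract S₂ T₂ hs₂ ht₂).contract (s := ⟨s₁, hs.symm⟩) (t := ⟨t₁, ht.symm⟩)
    S₁ (.inr ⟨T₁, hT.symm⟩) (Subtype.ext hs₁) (Subtype.ext ht₁)

/-- Elements on the pieces of `leftCommConfig`. -/
abbrev leftCommElt (z : M.obj (circ (C.Q (some (some none)))
    (circ (C.Q (some none)) (C.Q none) S₂ T₂) S₁ (.inr ⟨T₁, hT.symm⟩))) :
    ∀ i, M.obj ((C.leftCommConfig S₁ S₂ hT hs₁ ht₁ hs₂ ht₂ hs ht).Q i) :=
  contractElt (C.contract S₂ T₂ hs₂ ht₂) (s := ⟨s₁, hs.symm⟩) (t := ⟨t₁, ht.symm⟩)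
    S₁ (.inr ⟨T₁, hT.symm⟩) (Subtype.ext hs₁) (Subtype.ext ht₁)
    (C.contractVal S₂ T₂ hs₂ ht₂ μ a) z

include hμ in
lemma extendTotal_extendTotal_leftComm :
    extendTotal ε μ (biDel P s₂ t₂) ⟨s₁, hs.symm⟩ ⟨t₁, ht.symm⟩ (extendTotal ε μ P s₂ t₂
      (C.tgen ε (optFin (optFin (optFin f))) a)) =
    (C.leftCommConfig S₁ S₂ hT hs₁ ht₁ hs₂ ht₂ hs ht).tgen ε (optFin f)
      (C.leftCommElt (μ := μ) S₁ S₂ hT a hs₁ ht₁ hs₂ ht₂ hs ht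
        (circMul (Q₁ := circ (C.Q (some none)) (C.Q none) S₂ T₂) μ S₁ (.inr ⟨T₁, hT.symm⟩)
          (a (some (some none))) (circMul μ S₂ T₂ (a (some none)) (a none)))) := by
  rw [extendTotal_tgen hμ C S₂ T₂ hs₂ ht₂]
  exact extendTotal_tgen hμ (C.contract S₂ T₂ hs₂ ht₂) (s := ⟨s₁, hs.symm⟩) (t := ⟨t₁, ht.symm⟩)
    S₁ (.inr ⟨T₁, hT.symm⟩) (Subtype.ext hs₁) (Subtype.ext ht₁) f _

include hμ in
-- One exchange turns z, x, y into x, z, y. Then z ∘ y is formed in the last place, already after x,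
-- so a single sign remains.
lemma map_extendTotal_extendTotal_leftComm :
    (((totalPow k ε).obj M).map (biDelSwap P hs ht)).hom
      (extendTotal ε μ (biDel P s₁ t₁) ⟨s₂, hs⟩ ⟨t₂, ht⟩ (extendTotal ε μ P s₁ t₁
        (C.tgen ε (optFin (optFin (optFin f))) a))) =
    (ε.sgn : ℤ) • (C.leftCommConfig S₁ S₂ hT hs₁ ht₁ hs₂ ht₂ hs ht).tgen ε (optFin f)
      (C.leftCommElt (μ := μ) S₁ S₂ hT a hs₁ ht₁ hs₂ ht₂ hs ht
        ((M.map (circLeftComm S₁ S₂ hT)).hom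
          (circMul (Q₁ := circ (C.Q (some (some none))) (C.Q none) S₁ T₁) μ S₂ (.inr ⟨T₂, hT⟩)
            (a (some none)) (circMul μ S₁ T₁ (a (some (some none))) (a none))))) := by
  rw [C.tgen_swap₂, map_zsmul, map_zsmul, map_zsmul]
  rw [extendTotal_tgen hμ (C.comp (consOpt (swapTop _))) S₁ T₁ hs₁ ht₁]
  rw [extendTotal_tgen hμ ((C.comp (consOpt (swapTop _))).contract S₁ T₁ hs₁ ht₁)
    (s := ⟨s₂, hs⟩) (t := ⟨t₂, ht⟩) S₂ (.inr ⟨T₂, hT⟩) (Subtype.ext hs₂) (Subtype.ext ht₂), map_tgen]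
  congr 1
  refine tgen_congr_none _ _ _ (circLeftComm S₁ S₂ hT) ?_ ?_ rfl
    fun j => ⟨𝟙 _, fun _ => rfl, fun _ => rfl, (M.map_id_apply _).symm⟩
  · rintro (x | x | x) <;> rfl
  · rintro (x | ⟨x | x, h⟩) <;> rfl

end LeftComm

section RightComm

variable (C : Config P (Option (Option (Option J)))) {S₁ S₂ : (C.Q (some none)).1} (hS : S₂ ≠ S₁)
  (T₁ : (C.Q (some (some none))).2) (T₂ : (C.Q none).2)
  (f : J ≃ Fin n) (a : ∀ i, M.obj (C.Q i))
  {s₁ s₂ : P.1} {t₁ t₂ : P.2} (hs₁ : C.p₁ (some none) S₁ = s₁)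
  (ht₁ : C.p₂ (some (some none)) T₁ = t₁)
  (hs₂ : C.p₁ (some none) S₂ = s₂) (ht₂ : C.p₂ none T₂ = t₂) (hs : s₂ ≠ s₁) (ht : t₂ ≠ t₁)

/-- The configuration for `(z ∘ x) ∘ y`. -/
abbrev rightCommConfig : Config (biDel (biDel P s₂ t₂) ⟨s₁, hs.symm⟩ ⟨t₁, ht.symm⟩) (Option J) :=
  ((C.contract S₂ T₂ hs₂ ht₂).comp (swapTop _)).contract (s := ⟨s₁, hs.symm⟩) (t := ⟨t₁, ht.symm⟩)
    (.inl ⟨S₁, hS.symm⟩) T₁ (Subtype.ext hs₁) (Subtype.ext ht₁)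

/-- Elements on the pieces of `rightCommConfig`. -/
abbrev rightCommElt (z : M.obj (circ (circ (C.Q (some none)) (C.Q none) S₂ T₂)
    (C.Q (some (some none))) (.inl ⟨S₁, hS.symm⟩) T₁)) :
    ∀ i, M.obj ((C.rightCommConfig hS T₁ T₂ hs₁ ht₁ hs₂ ht₂ hs ht).Q i) :=
  contractElt ((C.contract S₂ T₂ hs₂ ht₂).comp (swapTop _)) (s := ⟨s₁, hs.symm⟩)
    (t := ⟨t₁, ht.symm⟩) (.inl ⟨S₁, hS.symm⟩) T₁ (Subtype.ext hs₁) (Subtype.ext ht₁)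
    (compVal _ (swapTop _) (C.contractVal S₂ T₂ hs₂ ht₂ μ a)) z

include hμ in
-- The order is y, z, x. The composite z ∘ x arises in the last place but must precede y, so here
-- the sign is on this side.
lemma extendTotal_extendTotal_rightComm :
    extendTotal ε μ (biDel P s₂ t₂) ⟨s₁, hs.symm⟩ ⟨t₁, ht.symm⟩ (extendTotal ε μ P s₂ t₂
      (C.tgen ε (optFin (optFin (optFin f))) a)) =
    (ε.sgn : ℤ) • (C.rightCommConfig hS T₁ T₂ hs₁ ht₁ hs₂ ht₂ hs ht).tgen ε (optFin f)
      (C.rightCommElt (μ := μ) hS T₁ T₂ a hs₁ ht₁ hs₂ ht₂ hs ht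
        (circMul (Q₀ := circ (C.Q (some none)) (C.Q none) S₂ T₂) μ (.inl ⟨S₁, hS.symm⟩) T₁
          (circMul μ S₂ T₂ (a (some none)) (a none)) (a (some (some none))))) := by
  rw [extendTotal_tgen hμ C S₂ T₂ hs₂ ht₂, tgen_swap₁, map_zsmul]
  congr 1
  exact extendTotal_tgen hμ ((C.contract S₂ T₂ hs₂ ht₂).comp (swapTop _)) (s := ⟨s₁, hs.symm⟩)
    (t := ⟨t₁, ht.symm⟩) (.inl ⟨S₁, hS.symm⟩) T₁ (Subtype.ext hs₁) (Subtype.ext ht₁) f _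

include hμ in
-- Three exchanges turn y, z, x into x, z, y, and a fourth puts z ∘ y before x. The number is even,
-- so the two orders of contraction again differ by one sign.
lemma map_extendTotal_extendTotal_rightComm :
    (((totalPow k ε).obj M).map (biDelSwap P hs ht)).hom
      (extendTotal ε μ (biDel P s₁ t₁) ⟨s₂, hs⟩ ⟨t₂, ht⟩ (extendTotal ε μ P s₁ t₁
        (C.tgen ε (optFin (optFin (optFin f))) a))) =
    (C.rightCommConfig hS T₁ T₂ hs₁ ht₁ hs₂ ht₂ hs ht).tgen ε (optFin f)
      (C.rightCommElt (μ := μ) hS T₁ T₂ a hs₁ ht₁ hs₂ ht₂ hs ht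
        ((M.map (circRightComm hS T₁ T₂)).hom
          (circMul (Q₀ := circ (C.Q (some none)) (C.Q (some (some none))) S₁ T₁) μ
            (.inl ⟨S₂, hS⟩) T₂
            (circMul μ S₁ T₁ (a (some none)) (a (some (some none)))) (a none)))) := by
  rw [C.tgen_swap₂, tgen_swap₁, Twist.sgn_smul_sgn_smul, tgen_swap₂, map_zsmul]
  rw [extendTotal_tgen hμ (((C.comp (consOpt (swapTop _))).comp (swapTop _)).comp
    (consOpt (swapTop _))) S₁ T₁ hs₁ ht₁, tgen_swap₁, Twist.sgn_smul_sgn_smul]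
  rw [extendTotal_tgen hμ (((((C.comp (consOpt (swapTop _))).comp (swapTop _)).comp
    (consOpt (swapTop _))).contract S₁ T₁ hs₁ ht₁).comp (swapTop _))
    (s := ⟨s₂, hs⟩) (t := ⟨t₂, ht⟩) (.inl ⟨S₂, hS⟩) T₂ (Subtype.ext hs₂) (Subtype.ext ht₂), map_tgen]
  refine tgen_congr_none _ _ _ (circRightComm hS T₁ T₂) ?_ ?_ rfl
    fun j => ⟨𝟙 _, fun _ => rfl, fun _ => rfl, (M.map_id_apply _).symm⟩
  · rintro (⟨x | x, h⟩ | x) <;> rfl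
  · rintro ((x | x) | x) <;> rfl

end RightComm

end Config

/-! ### Associativity of the composition along walled pairs -/

section Injectivity

variable {k : Type v} [Field k] {M : BiMod k} {P : FB × FB}

lemma dsOf_injective {ι : Type} {A : ι → Type v} [∀ i, AddCommGroup (A i)] [∀ i, Module k (A i)]
    (i : ι) : Function.Injective (dsOf k A i) := by
  classical
  intro a b h
  have := congrArg (DirectSum.component k ι A i) h
  rwa [component_dsOf, component_dsOf, dif_pos rfl, dif_pos rfl] at this

lemma permAct_one_apply {d : ℕ} (v : (tpow d M).obj P) :
    permAct M (1 : Equiv.Perm (Fin d)) P v = v := by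
  refine LinearMap.congr_fun (g := LinearMap.id) (tpow_hom_ext fun c a => ?_) v
  rw [Config.tpowMk_eq_ofDec]
  exact (Config.ofDec c).permAct_pre (Equiv.refl _) a 1

/-- The symmetric group on one letter is trivial, so all defining relations are zero. -/
lemma gpowMk_one_injective (ε : Twist) : Function.Injective (gpowMk ε 1 M P) := by
  rw [← LinearMap.ker_eq_bot]
  refine (Submodule.ker_mkQ _).trans ((Submodule.span_eq_bot).2 ?_)
  rintro _ ⟨σ, v, rfl⟩
  obtain rfl : σ = 1 := Subsingleton.elim _ _
  rw [permAct_one_apply, ε.chi_one, Units.val_one, one_smul, sub_self]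

/-- An element of `S¹` or `Λ¹` determines the element on the only piece. -/
lemma Config.tgen_one_injective {ε : Twist} (C : Config P (Option Empty)) (e : Option Empty ≃ Fin 1)
    {a a' : ∀ i, M.obj (C.Q i)} (h : C.tgen ε e a = C.tgen ε e a') : a none = a' none := by
  have h₁ : tpowMk (C.dec e) (C.val e a) = tpowMk (C.dec e) (C.val e a') :=
    gpowMk_one_injective ε (dsOf_injective (k := k) (A := fun d => (gpow ε d M).obj P) 1 h)
  have h₂ := congrArg (PiTensorProduct.subsingletonEquiv (R := k) (e none)) (dsOf_injective _ h₁)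
  rw [PiTensorProduct.subsingletonEquiv_apply_tprod,
    PiTensorProduct.subsingletonEquiv_apply_tprod, C.val_eq e a rfl (C.isIncl_incl e none),
    C.val_eq e a' rfl (C.isIncl_incl e none)] at h₂
  let φ := C.incl e none
  have h₃ : ∀ x, (M.map (biHom (fstEquiv φ).symm (sndEquiv φ).symm)).hom ((M.map φ).hom x) = x := by
    intro x
    rw [BiMod.map_map]
    refine Eq.trans (congrArg (fun ψ => (M.map ψ).hom x) (?_ : _ = 𝟙 _)) (M.map_id_apply x)
    exact biMor_ext (fun x => (fstEquiv φ).symm_apply_apply x)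
      (fun x => (sndEquiv φ).symm_apply_apply x)
  rw [← h₃ (a none), ← h₃ (a' none)]
  exact congrArg _ h₂

end Injectivity

/-- The disjoint union of a family of pairs. -/
def Config.sigma {I : Type} [Finite I] (Q : I → FB × FB) :
    Config (⟨Σ i, (Q i).1.carrier⟩, ⟨Σ i, (Q i).2.carrier⟩) I where
  Q := Q
  p₁ i x := ⟨i, x⟩
  p₂ i x := ⟨i, x⟩
  bij₁ := Function.bijective_id
  bij₂ := Function.bijective_id

/-- A dependent function on three elements. -/
def tripleFun {F : Option (Option (Option Empty)) → Type*} (z : F (some (some none)))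
    (y : F (some none)) (x : F none) : ∀ i, F i
  | none => x
  | some none => y
  | some (some none) => z

section Associativity

variable {k : Type v} [Field k] {M : BiMod k} {μ : day M M ⟶ day M (kk11 k)}

/-- Brings associativity into the form in which the double contractions of configurations have been
computed. -/
lemma IsAssociative.extendTotal_comm (h : IsAssociative μ) (P : FB × FB) (s₁ s₂ : P.1) (t₁ t₂ : P.2)
    (hs : s₂ ≠ s₁) (ht : t₂ ≠ t₁) (v : (gpow .plus 3 M).obj P) :
    (((totalPow k .plus).obj M).map (biDelSwap P hs ht)).hom
      (extendTotal .plus μ (biDel P s₁ t₁) ⟨s₂, hs⟩ ⟨t₂, ht⟩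
        (extendTotal .plus μ P s₁ t₁ (totalOf .plus M P 3 v))) =
    extendTotal .plus μ (biDel P s₂ t₂) ⟨s₁, hs.symm⟩ ⟨t₁, ht.symm⟩
      (extendTotal .plus μ P s₂ t₂ (totalOf .plus M P 3 v)) := by
  rw [extendTotal_totalOf μ s₁ t₁ 1, extendTotal_totalOf μ s₂ t₂ 1]
  refine (congrArg _ (extendTotal_totalOf μ _ _ 0 _)).trans ((map_totalOf _ _ _).trans ?_)
  refine Eq.trans ?_ (extendTotal_totalOf μ _ _ 0 _).symm
  exact congrArg _ (h P s₁ s₂ t₁ t₂ hs ht v)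

variable [CharZero k] (hμ : IsSymmetric μ) (h : IsAssociative μ) {X Y Z : FB × FB}

include hμ h

/-- Associativity in S³ is applied to a single generator, the disjoint union of the three pairs
decorated by z, y, x. Both double contractions are known, and their equality in S¹ is equality of
the two composites. -/
lemma circMul_assoc (S₁ : Z.1) (T₁ : Y.2) (S₂ : Y.1) (T₂ : X.2) (z : M.obj Z) (y : M.obj Y)
    (x : M.obj X) :
    (M.map (circAssoc S₁ T₁ S₂ T₂)).hom (circMul (Q₀ := circ Z Y S₁ T₁) μ (.inr S₂) T₂
      (circMul μ S₁ T₁ z y) x) =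
    circMul (Q₁ := circ Y X S₂ T₂) μ S₁ (.inl T₁) z (circMul μ S₂ T₂ y x) := by
  let C := Config.sigma (tripleFun (F := fun _ => FB × FB) Z Y X)
  let a : ∀ i, M.obj (C.Q i) := tripleFun (F := fun i => M.obj (C.Q i)) z y x
  let f : Empty ≃ Fin 0 := Equiv.equivOfIsEmpty _ _
  have hs : C.p₁ (some none) S₂ ≠ C.p₁ (some (some none)) S₁ := C.p₁_ne (by simp) _ _
  have ht : C.p₂ none T₂ ≠ C.p₂ (some none) T₁ := C.p₂_ne (by simp) _ _
  have key := h.extendTotal_comm _ _ _ _ _ hs ht (C.gen .plus (optFin (optFin (optFin f))) a)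
  have h₁ := C.map_extendTotal_extendTotal_assoc (ε := .plus) hμ S₁ T₁ S₂ T₂ f a rfl rfl rfl rfl
    hs ht
  have h₂ := C.extendTotal_extendTotal_assoc (ε := .plus) hμ S₁ T₁ S₂ T₂ f a rfl rfl rfl rfl hs ht
  have h₃ := h₁.symm.trans (key.trans h₂)
  rw [show ((Twist.plus.sgn : ℤˣ) : ℤ) = 1 from rfl, one_smul] at h₃
  exact Config.tgen_one_injective _ _ h₃

/-- The same argument for two walled pairs whose points T₁, T₂ lie in the common piece y. -/
lemma circMul_leftComm (S₁ : Z.1) (S₂ : X.1) {T₁ T₂ : Y.2} (hT : T₂ ≠ T₁) (z : M.obj Z)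
    (x : M.obj X) (y : M.obj Y) :
    (M.map (circLeftComm S₁ S₂ hT)).hom (circMul (Q₁ := circ Z Y S₁ T₁) μ S₂ (.inr ⟨T₂, hT⟩) x
      (circMul μ S₁ T₁ z y)) =
    circMul (Q₁ := circ X Y S₂ T₂) μ S₁ (.inr ⟨T₁, hT.symm⟩) z (circMul μ S₂ T₂ x y) := by
  let C := Config.sigma (tripleFun (F := fun _ => FB × FB) Z X Y)
  let a : ∀ i, M.obj (C.Q i) := tripleFun (F := fun i => M.obj (C.Q i)) z x y
  let f : Empty ≃ Fin 0 := Equiv.equivOfIsEmpty _ _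
  have hs : C.p₁ (some none) S₂ ≠ C.p₁ (some (some none)) S₁ := C.p₁_ne (by simp) _ _
  have ht : C.p₂ none T₂ ≠ C.p₂ none T₁ := C.p₂_ne_of_ne hT
  have key := h.extendTotal_comm _ _ _ _ _ hs ht (C.gen .plus (optFin (optFin (optFin f))) a)
  have h₁ := C.map_extendTotal_extendTotal_leftComm (ε := .plus) hμ S₁ S₂ hT f a rfl rfl rfl rfl
    hs ht
  have h₂ := C.extendTotal_extendTotal_leftComm (ε := .plus) hμ S₁ S₂ hT f a rfl rfl rfl rfl hs ht
  have h₃ := h₁.symm.trans (key.trans h₂)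
  rw [show ((Twist.plus.sgn : ℤˣ) : ℤ) = 1 from rfl, one_smul] at h₃
  exact Config.tgen_one_injective _ _ h₃

/-- The same argument for two walled pairs whose points S₁, S₂ lie in the common piece z. The pieces
are listed as y, z, x to match the configuration lemmas. -/
lemma circMul_rightComm {S₁ S₂ : Z.1} (hS : S₂ ≠ S₁) (T₁ : Y.2) (T₂ : X.2) (y : M.obj Y)
    (z : M.obj Z) (x : M.obj X) :
    (M.map (circRightComm hS T₁ T₂)).hom (circMul (Q₀ := circ Z Y S₁ T₁) μ (.inl ⟨S₂, hS⟩) T₂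
      (circMul μ S₁ T₁ z y) x) =
    circMul (Q₀ := circ Z X S₂ T₂) μ (.inl ⟨S₁, hS.symm⟩) T₁ (circMul μ S₂ T₂ z x) y := by
  let C := Config.sigma (tripleFun (F := fun _ => FB × FB) Y Z X)
  let a : ∀ i, M.obj (C.Q i) := tripleFun (F := fun i => M.obj (C.Q i)) y z x
  let f : Empty ≃ Fin 0 := Equiv.equivOfIsEmpty _ _
  have hs : C.p₁ (some none) S₂ ≠ C.p₁ (some none) S₁ := C.p₁_ne_of_ne hS
  have ht : C.p₂ none T₂ ≠ C.p₂ (some (some none)) T₁ := C.p₂_ne (by simp) _ _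
  have key := h.extendTotal_comm _ _ _ _ _ hs ht (C.gen .plus (optFin (optFin (optFin f))) a)
  have h₁ := C.map_extendTotal_extendTotal_rightComm (ε := .plus) hμ hS T₁ T₂ f a rfl rfl rfl rfl
    hs ht
  have h₂ := C.extendTotal_extendTotal_rightComm (ε := .plus) hμ hS T₁ T₂ f a rfl rfl rfl rfl hs ht
  rw [show ((Twist.plus.sgn : ℤˣ) : ℤ) = 1 from rfl, one_smul] at h₂
  exact Config.tgen_one_injective _ _ (h₁.symm.trans (key.trans h₂))

end Associativity

/-! ### Commutation of contractions -/

section ContractionsCommute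

variable {k : Type v} [Field k] {M : BiMod k} {P : FB × FB}

/-- The contractions of two walled pairs commute on `v`, up to the sign of `ε`. -/
def ContractionsCommute (ε : Twist) (μ : day M M ⟶ day M (kk11 k)) {s₁ s₂ : P.1} {t₁ t₂ : P.2}
    (hs : s₂ ≠ s₁) (ht : t₂ ≠ t₁) (v : ((totalPow k ε).obj M).obj P) : Prop :=
  (((totalPow k ε).obj M).map (biDelSwap P hs ht)).hom
      (extendTotal ε μ (biDel P s₁ t₁) ⟨s₂, hs⟩ ⟨t₂, ht⟩ (extendTotal ε μ P s₁ t₁ v)) =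
    (ε.sgn : ℤ) • extendTotal ε μ (biDel P s₂ t₂) ⟨s₁, hs.symm⟩ ⟨t₁, ht.symm⟩
      (extendTotal ε μ P s₂ t₂ v)

variable {ε : Twist} {μ : day M M ⟶ day M (kk11 k)} {s₁ s₂ : P.1} {t₁ t₂ : P.2}
    {hs : s₂ ≠ s₁} {ht : t₂ ≠ t₁} {v : ((totalPow k ε).obj M).obj P}

/-- Renaming the pieces multiplies a generator by a sign, which this lemma discards. -/
lemma ContractionsCommute.zsmul (h : ContractionsCommute ε μ hs ht v) (z : ℤ) :
    ContractionsCommute ε μ hs ht (z • v) := by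
  unfold ContractionsCommute at h ⊢
  simp only [map_zsmul]
  rw [h, smul_comm]

/-- The sign squares to 1, and `biDelSwap` followed by the reverse exchange is the identity. This
makes the two walled pairs interchangeable in the case distinction. -/
lemma ContractionsCommute.symm (h : ContractionsCommute ε μ hs ht v) :
    ContractionsCommute ε μ hs.symm ht.symm v := by
  unfold ContractionsCommute at h ⊢
  rw [← ε.sgn_smul_sgn_smul (extendTotal ε μ (biDel P s₂ t₂) _ _ _), ← h, map_zsmul, BiMod.map_map]
  exact congrArg _ (BiMod.map_id_apply _ _)

end ContractionsCommute

namespace Config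

variable {k : Type v} [Field k] [CharZero k] {ε : Twist} {M : BiMod k} {P : FB × FB} {d n : ℕ}
  {J : Type} {μ : day M M ⟶ day M (kk11 k)} (hμ : IsSymmetric μ)

include hμ in
-- Both orders form the same two composites, so associativity plays no role. One order needs an even
-- number of exchanges; the other needs one more, to put the two composites into the same order.
lemma contractionsCommute_disjoint (C : Config P (Option (Option (Option (Option J)))))
    (S₁ : (C.Q (some (some (some none)))).1) (T₁ : (C.Q (some (some none))).2)
    (S₂ : (C.Q (some none)).1) (T₂ : (C.Q none).2) (f : J ≃ Fin n) (a : ∀ i, M.obj (C.Q i))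
    {s₁ s₂ : P.1} {t₁ t₂ : P.2} (hs₁ : C.p₁ (some (some (some none))) S₁ = s₁)
    (ht₁ : C.p₂ (some (some none)) T₁ = t₁) (hs₂ : C.p₁ (some none) S₂ = s₂)
    (ht₂ : C.p₂ none T₂ = t₂) (hs : s₂ ≠ s₁) (ht : t₂ ≠ t₁) :
    ContractionsCommute ε μ hs ht (C.tgen ε (optFin (optFin (optFin (optFin f)))) a) := by
  unfold ContractionsCommute
  -- With pieces A, B, C, D, this order gives A, B, CD, then CD, A, B after two exchanges.
  rw [extendTotal_tgen hμ C S₂ T₂ hs₂ ht₂, tgen_swap₁ (C.contract S₂ T₂ hs₂ ht₂),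
    tgen_swap₂ ((C.contract S₂ T₂ hs₂ ht₂).comp (swapTop _)), Twist.sgn_smul_sgn_smul]
  have h₂ := (extendTotal_tgen hμ (((C.contract S₂ T₂ hs₂ ht₂).comp (swapTop _)).comp
    (consOpt (swapTop _))) (s := ⟨s₁, hs.symm⟩) (t := ⟨t₁, ht.symm⟩) S₁ T₁ (Subtype.ext hs₁)
    (Subtype.ext ht₁) (optFin f) (compVal _ _ (compVal _ _ (C.contractVal S₂ T₂ hs₂ ht₂ μ a)))).trans
    (tgen_swap₁ (ε := ε) _ _ _)
  refine Eq.trans ?_ (congrArg (fun v => (ε.sgn : ℤ) • v) h₂).symm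
  -- The other order: four exchanges lead from A, B, C, D to C, D, A, B.
  rw [Twist.sgn_smul_sgn_smul, C.tgen_swap₂,
    tgen_swap₃ (C.comp _), Twist.sgn_smul_sgn_smul, tgen_swap₁ ((C.comp _).comp _),
    tgen_swap₂ (((C.comp _).comp _).comp _), Twist.sgn_smul_sgn_smul]
  rw [extendTotal_tgen hμ ((((C.comp (consOpt (swapTop _))).comp
    (consOpt (consOpt (swapTop _)))).comp (swapTop _)).comp (consOpt (swapTop _))) S₁ T₁ hs₁ ht₁,
    tgen_swap₁ (K := Option J), tgen_swap₂ (K := J), Twist.sgn_smul_sgn_smul]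
  -- Two further exchanges have turned C, D, AB into AB, C, D; the second contraction then gives AB,
  -- CD.
  rw [extendTotal_tgen hμ (((((((C.comp (consOpt (swapTop _))).comp
    (consOpt (consOpt (swapTop _)))).comp (swapTop _)).comp (consOpt (swapTop _))).contract S₁ T₁ hs₁
    ht₁).comp (swapTop _)).comp (consOpt (swapTop _))) (s := ⟨s₂, hs⟩) (t := ⟨t₂, ht⟩) S₂ T₂
    (Subtype.ext hs₂) (Subtype.ext ht₂), map_tgen]
  refine tgen_congr_none _ _ _ (𝟙 _) ?_ ?_ (M.map_id_apply _).symm fun j => ?_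
  · rintro (x | x) <;> rfl
  · rintro (x | x) <;> rfl
  · rcases j with _ | j
    · refine ⟨𝟙 (circ _ _ _ _), ?_, ?_, (M.map_id_apply _).symm⟩ <;> rintro (x | x) <;> rfl
    · exact ⟨𝟙 (C.Q (some (some (some (some j))))), fun _ => rfl, fun _ => rfl,
        (M.map_id_apply _).symm⟩

section Zero

omit [CharZero k]

variable (C : Config P (Option (Option J))) (s₀ : (C.Q (some none)).1.carrier)
  (t₀ : (C.Q none).2.carrier) {s : P.1.carrier} {t : P.2.carrier}
  (hs : C.p₁ (some none) s₀ = s) (ht : C.p₂ none t₀ = t)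

/-- `Option.join` expresses the merging: it sends the last two names to `none` and keeps the others
apart. -/
lemma pieceOf_contract_fst (i : Option (Option J)) (x : (C.Q i).1) (h : C.p₁ i x ≠ s) :
    pieceOf (C.contract s₀ t₀ hs ht).bij₁ ⟨C.p₁ i x, h⟩ = i.join := by
  rcases i with _ | _ | j
  · exact pieceOf_apply (C.contract s₀ t₀ hs ht).bij₁ none (Sum.inr x)
  · exact pieceOf_apply (C.contract s₀ t₀ hs ht).bij₁ none
      (Sum.inl ⟨x, fun e => h (by rw [e, hs])⟩)
  · exact pieceOf_apply (C.contract s₀ t₀ hs ht).bij₁ (some j) x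

lemma pieceOf_contract_snd (i : Option (Option J)) (x : (C.Q i).2) (h : C.p₂ i x ≠ t) :
    pieceOf (C.contract s₀ t₀ hs ht).bij₂ ⟨C.p₂ i x, h⟩ = i.join := by
  rcases i with _ | _ | j
  · exact pieceOf_apply (C.contract s₀ t₀ hs ht).bij₂ none
      (Sum.inr ⟨x, fun e => h (by rw [e, ht])⟩)
  · exact pieceOf_apply (C.contract s₀ t₀ hs ht).bij₂ none (Sum.inl x)
  · exact pieceOf_apply (C.contract s₀ t₀ hs ht).bij₂ (some j) x

end Zero

variable (hd : IsDiagonal μ)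

include hμ hd in
-- One of the two edges is a loop, or both join the same two pieces, in which case the first
-- contraction turns the second edge into a loop. Diagonality then applies to the first or to the
-- second contraction.
lemma extendTotal_extendTotal_eq_zero (C : Config P (Fin d)) (a : ∀ i, M.obj (C.Q i))
    {i₁ i₂ j₁ j₂ : Fin d} (S₁ : (C.Q i₁).1) (T₁ : (C.Q j₁).2) (S₂ : (C.Q i₂).1) (T₂ : (C.Q j₂).2)
    {s₁ s₂ : P.1} {t₁ t₂ : P.2} (hs₁ : C.p₁ i₁ S₁ = s₁) (ht₁ : C.p₂ j₁ T₁ = t₁)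
    (hs₂ : C.p₁ i₂ S₂ = s₂) (ht₂ : C.p₂ j₂ T₂ = t₂) (hs : s₂ ≠ s₁) (ht : t₂ ≠ t₁)
    (h : i₁ = j₁ ∨ i₂ = j₂ ∨ ((i₂ = i₁ ∨ i₂ = j₁) ∧ (j₂ = i₁ ∨ j₂ = j₁))) :
    extendTotal ε μ (biDel P s₁ t₁) ⟨s₂, hs⟩ ⟨t₂, ht⟩
      (extendTotal ε μ P s₁ t₁ (C.tgen ε (Equiv.refl _) a)) = 0 := by
  by_cases h₁ : i₁ = j₁
  · rw [extendTotal_tgen_eq_zero hd C, map_zero]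
    rw [← hs₁, ← ht₁, pieceOf_apply, pieceOf_apply, h₁]
  · obtain ⟨n, rfl, α, rfl, rfl⟩ := exists_option₂_equiv h₁
    obtain ⟨i, rfl⟩ := α.surjective i₂
    obtain ⟨j, rfl⟩ := α.surjective j₂
    rw [C.tgen_comp ε α _ (optFin (optFin (Equiv.refl _))), map_zsmul, map_zsmul,
      extendTotal_tgen hμ (C.comp α) S₁ T₁ hs₁ ht₁, extendTotal_tgen_eq_zero hd, smul_zero]
    subst hs₂ ht₂
    refine ((C.comp α).pieceOf_contract_fst S₁ T₁ hs₁ ht₁ i S₂ hs).trans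
      (Eq.trans ?_ ((C.comp α).pieceOf_contract_snd S₁ T₁ hs₁ ht₁ j T₂ ht).symm)
    simp only [α.injective.eq_iff] at h
    rcases h with h | rfl | ⟨rfl | rfl, rfl | rfl⟩
    · simp at h
    all_goals rfl

variable (hA : IsAssociative μ)

include hμ hA in
-- The two orders have been written over the same configuration up to the sign; they differ only in
-- the composite piece, where `circMul_assoc` identifies the elements.
lemma contractionsCommute_option_assoc (C : Config P (Option (Option (Option J))))
    (S₁ : (C.Q (some (some none))).1) (T₁ : (C.Q (some none)).2) (S₂ : (C.Q (some none)).1)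
    (T₂ : (C.Q none).2) (f : J ≃ Fin n) (a : ∀ i, M.obj (C.Q i)) {s₁ s₂ : P.1} {t₁ t₂ : P.2}
    (hs₁ : C.p₁ (some (some none)) S₁ = s₁) (ht₁ : C.p₂ (some none) T₁ = t₁)
    (hs₂ : C.p₁ (some none) S₂ = s₂) (ht₂ : C.p₂ none T₂ = t₂) (hs : s₂ ≠ s₁) (ht : t₂ ≠ t₁) :
    ContractionsCommute ε μ hs ht (C.tgen ε (optFin (optFin (optFin f))) a) := by
  unfold ContractionsCommute
  rw [C.map_extendTotal_extendTotal_assoc hμ S₁ T₁ S₂ T₂ _ _ hs₁ ht₁ hs₂ ht₂ hs ht,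
    C.extendTotal_extendTotal_assoc hμ S₁ T₁ S₂ T₂ _ _ hs₁ ht₁ hs₂ ht₂ hs ht, circMul_assoc hμ hA]

include hμ hA in
lemma contractionsCommute_assoc (C : Config P (Fin d)) (a : ∀ i, M.obj (C.Q i))
    {i₁ j₁ j₂ : Fin d} (S₁ : (C.Q i₁).1) (T₁ : (C.Q j₁).2) (S₂ : (C.Q j₁).1) (T₂ : (C.Q j₂).2)
    {s₁ s₂ : P.1} {t₁ t₂ : P.2} (hs₁ : C.p₁ i₁ S₁ = s₁) (ht₁ : C.p₂ j₁ T₁ = t₁)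
    (hs₂ : C.p₁ j₁ S₂ = s₂) (ht₂ : C.p₂ j₂ T₂ = t₂) (hs : s₂ ≠ s₁) (ht : t₂ ≠ t₁)
    (h₁ : i₁ ≠ j₁) (h₂ : i₁ ≠ j₂) (h₃ : j₁ ≠ j₂) :
    ContractionsCommute ε μ hs ht (C.tgen ε (Equiv.refl _) a) := by
  obtain ⟨n, rfl, α, rfl, rfl, rfl⟩ := exists_option₃_equiv h₃ h₁ h₂
  rw [C.tgen_comp ε α _ (optFin (optFin (optFin (Equiv.refl _))))]
  exact ((C.comp α).contractionsCommute_option_assoc hμ hA S₁ T₁ S₂ T₂ _ _ hs₁ ht₁ hs₂ ht₂ hs ht).zsmul _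

include hμ hA in
lemma contractionsCommute_option_leftComm (C : Config P (Option (Option (Option J))))
    (S₁ : (C.Q (some (some none))).1) (S₂ : (C.Q (some none)).1) {T₁ T₂ : (C.Q none).2}
    (hT : T₂ ≠ T₁) (f : J ≃ Fin n) (a : ∀ i, M.obj (C.Q i)) {s₁ s₂ : P.1} {t₁ t₂ : P.2}
    (hs₁ : C.p₁ (some (some none)) S₁ = s₁) (ht₁ : C.p₂ none T₁ = t₁)
    (hs₂ : C.p₁ (some none) S₂ = s₂) (ht₂ : C.p₂ none T₂ = t₂) (hs : s₂ ≠ s₁) (ht : t₂ ≠ t₁) :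
    ContractionsCommute ε μ hs ht (C.tgen ε (optFin (optFin (optFin f))) a) := by
  unfold ContractionsCommute
  rw [C.map_extendTotal_extendTotal_leftComm hμ S₁ S₂ hT _ _ hs₁ ht₁ hs₂ ht₂ hs ht,
    C.extendTotal_extendTotal_leftComm hμ S₁ S₂ hT _ _ hs₁ ht₁ hs₂ ht₂ hs ht, circMul_leftComm hμ hA]

include hμ hA in
lemma contractionsCommute_leftComm (C : Config P (Fin d)) (a : ∀ i, M.obj (C.Q i))
    {i₁ i₂ j : Fin d} (S₁ : (C.Q i₁).1) (T₁ : (C.Q j).2) (S₂ : (C.Q i₂).1) (T₂ : (C.Q j).2)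
    {s₁ s₂ : P.1} {t₁ t₂ : P.2} (hs₁ : C.p₁ i₁ S₁ = s₁) (ht₁ : C.p₂ j T₁ = t₁)
    (hs₂ : C.p₁ i₂ S₂ = s₂) (ht₂ : C.p₂ j T₂ = t₂) (hs : s₂ ≠ s₁) (ht : t₂ ≠ t₁)
    (h₁ : i₁ ≠ i₂) (h₂ : i₁ ≠ j) (h₃ : i₂ ≠ j) :
    ContractionsCommute ε μ hs ht (C.tgen ε (Equiv.refl _) a) := by
  obtain ⟨n, rfl, α, rfl, rfl, rfl⟩ := exists_option₃_equiv h₃ h₁ h₂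
  have hT : T₂ ≠ T₁ := fun e => ht (by rw [← ht₁, ← ht₂, e])
  rw [C.tgen_comp ε α _ (optFin (optFin (optFin (Equiv.refl _))))]
  exact ((C.comp α).contractionsCommute_option_leftComm hμ hA S₁ S₂ hT _ _ hs₁ ht₁ hs₂ ht₂ hs ht).zsmul _

include hμ hA in
lemma contractionsCommute_option_rightComm (C : Config P (Option (Option (Option J))))
    {S₁ S₂ : (C.Q (some none)).1} (hS : S₂ ≠ S₁) (T₁ : (C.Q (some (some none))).2)
    (T₂ : (C.Q none).2) (f : J ≃ Fin n) (a : ∀ i, M.obj (C.Q i)) {s₁ s₂ : P.1} {t₁ t₂ : P.2}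
    (hs₁ : C.p₁ (some none) S₁ = s₁) (ht₁ : C.p₂ (some (some none)) T₁ = t₁)
    (hs₂ : C.p₁ (some none) S₂ = s₂) (ht₂ : C.p₂ none T₂ = t₂) (hs : s₂ ≠ s₁) (ht : t₂ ≠ t₁) :
    ContractionsCommute ε μ hs ht (C.tgen ε (optFin (optFin (optFin f))) a) := by
  unfold ContractionsCommute
  rw [C.map_extendTotal_extendTotal_rightComm hμ hS T₁ T₂ _ _ hs₁ ht₁ hs₂ ht₂ hs ht,
    C.extendTotal_extendTotal_rightComm hμ hS T₁ T₂ _ _ hs₁ ht₁ hs₂ ht₂ hs ht, circMul_rightComm hμ hA, Twist.sgn_smul_sgn_smul]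

include hμ hA in
lemma contractionsCommute_rightComm (C : Config P (Fin d)) (a : ∀ i, M.obj (C.Q i))
    {i j₁ j₂ : Fin d} (S₁ : (C.Q i).1) (T₁ : (C.Q j₁).2) (S₂ : (C.Q i).1) (T₂ : (C.Q j₂).2)
    {s₁ s₂ : P.1} {t₁ t₂ : P.2} (hs₁ : C.p₁ i S₁ = s₁) (ht₁ : C.p₂ j₁ T₁ = t₁)
    (hs₂ : C.p₁ i S₂ = s₂) (ht₂ : C.p₂ j₂ T₂ = t₂) (hs : s₂ ≠ s₁) (ht : t₂ ≠ t₁)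
    (h₁ : j₁ ≠ i) (h₂ : j₁ ≠ j₂) (h₃ : i ≠ j₂) :
    ContractionsCommute ε μ hs ht (C.tgen ε (Equiv.refl _) a) := by
  obtain ⟨n, rfl, α, rfl, rfl, rfl⟩ := exists_option₃_equiv h₃ h₁ h₂
  have hS : S₂ ≠ S₁ := fun e => hs (by rw [← hs₁, ← hs₂, e])
  rw [C.tgen_comp ε α _ (optFin (optFin (optFin (Equiv.refl _))))]
  exact ((C.comp α).contractionsCommute_option_rightComm hμ hA hS T₁ T₂ _ _ hs₁ ht₁ hs₂ ht₂ hs ht).zsmul _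

include hμ hd hA in
-- The two walled pairs are edges, from the piece of s to the piece of t, and the cases are the
-- possible shapes of a graph with two edges.
lemma contractionsCommute (C : Config P (Fin d)) (a : ∀ i, M.obj (C.Q i)) {s₁ s₂ : P.1}
    {t₁ t₂ : P.2} (hs : s₂ ≠ s₁) (ht : t₂ ≠ t₁) :
    ContractionsCommute ε μ hs ht (C.tgen ε (Equiv.refl _) a) := by
  obtain ⟨i₁, S₁, hs₁⟩ := exists_piece C.bij₁ s₁
  obtain ⟨i₂, S₂, hs₂⟩ := exists_piece C.bij₁ s₂
  obtain ⟨j₁, T₁, ht₁⟩ := exists_piece C.bij₂ t₁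
  obtain ⟨j₂, T₂, ht₂⟩ := exists_piece C.bij₂ t₂
  by_cases h : i₁ = j₁ ∨ i₂ = j₂ ∨ ((i₂ = i₁ ∨ i₂ = j₁) ∧ (j₂ = i₁ ∨ j₂ = j₁))
  -- A loop or a double edge: the condition is symmetric in the two edges, so both orders give zero.
  · unfold ContractionsCommute
    rw [C.extendTotal_extendTotal_eq_zero hμ hd a S₁ T₁ S₂ T₂ hs₁ ht₁ hs₂ ht₂ hs ht h,
      C.extendTotal_extendTotal_eq_zero hμ hd a S₂ T₂ S₁ T₁ hs₂ ht₂ hs₁ ht₁ hs.symm ht.symm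
        (by grind), map_zero, smul_zero]
  -- Two edges that start at one piece.
  by_cases h₁ : i₂ = i₁
  · subst h₁
    exact C.contractionsCommute_rightComm hμ hA a S₁ T₁ S₂ T₂ hs₁ ht₁ hs₂ ht₂ hs ht (by grind)
      (by grind) (by grind)
  -- Two edges that end at one piece.
  by_cases h₂ : j₂ = j₁
  · subst h₂
    exact C.contractionsCommute_leftComm hμ hA a S₁ T₁ S₂ T₂ hs₁ ht₁ hs₂ ht₂ hs ht (by grind)
      (by grind) (by grind)
  -- A directed path with the first edge before the second, and below the same path with the edges
  -- exchanged.
  by_cases h₃ : i₂ = j₁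
  · subst h₃
    exact C.contractionsCommute_assoc hμ hA a S₁ T₁ S₂ T₂ hs₁ ht₁ hs₂ ht₂ hs ht (by grind)
      (by grind) (by grind)
  by_cases h₄ : j₂ = i₁
  · subst h₄
    exact (C.contractionsCommute_assoc hμ hA a S₂ T₂ S₁ T₁ hs₂ ht₂ hs₁ ht₁ hs.symm ht.symm
      (by grind) (by grind) (by grind)).symm
  -- The four pieces are now distinct, and the edges are disjoint.
  obtain ⟨n, rfl, α, rfl, rfl, rfl, rfl⟩ := exists_option₄_equiv (i := i₂) (j := j₂) (l := j₁)
    (m := i₁) (by grind) (by grind) (by grind) (by grind) (by grind) (by grind)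
  rw [C.tgen_comp ε α _ (optFin (optFin (optFin (optFin (Equiv.refl _)))))]
  exact ((C.comp α).contractionsCommute_disjoint hμ S₁ T₁ S₂ T₂ _ _ hs₁ ht₁ hs₂ ht₂ hs ht).zsmul _

end Config

/-! ### The modules over the walled Brauer categories -/

namespace Config

variable {k : Type v} [Field k] [CharZero k] {ε : Twist} {M : BiMod k} {P : FB × FB} {d : ℕ}
  {μ : day M M ⟶ day M (kk11 k)} (hμ : IsSymmetric μ) (hd : IsDiagonal μ)

include hμ hd

/-- A bijection changes only the placement of the pieces, not the pieces or their elements, so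
`contract` of the image is the image of `contract`. -/
lemma extendTotal_map_tgen (C : Config P (Fin d)) (a : ∀ i, M.obj (C.Q i)) {Q : FB × FB} (φ : P ⟶ Q)
    (s : P.1) (t : P.2) :
    extendTotal ε μ Q (fstEquiv φ s) (sndEquiv φ t)
      ((((totalPow k ε).obj M).map φ).hom (C.tgen ε (Equiv.refl _) a)) =
    (((totalPow k ε).obj M).map (delMap φ rfl rfl)).hom
      (extendTotal ε μ P s t (C.tgen ε (Equiv.refl _) a)) := by
  obtain ⟨i, S, rfl⟩ := exists_piece C.bij₁ s
  obtain ⟨j, T, rfl⟩ := exists_piece C.bij₂ t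
  by_cases h : i = j
  · subst h
    refine (congrArg _ (C.map_tgen _ a φ)).trans ((extendTotal_tgen_eq_zero hd (C.map φ) _ a _ _
      ((pieceOf_apply (C.map φ).bij₁ i S).trans (pieceOf_apply (C.map φ).bij₂ i T).symm)).trans ?_)
    rw [extendTotal_tgen_eq_zero hd C, map_zero]
    · rfl
    · rw [pieceOf_apply, pieceOf_apply]
  · obtain ⟨n, rfl, α, rfl, rfl⟩ := exists_option₂_equiv h
    rw [C.tgen_comp ε α _ (optFin (optFin (Equiv.refl _)))]
    simp only [map_zsmul]
    congr 1
    refine (congrArg _ ((C.comp α).map_tgen _ _ φ)).trans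
      ((extendTotal_tgen hμ ((C.comp α).map φ) S T rfl rfl _ _).trans (Eq.trans ?_ (congrArg _
        (extendTotal_tgen hμ (C.comp α) S T rfl rfl _ _)).symm))
    refine Eq.trans ?_ (map_tgen _ _ _ _).symm
    refine (tgen_congr_none _ _ _ (𝟙 (circ _ _ _ _)) ?_ ?_ (M.map_id_apply _).symm fun j =>
      ⟨𝟙 (C.Q (α (some (some j)))), fun _ => rfl, fun _ => rfl, (M.map_id_apply _).symm⟩).symm
    all_goals rintro (x | x) <;> rfl

/-- The two sides can differ only in the composite piece, where compatibility of `g` with the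
structure morphisms enters through `circMul_map`. -/
lemma extendTotal_totalPow_map_tgen {N : BiMod k} {ν : day N N ⟶ day N (kk11 k)}
    (hν : IsSymmetric ν) (hd' : IsDiagonal ν) (g : M ⟶ N)
    (hg : μ ≫ dayMap g (𝟙 (kk11 k)) = dayMap g g ≫ ν) (C : Config P (Fin d))
    (a : ∀ i, M.obj (C.Q i)) (s : P.1) (t : P.2) :
    (((totalPow k ε).map g).app (biDel P s t)).hom
      (extendTotal ε μ P s t (C.tgen ε (Equiv.refl _) a)) =
    extendTotal ε ν P s t
      ((((totalPow k ε).map g).app P).hom (C.tgen ε (Equiv.refl _) a)) := by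
  obtain ⟨i, S, rfl⟩ := exists_piece C.bij₁ s
  obtain ⟨j, T, rfl⟩ := exists_piece C.bij₂ t
  by_cases h : i = j
  · subst h
    have e : pieceOf C.bij₁ (C.p₁ i S) = pieceOf C.bij₂ (C.p₂ i T) := by
      rw [pieceOf_apply, pieceOf_apply]
    rw [totalPow_map_tgen, extendTotal_tgen_eq_zero hd C _ _ _ _ e,
      extendTotal_tgen_eq_zero hd' C _ _ _ _ e, map_zero]
  · obtain ⟨n, rfl, α, rfl, rfl⟩ := exists_option₂_equiv h
    rw [C.tgen_comp ε α _ (optFin (optFin (Equiv.refl _)))]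
    simp only [map_zsmul]
    congr 1
    refine (congrArg _ (extendTotal_tgen hμ (C.comp α) S T rfl rfl _ _)).trans
      ((totalPow_map_tgen _ _ _ _).trans (Eq.trans ?_ (congrArg _
        ((C.comp α).totalPow_map_tgen g _ _)).symm))
    refine Eq.trans ?_ (extendTotal_tgen hν (C.comp α) S T rfl rfl _ _).symm
    refine congrArg _ (funext fun j => ?_)
    rcases j with _ | j
    · exact (circMul_map μ ν g hg S T _ _).symm
    · rfl

end Config

section Functor

variable {k : Type v} [Field k] [CharZero k] (ε : Twist)

/-- The contractions of `S_⊚^* D` and `Λ_⊚^* D`. -/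
def DiOpd.contractions (D : DiOpd k) : Contractions ε ((totalPow k ε).obj D.toBiMod) where
  b := extendTotal ε D.mu
  nat {P Q} φ s t v := by
    refine LinearMap.congr_fun (f := extendTotal ε D.mu Q (fstEquiv φ s) (sndEquiv φ t) ∘ₗ
      (((totalPow k ε).obj D.toBiMod).map φ).hom)
      (g := (((totalPow k ε).obj D.toBiMod).map (delMap φ rfl rfl)).hom ∘ₗ
        extendTotal ε D.mu P s t) (total_hom_ext fun d C a => ?_) v
    exact C.extendTotal_map_tgen D.symmetric D.diagonal a φ s t
  comm P s₁ s₂ t₁ t₂ hs ht v := by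
    refine LinearMap.congr_fun
      (f := (((totalPow k ε).obj D.toBiMod).map (biDelSwap P hs ht)).hom ∘ₗ
        extendTotal ε D.mu (biDel P s₁ t₁) ⟨s₂, hs⟩ ⟨t₂, ht⟩ ∘ₗ extendTotal ε D.mu P s₁ t₁)
      (g := (ε.sgn : ℤ) • (extendTotal ε D.mu (biDel P s₂ t₂) ⟨s₁, hs.symm⟩ ⟨t₁, ht.symm⟩ ∘ₗ
        extendTotal ε D.mu P s₂ t₂)) (total_hom_ext fun d C a => ?_) v
    exact C.contractionsCommute D.symmetric D.diagonal D.associative a hs ht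

variable (k) in
/-- The functor from dioperads without unit to modules over the walled Brauer category. -/
def diOpdToDwbMod : DiOpd k ⥤ DwbMod k ε where
  obj D := (D.contractions ε).toDwbMod
  map {D E} g := (D.contractions ε).mapDwbMod (E.contractions ε) ((totalPow k ε).map g.hom)
    (fun P s t v => by
      refine LinearMap.congr_fun
        (f := (((totalPow k ε).map g.hom).app (biDel P s t)).hom ∘ₗ extendTotal ε D.mu P s t)
        (g := extendTotal ε E.mu P s t ∘ₗ (((totalPow k ε).map g.hom).app P).hom)
        (total_hom_ext fun d C a => ?_) v
      exact C.extendTotal_totalPow_map_tgen D.symmetric D.diagonal E.symmetric E.diagonal g.hom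
        g.comm a s t)
  map_id D := by
    refine ObjectProperty.hom_ext _ (NatTrans.ext (funext fun P => ?_))
    exact congrArg (fun α => α.app P.unop.pair) ((totalPow k ε).map_id D.toBiMod)
  map_comp f g := by
    refine ObjectProperty.hom_ext _ (NatTrans.ext (funext fun P => ?_))
    exact congrArg (fun α => α.app P.unop.pair) ((totalPow k ε).map_comp f.hom g.hom)

variable (k) in
/-- The modules have the underlying `k(FB × FB)`-modules `S_⊚^* D` and `Λ_⊚^* D`. -/
def diOpdToDwbModRestrict : diOpdToDwbMod k ε ⋙ dwbRestrict k ε ≅ DiOpd.forget k ⋙ totalPow k ε :=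
  NatIso.ofComponents (fun D => (D.contractions ε).restrictIso) (fun {D E} g => by
    refine NatTrans.ext (funext fun P => ?_)
    exact (Category.comp_id _).trans (Category.id_comp _).symm)

lemma isInduced_diOpdToDwbMod (D : DiOpd k) :
    IsInduced D ((diOpdToDwbMod k ε).obj D) ((diOpdToDwbModRestrict k ε).app D) := by
  intro P s t
  refine Eq.trans (Category.comp_id _) (Eq.trans ?_ (Category.id_comp _).symm)
  exact (D.contractions ε).toDwbMod_beta P s t

variable (k) in
lemma exists_dwbMod_functor :
    ∃ (Φ : DiOpd k ⥤ DwbMod k ε)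
      (e : Φ ⋙ dwbRestrict k ε ≅ DiOpd.forget k ⋙ totalPow k ε),
    (∀ D : DiOpd k, IsInduced D (Φ.obj D) (e.app D)) ∧
    ∀ (D : DiOpd k) (A : DwbMod k ε)
      (e' : (dwbRestrict k ε).obj A ≅ (totalPow k ε).obj D.toBiMod), IsInduced D A e' →
      ∃! i : Φ.obj D ≅ A, (dwbRestrict k ε).map i.hom ≫ e'.hom = e.hom.app D :=
  ⟨diOpdToDwbMod k ε, diOpdToDwbModRestrict k ε, isInduced_diOpdToDwbMod ε, fun D _ e' h =>
    existsUnique_dwbMod_iso ((diOpdToDwbModRestrict k ε).app D) e' _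
      (isInduced_diOpdToDwbMod ε D) h⟩

end Functor

end

theorem mainTheorem11 (k : Type v) [Field k] [CharZero k] :
    (∃ (Φ : DiOpd k ⥤ DwbMod k .plus)
        (e : Φ ⋙ dwbRestrict k .plus ≅ DiOpd.forget k ⋙ totalPow k .plus),
      (∀ D : DiOpd k, IsInduced D (Φ.obj D) (e.app D)) ∧
      ∀ (D : DiOpd k) (A : DwbMod k .plus)
        (e' : (dwbRestrict k .plus).obj A ≅ (totalPow k .plus).obj D.toBiMod), IsInduced D A e' →
        ∃! i : Φ.obj D ≅ A, (dwbRestrict k .plus).map i.hom ≫ e'.hom = e.hom.app D) ∧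
    (∃ (Φ : DiOpd k ⥤ DwbMod k .minus)
        (e : Φ ⋙ dwbRestrict k .minus ≅ DiOpd.forget k ⋙ totalPow k .minus),
      (∀ D : DiOpd k, IsInduced D (Φ.obj D) (e.app D)) ∧
      ∀ (D : DiOpd k) (A : DwbMod k .minus)
        (e' : (dwbRestrict k .minus).obj A ≅ (totalPow k .minus).obj D.toBiMod), IsInduced D A e' →
        ∃! i : Φ.obj D ≅ A, (dwbRestrict k .minus).map i.hom ≫ e'.hom = e.hom.app D) :=
  ⟨exists_dwbMod_functor k .plus, exists_dwbMod_functor k .minus⟩
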